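/- Let $M=\Gamma\backslash G$ be a nilmanifold of real dimension $6$, i.e. $G$ is a simply connected nilpotent Lie group with Lie algebra $\mathfrak g$ and $\Gamma\subset G$ is a discrete subgroup such that $\Gamma\backslash G$ is compact. An invariant complex structure $J$ on $M$ is one induced by a left-invariant (integrable) complex structure on $G$; an invariant $J$-Hermitian metric is one induced by a left-invariant $J$-Hermitian metric on $G$, with positive fundamental $(1,1)$-form $\Omega$. For such $\Omega$, $\gamma_1(\Omega)$ denotes the unique real constant for which there is a function $v\in C^\infty(M,\mathbb R)$ with $$\tfrac{i}{2}\,\partial\bar\partial(e^v\Omega)\wedge\Omega=\gamma_1(\Omega)\,e^v\,\Omega^3 .$$ Denote by $\mathfrak h_2=(0,0,0,0,12,34)$, $\mathfrak h_3=(0,0,0,0,0,12+34)$, $\mathfrak h_4=(0,0,0,0,12,14+23)$, $\mathfrak h_5=(0,0,0,0,13+42,14+23)$ the Lie algebras with a basis $e^1,\dots,e^6$ of the dual having the listed differentials $(de^1,\dots,de^6)$, where $ij$ stands for $e^i\wedge e^j$. (1) There exist an invariant complex structure $J$ on $M$ and an invariant $J$-Hermitian metric $\Omega$ with $\gamma_1(\Omega)<0$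 if and only if $\mathfrak g$ is isomorphic to $\mathfrak h_2$, $\mathfrak h_3$, $\mathfrak h_4$ or $\mathfrak h_5$. (2) Let $J$ be an invariant complex structure on $M$. Say that a basis $\omega^1,\omega^2,\omega^3$ of the invariant $(1,0)$-forms satisfies the reduced equations with parameters $\rho\in\{0,1\}$, $B\in\mathbb C$, $x,y\in\mathbb R$ if $$d\omega^1=d\omega^2=0,\qquad d\omega^3=\rho\,\omega^1\wedge\omega^2+\omega^1\wedge\bar\omega^1+B\,\omega^1\wedge\bar\omega^2+(x+iy)\,\omega^2\wedge\bar\omega^2 .$$ There is an invariant $J$-Hermitian metric $\Omega$ with $\gamma_1(\Omega)<0$ if and only if some basis of invariant $(1,0)$-forms satisfies the reduced equations with parameters such that $2x>\rho+|B|^2$. Moreover, whenever a basis of invariant $(1,0)$-forms satisfies the reduced equations with parameters $\rho,B,x,y$, there is an invariant $J$-Hermitian metric $\Omega$ with $\gamma_1(\Omega)<0$ if and only if $2x>\rho+|B|^2$. -/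

import Mathlib

open scoped Manifold ContDiff

/-! ## Left-invariant structures on a real Lie algebra -/

section LieAlgebraPart

variable {𝔤 : Type*} [LieRing 𝔤] [LieAlgebra ℝ 𝔤]

variable (𝔤) in
/-- A complex structure on the real Lie algebra `𝔤`: an endomorphism `J` with `J² = -1` whose
Nijenhuis tensor vanishes. For `𝔤 = Lie G` this is a left-invariant (integrable) complex structure
on `G`, equivalently an invariant complex structure on `Γ \ G`. -/
structure InvComplexStructure where
  /-- The endomorphism `J`. -/
  J : 𝔤 →ₗ[ℝ] 𝔤
  sq : ∀ X, J (J X) = -X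
  integrable : ∀ X Y, ⁅J X, J Y⁆ - ⁅X, Y⁆ - J ⁅J X, Y⁆ - J ⁅X, J Y⁆ = 0

/-- An invariant `J`-Hermitian metric: a `J`-invariant inner product on `𝔤`. -/
structure InvHermitianMetric (𝒥 : InvComplexStructure 𝔤) where
  /-- The metric. -/
  g : LinearMap.BilinForm ℝ 𝔤
  symm : ∀ X Y, g X Y = g Y X
  pos : ∀ X, X ≠ 0 → 0 < g X X
  compat : ∀ X Y, g (𝒥.J X) (𝒥.J Y) = g X Y

/-- The differential `dα (X, Y) = -α [X, Y]` of an invariant (real or complex valued) 1-form. -/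
def invD {V : Type*} [AddCommGroup V] [Module ℝ V] (α : 𝔤 →ₗ[ℝ] V) (X Y : 𝔤) : V :=
  -α ⁅X, Y⁆

/-- The wedge product `α ∧ β` of two functions on `𝔤` (1-forms), as a function of two vectors. -/
def wedge₁ {A : Type*} [CommRing A] (α β : 𝔤 → A) (X Y : 𝔤) : A :=
  α X * β Y - α Y * β X

variable (𝔤) in
/-- `𝔤 ≅ 𝔥₂ = (0,0,0,0,12,34)`: there is a basis `e¹,…,e⁶` of `𝔤*` (here `e 0,…,e 5`) with
`de¹ = de² = de³ = de⁴ = 0`, `de⁵ = e¹ ∧ e²`, `de⁶ = e³ ∧ e⁴`. -/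
def IsH2 : Prop :=
  ∃ e : Module.Basis (Fin 6) ℝ (Module.Dual ℝ 𝔤), ∀ X Y : 𝔤,
    invD (e 0) X Y = 0 ∧ invD (e 1) X Y = 0 ∧ invD (e 2) X Y = 0 ∧ invD (e 3) X Y = 0 ∧
    invD (e 4) X Y = wedge₁ (e 0) (e 1) X Y ∧
    invD (e 5) X Y = wedge₁ (e 2) (e 3) X Y

variable (𝔤) in
/-- `𝔤 ≅ 𝔥₃ = (0,0,0,0,0,12+34)`. -/
def IsH3 : Prop :=
  ∃ e : Module.Basis (Fin 6) ℝ (Module.Dual ℝ 𝔤), ∀ X Y : 𝔤,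
    invD (e 0) X Y = 0 ∧ invD (e 1) X Y = 0 ∧ invD (e 2) X Y = 0 ∧ invD (e 3) X Y = 0 ∧
    invD (e 4) X Y = 0 ∧
    invD (e 5) X Y = wedge₁ (e 0) (e 1) X Y + wedge₁ (e 2) (e 3) X Y

variable (𝔤) in
/-- `𝔤 ≅ 𝔥₄ = (0,0,0,0,12,14+23)`. -/
def IsH4 : Prop :=
  ∃ e : Module.Basis (Fin 6) ℝ (Module.Dual ℝ 𝔤), ∀ X Y : 𝔤,
    invD (e 0) X Y = 0 ∧ invD (e 1) X Y = 0 ∧ invD (e 2) X Y = 0 ∧ invD (e 3) X Y = 0 ∧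
    invD (e 4) X Y = wedge₁ (e 0) (e 1) X Y ∧
    invD (e 5) X Y = wedge₁ (e 0) (e 3) X Y + wedge₁ (e 1) (e 2) X Y

variable (𝔤) in
/-- `𝔤 ≅ 𝔥₅ = (0,0,0,0,13+42,14+23)`. -/
def IsH5 : Prop :=
  ∃ e : Module.Basis (Fin 6) ℝ (Module.Dual ℝ 𝔤), ∀ X Y : 𝔤,
    invD (e 0) X Y = 0 ∧ invD (e 1) X Y = 0 ∧ invD (e 2) X Y = 0 ∧ invD (e 3) X Y = 0 ∧
    invD (e 4) X Y = wedge₁ (e 0) (e 2) X Y + wedge₁ (e 3) (e 1) X Y ∧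
    invD (e 5) X Y = wedge₁ (e 0) (e 3) X Y + wedge₁ (e 1) (e 2) X Y

/-- The reduced complex structure equations: `η 0, η 1, η 2` (that is `ω¹, ω², ω³`) are three
`ℂ`-linearly independent invariant `(1,0)`-forms of `𝒥` (hence, when `dim 𝔤 = 6`, a basis of the
invariant `(1,0)`-forms) such that `ρ ∈ {0,1}`, `dω¹ = dω² = 0` and
`dω³ = ρ ω¹∧ω² + ω¹∧ω̄¹ + B ω¹∧ω̄² + (x + i y) ω²∧ω̄²`. -/
structure IsReducedBasis (𝒥 : InvComplexStructure 𝔤) (η : Fin 3 → 𝔤 →ₗ[ℝ] ℂ)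
    (ρ : ℝ) (B : ℂ) (x y : ℝ) : Prop where
  type_one_zero : ∀ j X, η j (𝒥.J X) = Complex.I * η j X
  linearIndependent : LinearIndependent ℂ η
  rho : ρ = 0 ∨ ρ = 1
  d_one : ∀ X Y, invD (η 0) X Y = 0
  d_two : ∀ X Y, invD (η 1) X Y = 0
  d_three : ∀ X Y, invD (η 2) X Y =
    ρ * wedge₁ (η 0) (η 1) X Y
      + wedge₁ (η 0) (fun Z ↦ star (η 0 Z)) X Y
      + B * wedge₁ (η 0) (fun Z ↦ star (η 1 Z)) X Y
      + (x + Complex.I * y) * wedge₁ (η 1) (fun Z ↦ star (η 1 Z)) X Y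

end LieAlgebraPart

/-! ## Differential forms on a six-dimensional Lie group and its quotients -/

instance instLEInftyMinSmoothness : ENat.LEInfty (minSmoothness ℝ 3) :=
  ⟨by rw [minSmoothness_of_isRCLikeNormedField]; exact ENat.LEInfty.out⟩

noncomputable section LieGroupPart

variable {G : Type*} [TopologicalSpace G] [ChartedSpace (EuclideanSpace ℝ (Fin 6)) G] [Group G]

variable (G) in
/-- Complex differential `k`-forms on the six-dimensional Lie group `G`, written in the global
frame of left-invariant vector fields: `α X` is the function obtained by evaluating the form on the
left-invariant fields `X 0, …, X (k-1)`. Forms on `Γ \ G` are the forms for which these functions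
are invariant under left translation by `Γ`. (All forms used below are alternating, multilinear
and smooth.) -/
abbrev DForm (k : ℕ) : Type _ := (Fin k → GroupLieAlgebra (𝓡 6) G) → G → ℂ

/-- The derivative of a complex function along the left-invariant vector field given by `X`. -/
def lieDer (X : GroupLieAlgebra (𝓡 6) G) (f : G → ℂ) (p : G) : ℂ :=
  mfderiv (𝓡 6) 𝓘(ℝ, ℂ) f p (mulInvariantVectorField X p)

/-- The exterior derivative, by the invariant formula
`dα (X₀,…,Xₖ) = ∑ⱼ (-1)ʲ Xⱼ (α (…,X̂ⱼ,…)) + ∑_{i<j} (-1)^{i+j} α ([Xᵢ,Xⱼ],…,X̂ᵢ,…,X̂ⱼ,…)`; in the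
second sum the bracket has been moved to the `i`-th place, which changes the sign to `(-1)ʲ`. -/
def extD {k : ℕ} (α : DForm G k) : DForm G (k + 1) := fun X p ↦
  ∑ j : Fin (k + 1), (-1 : ℂ) ^ (j : ℕ) * lieDer (X j) (α (j.removeNth X)) p
    + ∑ j : Fin (k + 1), ∑ i ∈ Finset.Iio j,
        (-1 : ℂ) ^ (j : ℕ) * α (j.removeNth (Function.update X i ⁅X i, X j⁆)) p

/-- The wedge product
`(α ∧ β) (X) = 1/(k! l!) ∑_σ sgn σ α (X_{σ 1},…,X_{σ k}) β (X_{σ (k+1)},…,X_{σ (k+l)})`. -/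
def wedge {k l : ℕ} (α : DForm G k) (β : DForm G l) : DForm G (k + l) := fun X p ↦
  ((k.factorial : ℂ) * (l.factorial : ℂ))⁻¹ *
    ∑ σ : Equiv.Perm (Fin (k + l)), ((Equiv.Perm.sign σ : ℤ) : ℂ) *
      α (fun i ↦ X (σ (Fin.castAdd l i))) p * β (fun i ↦ X (σ (Fin.natAdd k i))) p

/-- The pull-back of a form by an endomorphism of the tangent bundle that is constant in the
left-invariant frame. -/
def pullEnd {k : ℕ} (A : GroupLieAlgebra (𝓡 6) G →ₗ[ℝ] GroupLieAlgebra (𝓡 6) G)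
    (α : DForm G k) : DForm G k := fun X ↦ α (fun i ↦ A (X i))

variable [LieGroup (𝓡 6) ∞ G]

/-- `dᶜ = J⁻¹ d J`. As `J` multiplies a form of type `(p,q)` by `i^{p-q}` and `d = ∂ + ∂̄`, this is
`i (∂̄ - ∂)`. -/
def dc (𝒥 : InvComplexStructure (GroupLieAlgebra (𝓡 6) G)) {k : ℕ} (α : DForm G k) :
    DForm G (k + 1) := pullEnd (-𝒥.J) (extD (pullEnd 𝒥.J α))

/-- The operator `∂ = (d + i dᶜ) / 2`. -/
def del (𝒥 : InvComplexStructure (GroupLieAlgebra (𝓡 6) G)) {k : ℕ} (α : DForm G k) :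
    DForm G (k + 1) := fun X p ↦ (extD α X p + Complex.I * dc 𝒥 α X p) / 2

/-- The operator `∂̄ = (d - i dᶜ) / 2`. -/
def delBar (𝒥 : InvComplexStructure (GroupLieAlgebra (𝓡 6) G)) {k : ℕ} (α : DForm G k) :
    DForm G (k + 1) := fun X p ↦ (extD α X p - Complex.I * dc 𝒥 α X p) / 2

/-- The fundamental form `Ω (X, Y) = g (J X, Y)`, a positive `(1,1)`-form. -/
def fundamentalForm {𝒥 : InvComplexStructure (GroupLieAlgebra (𝓡 6) G)}
    (h : InvHermitianMetric 𝒥) : DForm G 2 := fun X _ ↦ ((h.g (𝒥.J (X 0)) (X 1) : ℝ) : ℂ)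

/-- The product of a form with a real function. -/
def funSmul {k : ℕ} (f : G → ℝ) (α : DForm G k) : DForm G k := fun X p ↦ (f p : ℂ) * α X p

/-- `γ₁ (Ω) = γ` on the compact complex threefold `Γ \ G`: there is a real smooth function `v` on
`Γ \ G`, i.e. a smooth function on `G` invariant under left translation by `Γ`, with
`(i/2) ∂∂̄ (eᵛ Ω) ∧ Ω = γ eᵛ Ω³`. -/
def IsGamma₁ (Γ : Subgroup G) {𝒥 : InvComplexStructure (GroupLieAlgebra (𝓡 6) G)}
    (h : InvHermitianMetric 𝒥) (γ : ℝ) : Prop :=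
  ∃ v : G → ℝ, ContMDiff (𝓡 6) 𝓘(ℝ, ℝ) ∞ v ∧ (∀ a ∈ Γ, ∀ p, v (a * p) = v p) ∧
    ∀ (X : Fin 6 → GroupLieAlgebra (𝓡 6) G) (p : G),
      Complex.I / 2 *
          wedge (del 𝒥 (delBar 𝒥 (funSmul (fun q ↦ Real.exp (v q)) (fundamentalForm h))))
            (fundamentalForm h) X p
        = (γ : ℂ) * (Real.exp (v p) : ℂ) *
            wedge (wedge (fundamentalForm h) (fundamentalForm h)) (fundamentalForm h) X p

/-- There is an invariant `J`-Hermitian metric `Ω` on `Γ \ G` with `γ₁ (Ω) < 0`. -/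
def AdmitsNegativeGamma₁ (Γ : Subgroup G)
    (𝒥 : InvComplexStructure (GroupLieAlgebra (𝓡 6) G)) : Prop :=
  ∃ h : InvHermitianMetric 𝒥, ∃ γ : ℝ, IsGamma₁ Γ h γ ∧ γ < 0

end LieGroupPart

/-!
Write an invariant metric in a unitary frame and let `S` be the contraction of the `(2,2)`-form
`(i/2) ∂∂̄Ω` with the metric, so that `(i/2) ∂∂̄Ω ∧ Ω = (S / 6) Ω³`
(`IsUnitaryFrame.sum_ddbar_eq`). The constant function `v = 0` therefore solves the equation
defining `γ₁` with the constant `S / 6` (`isGamma₁_ddbarTrace`). Conversely, for any solution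
`(v, γ)` one evaluates the equation at a minimum of `v` on the compact quotient: first derivatives
vanish there, second derivatives contribute a nonnegative multiple of a Laplacian, and `S / 6 ≤ γ`
follows (`IsGamma₁.ddbarTrace_le`). Hence there is an invariant metric with `γ₁ < 0` exactly if
there is one with `S < 0`, and the problem becomes one about the Lie algebra `𝔤` with its complex
structure.

On a nilpotent `𝔤`, the subspaces `𝔤ᵢ + J 𝔤ᵢ`, for `𝔤ᵢ` the lower central series, form a descending
`J`-invariant series, and integrability makes `ad X` complex linear modulo the next step. In a
unitary coframe adapted to this series (`exists_adapted_frame`) most structure constants vanish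
(`exists_structure_equations`), and `S` becomes a sum of squares minus `2 Re (B₂₂ B̄₁₁)`, where
`B₁₁` and `B₂₂` are the coefficients of `ω¹ ∧ ω̄¹` and `ω² ∧ ω̄²` in `dω³`
(`IsUnitaryCoframe.ddbarTrace_eq`). If `S < 0`, then `B₁₁` and `B₂₂` are nonzero, the Jacobi
identity gives `dω² = 0` and removes `ω³` from `dω³`, and a triangular change of basis produces the
reduced equations (`exists_isReducedBasis_of_ddbarTrace_neg`). For a reduced basis and an arbitrary
metric, Gram–Schmidt and the same formula show that `S` is a positive multiple of `ρ + |B|² - 2x`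
(`IsReducedBasis.exists_ddbarTrace_eq`), which settles the second statement.

For the first statement, the real and imaginary parts of `dω³` span a pencil of 2-forms on a space
of dimension four. Counting its decomposable members identifies the Lie algebra as one of the four
in the list (`IsReducedBasis.isH2_or_isH3_or_isH4_or_isH5`). Conversely, on each of the four an
explicit basis satisfies the reduced equations with `2x > ρ + |B|²`.
-/

/-! ### Alternating sums over permutations of six vectors -/

open Equiv in
/-- A function that changes sign under adjacent transpositions is alternating. -/
theorem alternating_perm_four {V R : Type*} [CommRing R] (A : V → V → V → V → R)
    (h01 : ∀ x y z w, A y x z w = -A x y z w) (h12 : ∀ x y z w, A x z y w = -A x y z w)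
    (h23 : ∀ x y z w, A x y w z = -A x y z w) (σ : Perm (Fin 4)) (X : Fin 4 → V) :
    A (X (σ 0)) (X (σ 1)) (X (σ 2)) (X (σ 3))
      = ((Perm.sign σ : ℤ) : R) * A (X 0) (X 1) (X 2) (X 3) := by
  have hσ : σ ∈ Submonoid.closure (Set.range fun i : Fin 3 ↦ swap i.castSucc i.succ) := by
    rw [Perm.mclosure_swap_castSucc_succ]; trivial
  induction hσ using Submonoid.closure_induction generalizing X with
  | one => simp
  | mul a b _ _ iha ihb =>
    have := ihb (X ∘ a)
    simp only [Function.comp_apply] at this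
    simp only [Perm.coe_mul, Function.comp_apply, this, iha, Perm.sign_mul, Units.val_mul,
      Int.cast_mul]
    ring
  | mem s hs =>
    obtain ⟨i, rfl⟩ := hs
    have e : Perm.sign (swap i.castSucc i.succ) = -1 :=
      Perm.sign_swap (Fin.castSucc_lt_succ).ne
    rw [e]
    fin_cases i
    · simpa [swap_apply_def] using h01 _ _ _ _
    · simpa [swap_apply_def] using h12 _ _ _ _
    · simpa [swap_apply_def] using h23 _ _ _ _

open Equiv in
/-- The alternating sum of `A ∧ w` over `S₆`, for `A` alternating of degree 4, reduced to a sum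
over the pair of vectors that `w` receives. -/
theorem sum_perm_six_eq {V R : Type*} [CommRing R] (A : V → V → V → V → R) (w : V → V → R)
    (h01 : ∀ x y z w, A y x z w = -A x y z w) (h12 : ∀ x y z w, A x z y w = -A x y z w)
    (h23 : ∀ x y z w, A x y w z = -A x y z w) (X : Fin 6 → V) :
    ∑ σ : Perm (Fin 6), ((Perm.sign σ : ℤ) : R) *
        A (X (σ 0)) (X (σ 1)) (X (σ 2)) (X (σ 3)) * w (X (σ 4)) (X (σ 5)) =
      24 * ∑ p : Fin 6, ∑ q : Fin 5, (if p = 0 then 1 else -1) * (if q = 0 then 1 else -1) *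
        A (X (swap 0 p (swap 0 q 1).succ)) (X (swap 0 p (swap 0 q 2).succ))
          (X (swap 0 p (swap 0 q 3).succ)) (X (swap 0 p (swap 0 q 4).succ))
          * w (X p) (X (swap 0 p q.succ)) := by
  -- `decomposeFin` splits off the first entries, so the arguments of `w` are rotated to the front
  rw [← Equiv.sum_comp (Equiv.mulRight (finRotate 6 ^ 2))]
  rw [← Equiv.sum_comp Perm.decomposeFin.symm, Fintype.sum_prod_type, Finset.mul_sum]
  refine Finset.sum_congr rfl fun p _ ↦ ?_
  rw [← Equiv.sum_comp Perm.decomposeFin.symm, Fintype.sum_prod_type, Finset.mul_sum]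
  refine Finset.sum_congr rfl fun q _ ↦ ?_
  have key : ∀ e : Perm (Fin 4),
      ((Perm.sign (Equiv.mulRight (finRotate 6 ^ 2)
        (Perm.decomposeFin.symm (p, Perm.decomposeFin.symm (q, e)))) : ℤ) : R) =
        (if p = 0 then 1 else -1) * (if q = 0 then 1 else -1) * ((Perm.sign e : ℤ) : R) := by
    intro e
    have h2 : Perm.sign (finRotate 6 ^ 2) = 1 := by
      rw [map_pow, sign_finRotate]; rfl
    simp only [Equiv.coe_mulRight, Perm.sign_mul, h2, mul_one, Perm.decomposeFin.symm_sign]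
    split_ifs <;> simp
  have r0 : (finRotate 6 ^ 2) 0 = (Fin.succ (Fin.succ 0) : Fin 6) := by decide
  have r1 : (finRotate 6 ^ 2) 1 = (Fin.succ (Fin.succ 1) : Fin 6) := by decide
  have r2 : (finRotate 6 ^ 2) 2 = (Fin.succ (Fin.succ 2) : Fin 6) := by decide
  have r3 : (finRotate 6 ^ 2) 3 = (Fin.succ (Fin.succ 3) : Fin 6) := by decide
  have r4 : (finRotate 6 ^ 2) 4 = (0 : Fin 6) := by decide
  have r5 : (finRotate 6 ^ 2) 5 = (Fin.succ 0 : Fin 6) := by decide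
  have t : ∀ e : Perm (Fin 4), _ := fun e ↦ alternating_perm_four A h01 h12 h23 e
    (fun i ↦ X (swap 0 p (swap 0 q i.succ).succ))
  have s2 : ∀ e : Perm (Fin 4), ((Perm.sign e : ℤ) : R) * ((Perm.sign e : ℤ) : R) = 1 := by
    intro e
    rw [← Int.cast_mul, ← Units.val_mul, Int.units_mul_self]; simp
  simp only [key]
  simp only [Equiv.coe_mulRight, Perm.coe_mul, Function.comp_apply, r0, r1, r2, r3, r4, r5,
    Perm.decomposeFin_symm_apply_succ, Perm.decomposeFin_symm_apply_zero, t]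
  have : ∀ c d f : R, ∀ e : Perm (Fin 4), c * ((Perm.sign e : ℤ) : R) *
      (((Perm.sign e : ℤ) : R) * d) * f = c * d * f := by
    intro c d f e
    linear_combination c * d * f * s2 e
  simp only [this, Finset.sum_const, Finset.card_univ, Fintype.card_perm, Fintype.card_fin]
  rw [nsmul_eq_mul, show ((Nat.factorial 4 : ℕ) : R) = 24 by norm_num [Nat.factorial]]
  rfl

/-- The same sum on a frame for which `w` pairs only `X₀` with `X₁`, `X₂` with `X₃` and `X₄` with
`X₅`. -/
theorem sum_perm_six_paired {V R : Type*} [CommRing R] (A : V → V → V → V → R) (w : V → V → R)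
    (h01 : ∀ x y z w, A y x z w = -A x y z w) (h12 : ∀ x y z w, A x z y w = -A x y z w)
    (h23 : ∀ x y z w, A x y w z = -A x y z w) (hw : ∀ x y, w y x = -w x y) (X : Fin 6 → V)
    (w02 : w (X 0) (X 2) = 0) (w03 : w (X 0) (X 3) = 0) (w04 : w (X 0) (X 4) = 0)
    (w05 : w (X 0) (X 5) = 0) (w12 : w (X 1) (X 2) = 0) (w13 : w (X 1) (X 3) = 0)
    (w14 : w (X 1) (X 4) = 0) (w15 : w (X 1) (X 5) = 0) (w24 : w (X 2) (X 4) = 0)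
    (w25 : w (X 2) (X 5) = 0) (w34 : w (X 3) (X 4) = 0) (w35 : w (X 3) (X 5) = 0) :
    ∑ σ : Equiv.Perm (Fin 6), ((Equiv.Perm.sign σ : ℤ) : R) *
        A (X (σ 0)) (X (σ 1)) (X (σ 2)) (X (σ 3)) * w (X (σ 4)) (X (σ 5)) =
      48 * (A (X 0) (X 1) (X 2) (X 3) * w (X 4) (X 5) + A (X 0) (X 1) (X 4) (X 5) * w (X 2) (X 3)
        + A (X 2) (X 3) (X 4) (X 5) * w (X 0) (X 1)) := by
  rw [sum_perm_six_eq A w h01 h12 h23]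
  have z : ∀ {x y}, w x y = 0 → w y x = 0 := fun {x y} h ↦ by rw [hw, h, neg_zero]
  simp only [Fin.sum_univ_succ, Fin.sum_univ_zero]
  simp [Equiv.swap_apply_def, Fin.ext_iff]
  rw [w02, w03, w04, w05, w12, w13, w14, w15, w24, w25, w34, w35, z w02, z w03, z w04, z w05, z w12,
    z w13, z w14, z w15, z w24, z w25, z w34, z w35, hw (X 0) (X 1), hw (X 2) (X 3), hw (X 4) (X 5),
    h23 (X 2) (X 3) (X 0) (X 1), h01 (X 0) (X 1), h12 (X 2) (X 0) (X 3) (X 1),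
    h01 (X 0) (X 2) (X 3) (X 1), h23 (X 0) (X 2) (X 1) (X 3), h12 (X 0) (X 1) (X 2) (X 3)]
  ring

/-! ### Invariant forms on a Lie algebra with a Hermitian structure -/

section InvariantForms

variable {𝔤 : Type*} [LieRing 𝔤]

/-- The Chevalley–Eilenberg differential of an invariant real 2-form. -/
def ceD₂ (W : 𝔤 → 𝔤 → ℝ) (X Y Z : 𝔤) : ℝ :=
  -W ⁅X, Y⁆ Z + W ⁅X, Z⁆ Y + W X ⁅Y, Z⁆

/-- The Chevalley–Eilenberg differential of an invariant real 3-form. -/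
def ceD₃ (N : 𝔤 → 𝔤 → 𝔤 → ℝ) (X Y Z T : 𝔤) : ℝ :=
  -N ⁅X, Y⁆ Z T + N ⁅X, Z⁆ Y T + N X ⁅Y, Z⁆ T - N ⁅X, T⁆ Y Z - N X ⁅Y, T⁆ Z - N X Y ⁅Z, T⁆

/-- The wedge product of two 2-forms. -/
def wedge₂₂ {V : Type*} (a b : V → V → ℝ) (X Y Z T : V) : ℝ :=
  a X Y * b Z T - a X Z * b Y T + a X T * b Y Z + a Y Z * b X T - a Y T * b X Z + a Z T * b X Y

theorem wedge₂₂_swap01 {V : Type*} {a b : V → V → ℝ} (ha : ∀ x y, a y x = -a x y)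
    (hb : ∀ x y, b y x = -b x y) (X Y Z T : V) :
    wedge₂₂ a b Y X Z T = -wedge₂₂ a b X Y Z T := by
  simp only [wedge₂₂]; rw [ha X Y, hb X Y]; ring

theorem wedge₂₂_swap12 {V : Type*} {a b : V → V → ℝ} (ha : ∀ x y, a y x = -a x y)
    (hb : ∀ x y, b y x = -b x y) (X Y Z T : V) :
    wedge₂₂ a b X Z Y T = -wedge₂₂ a b X Y Z T := by
  simp only [wedge₂₂]; rw [ha Y Z, hb Y Z]; ring

theorem wedge₂₂_swap23 {V : Type*} {a b : V → V → ℝ} (ha : ∀ x y, a y x = -a x y)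
    (hb : ∀ x y, b y x = -b x y) (X Y Z T : V) :
    wedge₂₂ a b X Y T Z = -wedge₂₂ a b X Y Z T := by
  simp only [wedge₂₂]; rw [ha Z T, hb Z T]; ring

theorem ceD₃_swap01 {N : 𝔤 → 𝔤 → 𝔤 → ℝ} (h01 : ∀ x y z, N y x z = -N x y z)
    (hn : ∀ x y z, N (-x) y z = -N x y z) (X Y Z T : 𝔤) :
    ceD₃ N Y X Z T = -ceD₃ N X Y Z T := by
  simp only [ceD₃]
  rw [← lie_skew X Y, hn, h01 X ⁅Y, Z⁆ T, h01 ⁅X, Z⁆ Y T, h01 ⁅X, T⁆ Y Z, h01 X ⁅Y, T⁆ Z,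
    h01 X Y ⁅Z, T⁆]
  ring

theorem ceD₃_swap12 {N : 𝔤 → 𝔤 → 𝔤 → ℝ} (h01 : ∀ x y z, N y x z = -N x y z)
    (h12 : ∀ x y z, N x z y = -N x y z)
    (hn : ∀ x y z, N (-x) y z = -N x y z) (X Y Z T : 𝔤) :
    ceD₃ N X Z Y T = -ceD₃ N X Y Z T := by
  simp only [ceD₃]
  rw [h01 ⁅Z, Y⁆ X T, ← lie_skew Z Y, hn, h01 X ⁅Y, Z⁆ T, h12 ⁅X, T⁆ Y Z, h12 X ⁅Y, T⁆ Z,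
    h12 X Y ⁅Z, T⁆]
  ring

theorem ceD₃_swap23 {N : 𝔤 → 𝔤 → 𝔤 → ℝ} (h01 : ∀ x y z, N y x z = -N x y z)
    (h12 : ∀ x y z, N x z y = -N x y z)
    (hn : ∀ x y z, N (-x) y z = -N x y z) (X Y Z T : 𝔤) :
    ceD₃ N X Y T Z = -ceD₃ N X Y Z T := by
  simp only [ceD₃]
  rw [h12 X ⁅T, Z⁆ Y, h01 ⁅T, Z⁆ X Y, ← lie_skew T Z, hn, h01 X ⁅Z, T⁆ Y, h12 X Y ⁅Z, T⁆,
    h12 ⁅X, Y⁆ Z T]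
  ring

variable [LieAlgebra ℝ 𝔤] {𝒥 : InvComplexStructure 𝔤}

/-- The fundamental form `Ω (X, Y) = g (J X, Y)` as a real 2-form on the Lie algebra. -/
def InvHermitianMetric.omega (h : InvHermitianMetric 𝒥) (X Y : 𝔤) : ℝ := h.g (𝒥.J X) Y

/-- The 3-form `J dΩ`, that is `(X, Y, Z) ↦ dΩ (J X, J Y, J Z)`; it is the negative of `dᶜ Ω`. -/
def InvHermitianMetric.jdOmega (h : InvHermitianMetric 𝒥) (X Y Z : 𝔤) : ℝ :=
  ceD₂ h.omega (𝒥.J X) (𝒥.J Y) (𝒥.J Z)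

/-- The real 4-form `(i/2) ∂∂̄ Ω`, symmetrised so that it is visibly of type `(2,2)`. -/
noncomputable def InvHermitianMetric.ddbar (h : InvHermitianMetric 𝒥) (X Y Z T : 𝔤) : ℝ :=
  -(1 / 8) * (ceD₃ h.jdOmega X Y Z T +
    ceD₃ h.jdOmega (-𝒥.J X) (-𝒥.J Y) (-𝒥.J Z) (-𝒥.J T))

namespace InvHermitianMetric

variable (h : InvHermitianMetric 𝒥)

theorem omega_swap (X Y : 𝔤) : h.omega Y X = -h.omega X Y := by
  have h1 := h.compat (𝒥.J X) Y
  rw [𝒥.sq] at h1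
  simp only [omega, map_neg, LinearMap.neg_apply] at *
  rw [← h1, h.symm X]; ring

theorem omega_J (X Y : 𝔤) : h.omega (𝒥.J X) (𝒥.J Y) = h.omega X Y := h.compat _ _

theorem omega_neg_left (X Y : 𝔤) : h.omega (-X) Y = -h.omega X Y := by simp [omega]

theorem omega_neg_right (X Y : 𝔤) : h.omega X (-Y) = -h.omega X Y := by simp [omega]

theorem ceD₂_omega_swap01 (X Y Z : 𝔤) :
    ceD₂ h.omega Y X Z = -ceD₂ h.omega X Y Z := by
  simp only [ceD₂]
  rw [← lie_skew X Y, omega_neg_left, h.omega_swap Y ⁅X, Z⁆, h.omega_swap X ⁅Y, Z⁆]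
  ring

theorem ceD₂_omega_swap12 (X Y Z : 𝔤) :
    ceD₂ h.omega X Z Y = -ceD₂ h.omega X Y Z := by
  simp only [ceD₂]
  rw [← lie_skew Y Z, omega_neg_right]
  ring

theorem ceD₂_omega_neg (X Y Z : 𝔤) : ceD₂ h.omega (-X) Y Z = -ceD₂ h.omega X Y Z := by
  simp only [ceD₂, neg_lie, omega_neg_left]; ring

theorem jdOmega_swap01 (X Y Z : 𝔤) : h.jdOmega Y X Z = -h.jdOmega X Y Z :=
  h.ceD₂_omega_swap01 _ _ _

theorem jdOmega_swap12 (X Y Z : 𝔤) : h.jdOmega X Z Y = -h.jdOmega X Y Z :=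
  h.ceD₂_omega_swap12 _ _ _

theorem jdOmega_neg (X Y Z : 𝔤) : h.jdOmega (-X) Y Z = -h.jdOmega X Y Z := by
  simp only [jdOmega, map_neg, ceD₂_omega_neg]

theorem ddbar_swap01 (X Y Z T : 𝔤) : h.ddbar Y X Z T = -h.ddbar X Y Z T := by
  simp only [ddbar]
  rw [ceD₃_swap01 h.jdOmega_swap01 h.jdOmega_neg X,
    ceD₃_swap01 h.jdOmega_swap01 h.jdOmega_neg (-𝒥.J X)]
  ring

theorem ddbar_swap12 (X Y Z T : 𝔤) : h.ddbar X Z Y T = -h.ddbar X Y Z T := by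
  simp only [ddbar]
  rw [ceD₃_swap12 h.jdOmega_swap01 h.jdOmega_swap12 h.jdOmega_neg _ Y,
    ceD₃_swap12 h.jdOmega_swap01 h.jdOmega_swap12 h.jdOmega_neg _ (-𝒥.J Y)]
  ring

theorem ddbar_swap23 (X Y Z T : 𝔤) : h.ddbar X Y T Z = -h.ddbar X Y Z T := by
  simp only [ddbar]
  rw [ceD₃_swap23 h.jdOmega_swap01 h.jdOmega_swap12 h.jdOmega_neg _ _ Z,
    ceD₃_swap23 h.jdOmega_swap01 h.jdOmega_swap12 h.jdOmega_neg _ _ (-𝒥.J Z)]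
  ring

/-- `d² = 0` on the fundamental form. -/
theorem ceD₃_ceD₂_omega (X Y Z T : 𝔤) : ceD₃ (ceD₂ h.omega) X Y Z T = 0 := by
  have J : ∀ A B C D : 𝔤, h.omega ⁅⁅A, B⁆, C⁆ D + h.omega ⁅⁅B, C⁆, A⁆ D
      - h.omega ⁅⁅A, C⁆, B⁆ D = 0 := by
    intro A B C D
    rw [lie_lie A B C, ← lie_skew ⁅B, C⁆ A, ← lie_skew ⁅A, C⁆ B]
    simp only [omega, map_sub, map_neg, LinearMap.sub_apply, LinearMap.neg_apply]
    ring
  have s : ∀ A B C D : 𝔤, h.omega ⁅A, ⁅B, C⁆⁆ D = -h.omega ⁅⁅B, C⁆, A⁆ D := fun A B C D ↦ by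
    rw [← lie_skew, omega_neg_left]
  simp only [ceD₃, ceD₂, s]
  rw [h.omega_swap ⁅⁅Y, Z⁆, T⁆ X, h.omega_swap ⁅⁅Y, T⁆, Z⁆ X, ← lie_skew Y ⁅Z, T⁆, omega_neg_right,
    h.omega_swap ⁅⁅Z, T⁆, Y⁆ X]
  linear_combination J X Y Z T - J X Y T Z + J X Z T Y - J Y Z T X

end InvHermitianMetric

/-! ### Comparison of forms of top degree -/

section Multilinear

/-- Two multilinear functions with the same alternating sum on a basis have the same alternating sum
everywhere, as forms of top degree are determined by one value. -/
theorem alternating_six_eq {V : Type*} [AddCommGroup V] [Module ℝ V] (b : Module.Basis (Fin 6) ℝ V)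
    (m₁ m₂ : MultilinearMap ℝ (fun _ : Fin 6 ↦ V) ℝ)
    (hb : ∑ σ : Equiv.Perm (Fin 6), ((Equiv.Perm.sign σ : ℤ) : ℝ) * m₁ (fun i ↦ b (σ i)) =
      ∑ σ : Equiv.Perm (Fin 6), ((Equiv.Perm.sign σ : ℤ) : ℝ) * m₂ (fun i ↦ b (σ i)))
    (X : Fin 6 → V) :
    ∑ σ : Equiv.Perm (Fin 6), ((Equiv.Perm.sign σ : ℤ) : ℝ) * m₁ (fun i ↦ X (σ i)) =
      ∑ σ : Equiv.Perm (Fin 6), ((Equiv.Perm.sign σ : ℤ) : ℝ) * m₂ (fun i ↦ X (σ i)) := by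
  have e : ∀ (m : MultilinearMap ℝ (fun _ : Fin 6 ↦ V) ℝ) (Y : Fin 6 → V),
      MultilinearMap.alternatization m Y =
        ∑ σ : Equiv.Perm (Fin 6), ((Equiv.Perm.sign σ : ℤ) : ℝ) * m (fun i ↦ Y (σ i)) := by
    intro m Y
    rw [MultilinearMap.alternatization_apply]
    refine Finset.sum_congr rfl fun σ _ ↦ ?_
    rw [Units.smul_def, zsmul_eq_mul]; rfl
  rw [← e, ← e] at *
  rw [AlternatingMap.eq_smul_basis_det b (MultilinearMap.alternatization m₁),
    AlternatingMap.eq_smul_basis_det b (MultilinearMap.alternatization m₂)]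
  simp only [AlternatingMap.smul_apply]
  congr 1

/-- `A ⊗ w` is multilinear; by the antisymmetry of `A`, linearity need only be checked in its first
argument. -/
theorem exists_multilinear_six {V : Type*} [AddCommGroup V] [Module ℝ V]
    (A : V → V → V → V → ℝ) (w : V →ₗ[ℝ] V →ₗ[ℝ] ℝ)
    (h01 : ∀ x y z w, A y x z w = -A x y z w) (h12 : ∀ x y z w, A x z y w = -A x y z w)
    (h23 : ∀ x y z w, A x y w z = -A x y z w)
    (hadd : ∀ x x' y z w, A (x + x') y z w = A x y z w + A x' y z w)
    (hsmul : ∀ (c : ℝ) x y z w, A (c • x) y z w = c * A x y z w) :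
    ∃ m : MultilinearMap ℝ (fun _ : Fin 6 ↦ V) ℝ, ∀ X,
      m X = A (X 0) (X 1) (X 2) (X 3) * w (X 4) (X 5) := by
  have hadd1 : ∀ x x' y z w, A y (x + x') z w = A y x z w + A y x' z w := fun x x' y z w ↦ by
    rw [h01 (x + x'), h01 x, h01 x', hadd]; ring
  have hadd2 : ∀ x x' y z w, A y z (x + x') w = A y z x w + A y z x' w := fun x x' y z w ↦ by
    rw [h12 y (x + x'), h12 y x, h12 y x', hadd1]; ring
  have hadd3 : ∀ x x' y z w, A y z w (x + x') = A y z w x + A y z w x' := fun x x' y z w ↦ by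
    rw [h23 y z (x + x'), h23 y z x, h23 y z x', hadd2]; ring
  have hsmul1 : ∀ (c : ℝ) x y z w, A y (c • x) z w = c * A y x z w := fun c x y z w ↦ by
    rw [h01 (c • x), h01 x, hsmul]; ring
  have hsmul2 : ∀ (c : ℝ) x y z w, A y z (c • x) w = c * A y z x w := fun c x y z w ↦ by
    rw [h12 y (c • x), h12 y x, hsmul1]; ring
  have hsmul3 : ∀ (c : ℝ) x y z w, A y z w (c • x) = c * A y z w x := fun c x y z w ↦ by
    rw [h23 y z (c • x), h23 y z x, hsmul2]; ring
  refine ⟨MultilinearMap.mk' (fun X ↦ A (X 0) (X 1) (X 2) (X 3) * w (X 4) (X 5)) ?_ ?_,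
    fun X ↦ rfl⟩
  · intro X i x y
    fin_cases i <;>
      simp [Fin.ext_iff, hadd, hadd1, hadd2, hadd3] <;> ring
  · intro X i c x
    fin_cases i <;>
      simp [Fin.ext_iff, hsmul, hsmul1, hsmul2, hsmul3] <;> ring

end Multilinear

end InvariantForms

/-! ### Unitary frames -/

section UnitaryFrames

variable {𝔤 : Type*} [LieRing 𝔤] [LieAlgebra ℝ 𝔤] {𝒥 : InvComplexStructure 𝔤}

/-- `e₀, e₁, e₂` is a unitary frame: `e₀, J e₀, e₁, J e₁, e₂, J e₂` are orthonormal. -/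
structure IsUnitaryFrame (h : InvHermitianMetric 𝒥) (e : Fin 3 → 𝔤) : Prop where
  orthonormal : ∀ i j, h.g (e i) (e j) = if i = j then 1 else 0
  orthogonal_J : ∀ i j, h.g (𝒥.J (e i)) (e j) = 0

/-- The real frame `e₀, J e₀, e₁, J e₁, e₂, J e₂`. -/
def realFrame (𝒥 : InvComplexStructure 𝔤) (e : Fin 3 → 𝔤) : Fin 6 → 𝔤 :=
  ![e 0, 𝒥.J (e 0), e 1, 𝒥.J (e 1), e 2, 𝒥.J (e 2)]

/-- The contraction of `(i/2) ∂∂̄ Ω` with the metric, that is the value of `(i/2) ∂∂̄ Ω ∧ Ω` on the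
real frame of a unitary frame. -/
noncomputable def InvHermitianMetric.ddbarTrace (h : InvHermitianMetric 𝒥) (e : Fin 3 → 𝔤) : ℝ :=
  h.ddbar (e 0) (𝒥.J (e 0)) (e 1) (𝒥.J (e 1)) + h.ddbar (e 0) (𝒥.J (e 0)) (e 2) (𝒥.J (e 2)) +
    h.ddbar (e 1) (𝒥.J (e 1)) (e 2) (𝒥.J (e 2))

namespace IsUnitaryFrame

variable {h : InvHermitianMetric 𝒥} {e : Fin 3 → 𝔤} (he : IsUnitaryFrame h e)

include he in
theorem omega_apply (i j : Fin 3) : h.omega (e i) (e j) = 0 := he.orthogonal_J i j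

include he in
theorem omega_J_J (i j : Fin 3) : h.omega (𝒥.J (e i)) (𝒥.J (e j)) = 0 := by
  rw [h.omega_J, he.omega_apply]

include he in
theorem omega_right_J (i j : Fin 3) : h.omega (e i) (𝒥.J (e j)) = if i = j then 1 else 0 := by
  rw [InvHermitianMetric.omega, h.compat, he.orthonormal]

include he in
theorem omega_left_J (i j : Fin 3) : h.omega (𝒥.J (e i)) (e j) = if j = i then -1 else 0 := by
  rw [h.omega_swap, he.omega_right_J]; split_ifs <;> simp

include he in
/-- Wedging a 4-form with `Ω` contracts it over the complex lines of a unitary frame. -/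
theorem sum_perm_six {A : 𝔤 → 𝔤 → 𝔤 → 𝔤 → ℝ}
    (h01 : ∀ x y z w, A y x z w = -A x y z w) (h12 : ∀ x y z w, A x z y w = -A x y z w)
    (h23 : ∀ x y z w, A x y w z = -A x y z w) :
    ∑ σ : Equiv.Perm (Fin 6), ((Equiv.Perm.sign σ : ℤ) : ℝ) *
      A (realFrame 𝒥 e (σ 0)) (realFrame 𝒥 e (σ 1)) (realFrame 𝒥 e (σ 2)) (realFrame 𝒥 e (σ 3))
        * h.omega (realFrame 𝒥 e (σ 4)) (realFrame 𝒥 e (σ 5)) =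
    48 * (A (e 0) (𝒥.J (e 0)) (e 1) (𝒥.J (e 1)) + A (e 0) (𝒥.J (e 0)) (e 2) (𝒥.J (e 2)) +
      A (e 1) (𝒥.J (e 1)) (e 2) (𝒥.J (e 2))) := by
  rw [sum_perm_six_paired A h.omega h01 h12 h23 h.omega_swap] <;>
    simp [realFrame, he.omega_apply, he.omega_J_J, he.omega_right_J, he.omega_left_J]

include he in
theorem exists_basis (hd : Module.finrank ℝ 𝔤 = 6) :
    ∃ b : Module.Basis (Fin 6) ℝ 𝔤, ∀ i, b i = realFrame 𝒥 e i := by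
  have li : LinearIndependent ℝ (realFrame 𝒥 e) := by
    rw [Fintype.linearIndependent_iff]
    intro c hc
    -- pairing a relation with `e j` and `J (e j)` under `Ω` isolates its coefficients
    have key : ∀ j, h.omega (∑ i, c i • realFrame 𝒥 e i) (e j) = 0 ∧
        h.omega (∑ i, c i • realFrame 𝒥 e i) (𝒥.J (e j)) = 0 := by
      intro j; rw [hc]; simp [InvHermitianMetric.omega]
    have lin : ∀ (a : ℝ) X Y Z, h.omega (a • X + Y) Z = a * h.omega X Z + h.omega Y Z := by
      intro a X Y Z; simp [InvHermitianMetric.omega]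
    have lin' : ∀ (a : ℝ) X Z, h.omega (a • X) Z = a * h.omega X Z := by
      intro a X Z; simp [InvHermitianMetric.omega]
    simp only [Fin.sum_univ_six, add_assoc, lin, lin', realFrame] at key
    have k0 := key 0
    have k1 := key 1
    have k2 := key 2
    simp [he.omega_apply, he.omega_J_J, he.omega_right_J, he.omega_left_J] at k0 k1 k2
    intro i
    fin_cases i
    exacts [k0.2, k0.1, k1.2, k1.1, k2.2, k2.1]
  refine ⟨basisOfLinearIndependentOfCardEqFinrank li (by simp [hd]), fun i ↦ by simp⟩

include he in
/-- `(i/2) ∂∂̄ Ω ∧ Ω` and `Ω³` are proportional, as top degree forms; the factor is found on a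
unitary frame, where `Ω³` takes the value `6`. -/
theorem sum_ddbar_eq (hd : Module.finrank ℝ 𝔤 = 6) (X : Fin 6 → 𝔤) :
    ∑ σ : Equiv.Perm (Fin 6), ((Equiv.Perm.sign σ : ℤ) : ℝ) *
      h.ddbar (X (σ 0)) (X (σ 1)) (X (σ 2)) (X (σ 3)) * h.omega (X (σ 4)) (X (σ 5)) =
    h.ddbarTrace e / 6 * ∑ σ : Equiv.Perm (Fin 6), ((Equiv.Perm.sign σ : ℤ) : ℝ) *
      wedge₂₂ h.omega h.omega (X (σ 0)) (X (σ 1)) (X (σ 2)) (X (σ 3)) *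
        h.omega (X (σ 4)) (X (σ 5)) := by
  obtain ⟨b, hb⟩ := he.exists_basis hd
  have w01 := wedge₂₂_swap01 h.omega_swap h.omega_swap
  have w12 := wedge₂₂_swap12 h.omega_swap h.omega_swap
  have w23 := wedge₂₂_swap23 h.omega_swap h.omega_swap
  obtain ⟨m₁, hm₁⟩ := exists_multilinear_six h.ddbar (h.g ∘ₗ 𝒥.J) h.ddbar_swap01 h.ddbar_swap12
    h.ddbar_swap23
    (by
      intro x x' y z w
      simp only [InvHermitianMetric.ddbar, ceD₃, InvHermitianMetric.jdOmega, ceD₂,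
        InvHermitianMetric.omega, map_add, add_lie, LinearMap.add_apply, map_neg, neg_add]
      ring)
    (by
      intro c x y z w
      simp only [InvHermitianMetric.ddbar, ceD₃, InvHermitianMetric.jdOmega, ceD₂,
        InvHermitianMetric.omega, map_smul, smul_lie, LinearMap.smul_apply, map_neg,
        LinearMap.neg_apply, smul_eq_mul, neg_lie, lie_neg, neg_neg]
      ring)
  obtain ⟨m₂, hm₂⟩ := exists_multilinear_six (wedge₂₂ h.omega h.omega) (h.g ∘ₗ 𝒥.J) w01 w12 w23
    (by
      intro x x' y z w
      simp only [wedge₂₂, InvHermitianMetric.omega, map_add, LinearMap.add_apply]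
      ring)
    (by
      intro c x y z w
      simp only [wedge₂₂, InvHermitianMetric.omega, map_smul, LinearMap.smul_apply, smul_eq_mul]
      ring)
  have key := alternating_six_eq b m₁ ((h.ddbarTrace e / 6) • m₂) ?_ X
  · simp only [smul_apply, hm₁, hm₂, smul_eq_mul, LinearMap.comp_apply] at key
    simp only [InvHermitianMetric.omega, mul_assoc] at *
    rw [key, Finset.mul_sum]
    refine Finset.sum_congr rfl fun σ _ ↦ ?_
    ring
  · simp only [smul_apply, hm₁, hm₂, smul_eq_mul, LinearMap.comp_apply, hb]
    have e₁ := he.sum_perm_six h.ddbar_swap01 h.ddbar_swap12 h.ddbar_swap23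
    have e₂ := he.sum_perm_six w01 w12 w23
    have e₃ : ∀ i j, i ≠ j →
        wedge₂₂ h.omega h.omega (e i) (𝒥.J (e i)) (e j) (𝒥.J (e j)) = 2 := by
      intro i j hij
      simp [wedge₂₂, he.omega_apply, he.omega_J_J, he.omega_right_J, he.omega_left_J, hij, hij.symm]
      norm_num
    rw [e₃ 0 1 (by decide), e₃ 0 2 (by decide), e₃ 1 2 (by decide)] at e₂
    change ∑ σ, _ * (_ * h.omega _ _) = ∑ σ, _ * (_ * (_ * h.omega _ _))
    simp only [← mul_assoc]
    rw [e₁]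
    have : ∀ s a w : ℝ, s * (h.ddbarTrace e / 6) * a * w = (h.ddbarTrace e / 6) * (s * a * w) :=
      fun s a w ↦ by ring
    simp only [this]
    rw [← Finset.mul_sum, e₂, InvHermitianMetric.ddbarTrace]
    ring

end IsUnitaryFrame

end UnitaryFrames

/-! ### Derivatives along invariant vector fields at a minimum -/

section SecondDerivative

theorem deriv_deriv_nonneg_of_isLocalMin {f : ℝ → ℝ} {x : ℝ} (hf : IsLocalMin f x)
    (hc : ContinuousAt f x) : 0 ≤ deriv (deriv f) x := by
  by_contra! hneg
  have hmax := isLocalMax_of_deriv_deriv_neg hneg hf.deriv_eq_zero hc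
  have : f =ᶠ[nhds x] fun _ ↦ f x := by
    filter_upwards [hf, hmax] with y h1 h2 using le_antisymm h2 h1
  have h2 := this.deriv.deriv_eq
  simp at h2
  linarith

end SecondDerivative

noncomputable section Derivations

variable {G : Type*} [TopologicalSpace G] [ChartedSpace (EuclideanSpace ℝ (Fin 6)) G] [Group G]

/-- The derivative of a real function along a left-invariant vector field. -/
def lieDerR (X : GroupLieAlgebra (𝓡 6) G) (f : G → ℝ) (p : G) : ℝ :=
  mfderiv (𝓡 6) 𝓘(ℝ, ℝ) f p (mulInvariantVectorField X p)

theorem HasMFDerivAt.lieDerR_eq {f : G → ℝ} {p : G}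
    {f' : TangentSpace (𝓡 6) p →L[ℝ] ℝ} (hf : HasMFDerivAt (𝓡 6) 𝓘(ℝ, ℝ) f p f')
    (X : GroupLieAlgebra (𝓡 6) G) : lieDerR X f p = f' (mulInvariantVectorField X p) := by
  rw [lieDerR, hf.mfderiv]; rfl

theorem lieDer_of_real {f : G → ℝ} {p : G} (hf : MDifferentiableAt (𝓡 6) 𝓘(ℝ, ℝ) f p)
    (X : GroupLieAlgebra (𝓡 6) G) (c : ℂ) :
    lieDer X (fun q ↦ c * (f q : ℂ)) p = c * (lieDerR X f p : ℂ) := by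
  have h1 : HasFDerivAt (fun x : ℝ ↦ c * (x : ℂ))
      ((ContinuousLinearMap.mul ℝ ℂ c).comp Complex.ofRealCLM) (f p) :=
    ((ContinuousLinearMap.mul ℝ ℂ c).comp Complex.ofRealCLM).hasFDerivAt
  have h2 := h1.hasMFDerivAt.comp p hf.hasMFDerivAt
  have h3 : mfderiv (𝓡 6) 𝓘(ℝ, ℂ) (fun q ↦ c * (f q : ℂ)) p = _ := h2.mfderiv
  rw [lieDer, h3]
  rfl

theorem lieDerR_const (X : GroupLieAlgebra (𝓡 6) G) (c : ℝ) (p : G) :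
    lieDerR X (fun _ ↦ c) p = 0 := by
  rw [(hasMFDerivAt_const c p).lieDerR_eq]; rfl

theorem lieDerR_add {f g : G → ℝ} {p : G} (hf : MDifferentiableAt (𝓡 6) 𝓘(ℝ, ℝ) f p)
    (hg : MDifferentiableAt (𝓡 6) 𝓘(ℝ, ℝ) g p) (X : GroupLieAlgebra (𝓡 6) G) :
    lieDerR X (fun q ↦ f q + g q) p = lieDerR X f p + lieDerR X g p := by
  exact (hf.hasMFDerivAt.add hg.hasMFDerivAt).lieDerR_eq X

theorem lieDerR_mul_const {f : G → ℝ} {p : G} (hf : MDifferentiableAt (𝓡 6) 𝓘(ℝ, ℝ) f p)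
    (c : ℝ) (X : GroupLieAlgebra (𝓡 6) G) :
    lieDerR X (fun q ↦ f q * c) p = lieDerR X f p * c := by
  have := (hf.hasMFDerivAt.const_smul c).lieDerR_eq X
  have e : (fun q ↦ f q * c) = c • f := by ext q; simp [mul_comm]
  rw [e, this, mul_comm]; rfl

variable [LieGroup (𝓡 6) ∞ G]

theorem contMDiff_lieDerR {f : G → ℝ} (hf : ContMDiff (𝓡 6) 𝓘(ℝ, ℝ) ∞ f)
    (X : GroupLieAlgebra (𝓡 6) G) : MDifferentiable (𝓡 6) 𝓘(ℝ, ℝ) (lieDerR X f) := by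
  have h1 : ContMDiff (𝓡 6).tangent 𝓘(ℝ, ℝ).tangent 1 (tangentMap (𝓡 6) 𝓘(ℝ, ℝ) f) :=
    hf.contMDiff_tangentMap (by norm_cast)
  have h2 : ContMDiff (𝓡 6) (𝓡 6).tangent 1
      (fun g : G ↦ (⟨g, mulInvariantVectorField X g⟩ : TangentBundle (𝓡 6) G)) :=
    (contMDiff_mulInvariantVectorField X).of_le
      (by rw [minSmoothness_of_isRCLikeNormedField]; norm_num)
  have h3 := h1.comp h2
  have h4 := (contMDiff_snd_tangentBundle_modelSpace ℝ 𝓘(ℝ, ℝ) (n := 1)).comp h3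
  exact h4.mdifferentiable (by simp)

/-- At a minimum, first derivatives vanish and second derivatives are nonnegative: restrict the
function to an integral curve of the invariant field. -/
theorem lieDerR_of_isMin {f : G → ℝ} (hf : ContMDiff (𝓡 6) 𝓘(ℝ, ℝ) ∞ f) {p : G}
    (hp : ∀ q, f p ≤ f q) (X : GroupLieAlgebra (𝓡 6) G) :
    lieDerR X f p = 0 ∧ 0 ≤ lieDerR X (lieDerR X f) p := by
  have hdf : MDifferentiable (𝓡 6) 𝓘(ℝ, ℝ) f := hf.mdifferentiable (by simp)
  obtain ⟨γ, h0, hγ⟩ := exists_isMIntegralCurveAt_of_contMDiffAt_boundaryless (I := 𝓡 6) (M := G)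
    (v := mulInvariantVectorField X) (x₀ := p) 0
    ((contMDiffAt_mulInvariantVectorField X).of_le
      (by rw [minSmoothness_of_isRCLikeNormedField]; norm_num))
  have key : ∀ (F : G → ℝ), MDifferentiable (𝓡 6) 𝓘(ℝ, ℝ) F →
      ∀ᶠ t in nhds 0, HasDerivAt (F ∘ γ) (lieDerR X F (γ t)) t := by
    intro F hF
    filter_upwards [hγ] with t ht
    have h1 := (hF (γ t)).hasMFDerivAt.comp t ht
    let D : ℝ →L[ℝ] ℝ := (mfderiv (𝓡 6) 𝓘(ℝ, ℝ) F (γ t)).comp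
      ((1 : ℝ →L[ℝ] ℝ).smulRight (mulInvariantVectorField X (γ t)))
    have h2 : HasFDerivAt (F ∘ γ) D t := HasMFDerivAt.hasFDerivAt h1
    have h3 : D 1 = lieDerR X F (γ t) := by
      change mfderiv (𝓡 6) 𝓘(ℝ, ℝ) F (γ t) ((1 : ℝ) • mulInvariantVectorField X (γ t)) = _
      rw [one_smul]; rfl
    rw [← h3]
    exact h2.hasDerivAt
  have k1 := key f hdf
  have k2 := key _ (contMDiff_lieDerR hf X)
  have hmin : IsLocalMin (f ∘ γ) 0 := Filter.Eventually.of_forall fun t ↦ by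
    simp only [Function.comp_apply, h0]; exact hp _
  have d1 : deriv (f ∘ γ) =ᶠ[nhds 0] (lieDerR X f) ∘ γ := by
    filter_upwards [k1] with t ht using ht.deriv
  constructor
  · rw [← h0, ← k1.self_of_nhds.deriv]; exact hmin.deriv_eq_zero
  · have := deriv_deriv_nonneg_of_isLocalMin hmin k1.self_of_nhds.continuousAt
    rwa [d1.deriv_eq, k2.self_of_nhds.deriv, h0] at this

end Derivations

/-! ### The form `∂∂̄ (F Ω)` in the invariant frame -/

noncomputable section FormsInInvariantFrame

variable {G : Type*} [TopologicalSpace G] [ChartedSpace (EuclideanSpace ℝ (Fin 6)) G] [Group G]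

theorem lieDer_add {f g : G → ℂ} {p : G} (hf : MDifferentiableAt (𝓡 6) 𝓘(ℝ, ℂ) f p)
    (hg : MDifferentiableAt (𝓡 6) 𝓘(ℝ, ℂ) g p) (X : GroupLieAlgebra (𝓡 6) G) :
    lieDer X (fun q ↦ f q + g q) p = lieDer X f p + lieDer X g p := by
  have := (hf.hasMFDerivAt.add hg.hasMFDerivAt).mfderiv
  have e : (fun q ↦ f q + g q) = f + g := rfl
  rw [lieDer, e, this]; rfl

omit [Group G] in
theorem mdifferentiableAt_const_mul_ofReal {f : G → ℝ} {p : G}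
    (hf : MDifferentiableAt (𝓡 6) 𝓘(ℝ, ℝ) f p) (c : ℂ) :
    MDifferentiableAt (𝓡 6) 𝓘(ℝ, ℂ) (fun q ↦ c * (f q : ℂ)) p := by
  have h1 : HasFDerivAt (fun x : ℝ ↦ c * (x : ℂ))
      ((ContinuousLinearMap.mul ℝ ℂ c).comp Complex.ofRealCLM) (f p) :=
    ((ContinuousLinearMap.mul ℝ ℂ c).comp Complex.ofRealCLM).hasFDerivAt
  exact (h1.hasMFDerivAt.comp p hf.hasMFDerivAt).mdifferentiableAt

theorem lieDer_of_real_add {f g : G → ℝ} {p : G} (hf : MDifferentiableAt (𝓡 6) 𝓘(ℝ, ℝ) f p)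
    (hg : MDifferentiableAt (𝓡 6) 𝓘(ℝ, ℝ) g p) (X : GroupLieAlgebra (𝓡 6) G) (c d : ℂ) :
    lieDer X (fun q ↦ c * (f q : ℂ) + d * (g q : ℂ)) p =
      c * (lieDerR X f p : ℂ) + d * (lieDerR X g p : ℂ) := by
  rw [lieDer_add (mdifferentiableAt_const_mul_ofReal hf c)
    (mdifferentiableAt_const_mul_ofReal hg d), lieDer_of_real hf, lieDer_of_real hg]

theorem lieDerR_neg_left (X : GroupLieAlgebra (𝓡 6) G) (f : G → ℝ) (p : G) :
    lieDerR (-X) f p = -lieDerR X f p := by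
  have h : mulInvariantVectorField (-X) p = -mulInvariantVectorField X p :=
    map_neg (mfderiv (𝓡 6) (𝓡 6) (p * ·) (1 : G)) X
  rw [lieDerR, h]
  exact map_neg (mfderiv (𝓡 6) 𝓘(ℝ, ℝ) f p) _

theorem extD_two (α : DForm G 2) (X : Fin 3 → GroupLieAlgebra (𝓡 6) G) (p : G) :
    extD α X p = lieDer (X 0) (α ![X 1, X 2]) p - lieDer (X 1) (α ![X 0, X 2]) p
      + lieDer (X 2) (α ![X 0, X 1]) p - α ![⁅X 0, X 1⁆, X 2] p + α ![⁅X 0, X 2⁆, X 1] p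
      + α ![X 0, ⁅X 1, X 2⁆] p := by
  have d : ∀ (j : Fin 3) (Y : Fin 3 → GroupLieAlgebra (𝓡 6) G),
      j.removeNth Y = ![Y (j.succAbove 0), Y (j.succAbove 1)] := by
    intro j Y; ext i; fin_cases i <;> rfl
  have i0 : (Finset.Iio (0 : Fin 3)) = ∅ := by decide
  have i1 : (Finset.Iio (1 : Fin 3)) = {0} := by decide
  have i2 : (Finset.Iio (2 : Fin 3)) = {0, 1} := by decide
  simp [extD, Fin.sum_univ_three, d, i0, i1, i2, Fin.succAbove, Function.update_apply]
  ring

theorem extD_three (α : DForm G 3) (X : Fin 4 → GroupLieAlgebra (𝓡 6) G) (p : G) :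
    extD α X p = lieDer (X 0) (α ![X 1, X 2, X 3]) p - lieDer (X 1) (α ![X 0, X 2, X 3]) p
      + lieDer (X 2) (α ![X 0, X 1, X 3]) p - lieDer (X 3) (α ![X 0, X 1, X 2]) p
      - α ![⁅X 0, X 1⁆, X 2, X 3] p + α ![⁅X 0, X 2⁆, X 1, X 3] p + α ![X 0, ⁅X 1, X 2⁆, X 3] p
      - α ![⁅X 0, X 3⁆, X 1, X 2] p - α ![X 0, ⁅X 1, X 3⁆, X 2] p
      - α ![X 0, X 1, ⁅X 2, X 3⁆] p := by
  have d : ∀ (j : Fin 4) (Y : Fin 4 → GroupLieAlgebra (𝓡 6) G),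
      j.removeNth Y = ![Y (j.succAbove 0), Y (j.succAbove 1), Y (j.succAbove 2)] := by
    intro j Y; ext i; fin_cases i <;> rfl
  have i0 : (Finset.Iio (0 : Fin 4)) = ∅ := by decide
  have i1 : (Finset.Iio (1 : Fin 4)) = {0} := by decide
  have i2 : (Finset.Iio (2 : Fin 4)) = {0, 1} := by decide
  have i3 : (Finset.Iio (3 : Fin 4)) = {0, 1, 2} := by decide
  simp [extD, Fin.sum_univ_four, d, i0, i1, i2, i3, Fin.succAbove, Function.update_apply]
  ring

/-- The exterior derivative of a real 3-form given by its components in the left-invariant frame. -/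
def realExtD₃ (T : GroupLieAlgebra (𝓡 6) G → GroupLieAlgebra (𝓡 6) G → GroupLieAlgebra (𝓡 6) G →
    G → ℝ) (X Y Z W : GroupLieAlgebra (𝓡 6) G) (p : G) : ℝ :=
  lieDerR X (T Y Z W) p - lieDerR Y (T X Z W) p + lieDerR Z (T X Y W) p - lieDerR W (T X Y Z) p
    - T ⁅X, Y⁆ Z W p + T ⁅X, Z⁆ Y W p + T X ⁅Y, Z⁆ W p - T ⁅X, W⁆ Y Z p - T X ⁅Y, W⁆ Z p
    - T X Y ⁅Z, W⁆ p

theorem extD_three_of_real (T S : GroupLieAlgebra (𝓡 6) G → GroupLieAlgebra (𝓡 6) G →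
    GroupLieAlgebra (𝓡 6) G → G → ℝ) (hT : ∀ X Y Z, MDifferentiable (𝓡 6) 𝓘(ℝ, ℝ) (T X Y Z))
    (hS : ∀ X Y Z, MDifferentiable (𝓡 6) 𝓘(ℝ, ℝ) (S X Y Z)) (c d : ℂ)
    (X : Fin 4 → GroupLieAlgebra (𝓡 6) G) (p : G) :
    extD (k := 3) (fun Y q ↦ c * (T (Y 0) (Y 1) (Y 2) q : ℂ) +
        d * (S (Y 0) (Y 1) (Y 2) q : ℂ)) X p =
      c * (realExtD₃ T (X 0) (X 1) (X 2) (X 3) p : ℂ) +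
        d * (realExtD₃ S (X 0) (X 1) (X 2) (X 3) p : ℂ) := by
  rw [extD_three]
  simp only [lieDer_of_real_add (hT _ _ _ p) (hS _ _ _ p), realExtD₃, Matrix.cons_val_zero,
    Matrix.cons_val_one, Matrix.cons_val]
  push_cast
  ring

variable [LieGroup (𝓡 6) ∞ G] {𝒥 : InvComplexStructure (GroupLieAlgebra (𝓡 6) G)}
  (h : InvHermitianMetric 𝒥)

/-- The components of the 3-form `A^* d (F Ω)`, where `F` is a real function and `A` an endomorphism
that preserves `Ω` (it will be the identity or `±J`). -/
def dFOmega (F : G → ℝ) (A : GroupLieAlgebra (𝓡 6) G →ₗ[ℝ] GroupLieAlgebra (𝓡 6) G)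
    (X Y Z : GroupLieAlgebra (𝓡 6) G) (q : G) : ℝ :=
  F q * ceD₂ h.omega (A X) (A Y) (A Z) + lieDerR (A X) F q * h.omega Y Z
    + lieDerR (A Y) F q * (-h.omega X Z) + lieDerR (A Z) F q * h.omega X Y

variable {h} {F : G → ℝ}

theorem extD_funSmul (hF : ContMDiff (𝓡 6) 𝓘(ℝ, ℝ) ∞ F)
    (X : Fin 3 → GroupLieAlgebra (𝓡 6) G) (p : G) :
    extD (funSmul F (fundamentalForm h)) X p =
      (dFOmega h F LinearMap.id (X 0) (X 1) (X 2) p : ℂ) := by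
  have hd : MDifferentiable (𝓡 6) 𝓘(ℝ, ℝ) F := hF.mdifferentiable (by simp)
  have e : ∀ Y : Fin 2 → GroupLieAlgebra (𝓡 6) G, funSmul F (fundamentalForm h) Y =
      fun q ↦ (h.omega (Y 0) (Y 1) : ℂ) * (F q : ℂ) := fun Y ↦ by
    ext q; simp [funSmul, fundamentalForm, InvHermitianMetric.omega, mul_comm]
  rw [extD_two]
  simp only [e, lieDer_of_real (hd p), dFOmega, ceD₂, LinearMap.id_apply, Matrix.cons_val_zero,
    Matrix.cons_val_one]
  push_cast
  ring

theorem mdifferentiable_dFOmega (hF : ContMDiff (𝓡 6) 𝓘(ℝ, ℝ) ∞ F)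
    (A : GroupLieAlgebra (𝓡 6) G →ₗ[ℝ] GroupLieAlgebra (𝓡 6) G)
    (X Y Z : GroupLieAlgebra (𝓡 6) G) :
    MDifferentiable (𝓡 6) 𝓘(ℝ, ℝ) (dFOmega h F A X Y Z) := by
  have hd : MDifferentiable (𝓡 6) 𝓘(ℝ, ℝ) F := hF.mdifferentiable (by simp)
  have hc : ∀ c : ℝ, MDifferentiable (𝓡 6) 𝓘(ℝ, ℝ) (fun _ : G ↦ c) := fun c ↦ mdifferentiable_const
  have hm : ∀ (f : G → ℝ) (c : ℝ), MDifferentiable (𝓡 6) 𝓘(ℝ, ℝ) f →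
      MDifferentiable (𝓡 6) 𝓘(ℝ, ℝ) (fun q ↦ f q * c) := fun f c hf ↦ hf.mul (hc c)
  exact (((hm _ _ hd).add (hm _ _ (contMDiff_lieDerR hF _))).add
    (hm _ _ (contMDiff_lieDerR hF _))).add (hm _ _ (contMDiff_lieDerR hF _))

theorem lieDerR_dFOmega (hF : ContMDiff (𝓡 6) 𝓘(ℝ, ℝ) ∞ F)
    (A : GroupLieAlgebra (𝓡 6) G →ₗ[ℝ] GroupLieAlgebra (𝓡 6) G)
    (W X Y Z : GroupLieAlgebra (𝓡 6) G) (p : G) :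
    lieDerR W (dFOmega h F A X Y Z) p =
      lieDerR W F p * ceD₂ h.omega (A X) (A Y) (A Z)
        + lieDerR W (lieDerR (A X) F) p * h.omega Y Z
        - lieDerR W (lieDerR (A Y) F) p * h.omega X Z
        + lieDerR W (lieDerR (A Z) F) p * h.omega X Y := by
  have hd : MDifferentiable (𝓡 6) 𝓘(ℝ, ℝ) F := hF.mdifferentiable (by simp)
  have hc : ∀ c : ℝ, MDifferentiable (𝓡 6) 𝓘(ℝ, ℝ) (fun _ : G ↦ c) := fun c ↦ mdifferentiable_const
  have hm : ∀ (f : G → ℝ) (c : ℝ), MDifferentiable (𝓡 6) 𝓘(ℝ, ℝ) f →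
      MDifferentiable (𝓡 6) 𝓘(ℝ, ℝ) (fun q ↦ f q * c) := fun f c hf ↦ hf.mul (hc c)
  have h1 := contMDiff_lieDerR hF
  have a1 := (hm F (ceD₂ h.omega (A X) (A Y) (A Z)) hd)
  have a2 : MDifferentiable (𝓡 6) 𝓘(ℝ, ℝ) (fun q ↦ F q * ceD₂ h.omega (A X) (A Y) (A Z)
    + lieDerR (A X) F q * h.omega Y Z) := a1.add (hm _ (h.omega Y Z) (h1 (A X)))
  have a3 : MDifferentiable (𝓡 6) 𝓘(ℝ, ℝ) (fun q ↦ F q * ceD₂ h.omega (A X) (A Y) (A Z)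
    + lieDerR (A X) F q * h.omega Y Z + lieDerR (A Y) F q * (-h.omega X Z)) :=
      a2.add (hm _ (-h.omega X Z) (h1 (A Y)))
  have e : dFOmega h F A X Y Z = fun q ↦ F q * ceD₂ h.omega (A X) (A Y) (A Z)
    + lieDerR (A X) F q * h.omega Y Z
    + lieDerR (A Y) F q * (-h.omega X Z) + lieDerR (A Z) F q * h.omega X Y := rfl
  rw [e, lieDerR_add (a3 p) (hm _ _ (h1 _) p), lieDerR_add (a2 p) (hm _ _ (h1 _) p),
    lieDerR_add (a1 p) (hm _ _ (h1 _) p), lieDerR_mul_const (hd p), lieDerR_mul_const (h1 _ p),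
    lieDerR_mul_const (h1 _ p), lieDerR_mul_const (h1 _ p)]
  ring

/-- The antisymmetrised second derivative `(X, Y) ↦ X (A Y) F - Y (A X) F`. -/
def skewHessian (F : G → ℝ) (A : GroupLieAlgebra (𝓡 6) G →ₗ[ℝ] GroupLieAlgebra (𝓡 6) G) (p : G)
    (X Y : GroupLieAlgebra (𝓡 6) G) : ℝ :=
  lieDerR X (lieDerR (A Y) F) p - lieDerR Y (lieDerR (A X) F) p

/-- At a critical point of `F`, the first order terms of `d A^* d (F Ω)` disappear. -/
theorem realExtD₃_dFOmega (hF : ContMDiff (𝓡 6) 𝓘(ℝ, ℝ) ∞ F)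
    (A : GroupLieAlgebra (𝓡 6) G →ₗ[ℝ] GroupLieAlgebra (𝓡 6) G)
    (X Y Z W : GroupLieAlgebra (𝓡 6) G) (p : G) (hp : ∀ X, lieDerR X F p = 0) :
    realExtD₃ (dFOmega h F A) X Y Z W p =
      F p * ceD₃ (fun X Y Z ↦ ceD₂ h.omega (A X) (A Y) (A Z)) X Y Z W
        + wedge₂₂ (skewHessian F A p) h.omega X Y Z W := by
  simp only [realExtD₃, lieDerR_dFOmega hF, hp, dFOmega, ceD₃, wedge₂₂, skewHessian]
  ring

/-- The value of `∂∂̄ (F Ω)` at a point, in terms of `d A^* d (F Ω)` for `A = 1, ±J`. -/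
theorem del_delBar_funSmul (hF : ContMDiff (𝓡 6) 𝓘(ℝ, ℝ) ∞ F)
    (X : Fin 4 → GroupLieAlgebra (𝓡 6) G) (p : G) :
    del 𝒥 (delBar 𝒥 (funSmul F (fundamentalForm h))) X p =
      (((realExtD₃ (dFOmega h F LinearMap.id) (X 0) (X 1) (X 2) (X 3) p
        + realExtD₃ (dFOmega h F LinearMap.id) (-𝒥.J (X 0)) (-𝒥.J (X 1)) (-𝒥.J (X 2))
          (-𝒥.J (X 3)) p : ℝ) : ℂ)
      + Complex.I * ((realExtD₃ (dFOmega h F 𝒥.J) (-𝒥.J (X 0)) (-𝒥.J (X 1)) (-𝒥.J (X 2))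
          (-𝒥.J (X 3)) p
        - realExtD₃ (dFOmega h F (-𝒥.J)) (X 0) (X 1) (X 2) (X 3) p : ℝ) : ℂ)) / 4 := by
  have hJ : pullEnd 𝒥.J (funSmul F (fundamentalForm h)) = funSmul F (fundamentalForm h) := by
    ext Y q
    simp only [pullEnd, funSmul, fundamentalForm]
    rw [h.compat]
  have e1 : delBar 𝒥 (funSmul F (fundamentalForm h)) = fun Y q ↦
      (1 / 2 : ℂ) * (dFOmega h F LinearMap.id (Y 0) (Y 1) (Y 2) q : ℂ) +
        (-Complex.I / 2) * (dFOmega h F (-𝒥.J) (Y 0) (Y 1) (Y 2) q : ℂ) := by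
    ext Y q
    simp only [delBar, dc, hJ]
    rw [extD_funSmul hF]
    simp only [pullEnd]
    rw [extD_funSmul hF]
    have : dFOmega h F LinearMap.id ((-𝒥.J) (Y 0)) ((-𝒥.J) (Y 1)) ((-𝒥.J) (Y 2)) q =
        dFOmega h F (-𝒥.J) (Y 0) (Y 1) (Y 2) q := by
      simp [dFOmega, h.omega_neg_left, h.omega_neg_right, h.omega_J]
    rw [this]
    ring
  have e2 : pullEnd 𝒥.J (delBar 𝒥 (funSmul F (fundamentalForm h))) = fun Y q ↦
      (1 / 2 : ℂ) * (dFOmega h F 𝒥.J (Y 0) (Y 1) (Y 2) q : ℂ) +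
        (-Complex.I / 2) * (dFOmega h F LinearMap.id (Y 0) (Y 1) (Y 2) q : ℂ) := by
    ext Y q
    rw [e1]
    simp [pullEnd, dFOmega, h.omega_J, 𝒥.sq]
  simp only [del, dc, e2]
  rw [e1, extD_three_of_real _ _ (mdifferentiable_dFOmega hF _) (mdifferentiable_dFOmega hF _)]
  simp only [pullEnd]
  rw [extD_three_of_real _ _ (mdifferentiable_dFOmega hF _) (mdifferentiable_dFOmega hF _)]
  simp only [LinearMap.neg_apply]
  push_cast
  linear_combination (-(1 / 4 : ℂ)) * (realExtD₃ (dFOmega h F LinearMap.id) (-𝒥.J (X 0))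
    (-𝒥.J (X 1)) (-𝒥.J (X 2)) (-𝒥.J (X 3)) p : ℂ) * Complex.I_mul_I

end FormsInInvariantFrame

/-! ### The sign of `γ₁` for an invariant metric -/

noncomputable section GammaSign

variable {G : Type*} [TopologicalSpace G] [ChartedSpace (EuclideanSpace ℝ (Fin 6)) G] [Group G]

theorem wedge_four_two (α : DForm G 4) (β : DForm G 2) (X : Fin 6 → GroupLieAlgebra (𝓡 6) G)
    (p : G) : wedge α β X p = (1 / 48 : ℂ) * ∑ σ : Equiv.Perm (Fin 6),
      ((Equiv.Perm.sign σ : ℤ) : ℂ) * α ![X (σ 0), X (σ 1), X (σ 2), X (σ 3)] p *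
        β ![X (σ 4), X (σ 5)] p := by
  have h1 : ∀ σ : Equiv.Perm (Fin 6), (fun i : Fin 4 ↦ X (σ (Fin.castAdd 2 i))) =
      ![X (σ 0), X (σ 1), X (σ 2), X (σ 3)] := by
    intro σ; ext i; fin_cases i <;> rfl
  have h2 : ∀ σ : Equiv.Perm (Fin 6), (fun i : Fin 2 ↦ X (σ (Fin.natAdd 4 i))) =
      ![X (σ 4), X (σ 5)] := by
    intro σ; ext i; fin_cases i <;> rfl
  have h3 : (((Nat.factorial 4 : ℕ) : ℂ) * ((Nat.factorial 2 : ℕ) : ℂ))⁻¹ = 1 / 48 := by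
    norm_num [Nat.factorial]
  simp only [wedge, h1, h2]
  rw [h3]

variable [LieGroup (𝓡 6) ∞ G] {𝒥 : InvComplexStructure (GroupLieAlgebra (𝓡 6) G)}
  (h : InvHermitianMetric 𝒥)

theorem wedge_fundamentalForm_self (X : Fin 4 → GroupLieAlgebra (𝓡 6) G) (p : G) :
    wedge (fundamentalForm h) (fundamentalForm h) X p =
      (wedge₂₂ h.omega h.omega (X 0) (X 1) (X 2) (X 3) : ℂ) := by
  have e : wedge (fundamentalForm h) (fundamentalForm h) X p = (1 / 4 : ℂ) *
      ∑ σ : Equiv.Perm (Fin 4), ((Equiv.Perm.sign σ : ℤ) : ℂ) *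
        (h.omega (X (σ 0)) (X (σ 1)) : ℂ) * (h.omega (X (σ 2)) (X (σ 3)) : ℂ) := by
    have h3 : (((Nat.factorial 2 : ℕ) : ℂ) * ((Nat.factorial 2 : ℕ) : ℂ))⁻¹ = 1 / 4 := by
      norm_num [Nat.factorial]
    simp only [wedge]
    rw [h3]; rfl
  rw [e, ← Equiv.sum_comp Equiv.Perm.decomposeFin.symm, Fintype.sum_prod_type]
  have e2 : ∀ f : Equiv.Perm (Fin 3) → ℂ, ∑ σ, f σ =
      ∑ q : Fin 3, ∑ r : Fin 2, f (Equiv.Perm.decomposeFin.symm (q,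
        Equiv.Perm.decomposeFin.symm (r, 1))) := by
    intro f
    rw [← Equiv.sum_comp Equiv.Perm.decomposeFin.symm, Fintype.sum_prod_type]
    refine Finset.sum_congr rfl fun q _ ↦ ?_
    rw [← Equiv.sum_comp Equiv.Perm.decomposeFin.symm, Fintype.sum_prod_type]
    refine Finset.sum_congr rfl fun r _ ↦ ?_
    rw [Fintype.sum_unique]; rfl
  have s1 : (1 : Fin 4) = Fin.succ 0 := rfl
  have s2 : (2 : Fin 4) = Fin.succ (Fin.succ 0) := rfl
  have s3 : (3 : Fin 4) = Fin.succ (Fin.succ (Fin.succ 0)) := rfl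
  simp only [e2, Equiv.Perm.decomposeFin.symm_sign, s1, s2, s3,
    Equiv.Perm.decomposeFin_symm_apply_succ, Equiv.Perm.decomposeFin_symm_apply_zero]
  simp only [Fin.sum_univ_succ, Fin.sum_univ_zero]
  simp [Equiv.swap_apply_def, Fin.ext_iff]
  simp only [wedge₂₂]
  have n := h.omega_swap
  rw [n (X 0) (X 1), n (X 0) (X 2), n (X 0) (X 3), n (X 1) (X 2), n (X 1) (X 3), n (X 2) (X 3)]
  push_cast
  ring

theorem wedge_fundamentalForm_cube (X : Fin 6 → GroupLieAlgebra (𝓡 6) G) (p : G) :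
    wedge (wedge (fundamentalForm h) (fundamentalForm h)) (fundamentalForm h) X p =
      ((1 / 48 * ∑ σ : Equiv.Perm (Fin 6), ((Equiv.Perm.sign σ : ℤ) : ℝ) *
        wedge₂₂ h.omega h.omega (X (σ 0)) (X (σ 1)) (X (σ 2)) (X (σ 3)) *
          h.omega (X (σ 4)) (X (σ 5)) : ℝ) : ℂ) := by
  rw [wedge_four_two (wedge (fundamentalForm h) (fundamentalForm h))]
  simp only [wedge_fundamentalForm_self]
  push_cast
  rfl

variable {h} {F : G → ℝ}

/-- The 4-form that is the real part of `(i/2) ∂∂̄ (F Ω)`, at a critical point of `F`. -/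
def ddbarCritical (h : InvHermitianMetric 𝒥) (F : G → ℝ) (p : G)
    (X Y Z W : GroupLieAlgebra (𝓡 6) G) : ℝ :=
  F p * h.ddbar X Y Z W - 1 / 8 * (wedge₂₂ (skewHessian F 𝒥.J p) h.omega X Y Z W +
    wedge₂₂ (skewHessian F 𝒥.J p) h.omega (-𝒥.J X) (-𝒥.J Y) (-𝒥.J Z) (-𝒥.J W))

omit [LieGroup (𝓡 6) ∞ G] in
theorem skewHessian_swap (A : GroupLieAlgebra (𝓡 6) G →ₗ[ℝ] GroupLieAlgebra (𝓡 6) G) (p : G)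
    (X Y : GroupLieAlgebra (𝓡 6) G) : skewHessian F A p Y X = -skewHessian F A p X Y := by
  simp [skewHessian]

theorem skewHessian_neg (hF : ContMDiff (𝓡 6) 𝓘(ℝ, ℝ) ∞ F)
    (A : GroupLieAlgebra (𝓡 6) G →ₗ[ℝ] GroupLieAlgebra (𝓡 6) G) (p : G)
    (X Y : GroupLieAlgebra (𝓡 6) G) : skewHessian F (-A) p X Y = -skewHessian F A p X Y := by
  have e : ∀ X Y : GroupLieAlgebra (𝓡 6) G,
      lieDerR X (lieDerR (-Y) F) p = -lieDerR X (lieDerR Y F) p := by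
    intro X Y
    have : lieDerR (-Y) F = fun q ↦ lieDerR Y F q * (-1) := by
      ext q; rw [lieDerR_neg_left]; ring
    rw [this, lieDerR_mul_const (contMDiff_lieDerR hF Y p)]; ring
  simp only [skewHessian, LinearMap.neg_apply, e]
  ring

/-- Real and imaginary parts of `(i/2) ∂∂̄ (F Ω) ∧ Ω` at a critical point of `F`. The density `R`
of the imaginary part involves only commutators of second derivatives of `F`. -/
theorem wedge_del_delBar_critical (hF : ContMDiff (𝓡 6) 𝓘(ℝ, ℝ) ∞ F) {p : G}
    (hp : ∀ X, lieDerR X F p = 0) (X : Fin 6 → GroupLieAlgebra (𝓡 6) G) :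
    ∃ R : (Fin 4 → GroupLieAlgebra (𝓡 6) G) → ℝ,
    (∀ Y, R Y = 1 / 8 * (wedge₂₂ (skewHessian F LinearMap.id p) h.omega (Y 0) (Y 1) (Y 2) (Y 3) +
      wedge₂₂ (skewHessian F LinearMap.id p) h.omega (-𝒥.J (Y 0)) (-𝒥.J (Y 1)) (-𝒥.J (Y 2))
        (-𝒥.J (Y 3)))) ∧
    Complex.I / 2 * wedge (del 𝒥 (delBar 𝒥 (funSmul F (fundamentalForm h))))
        (fundamentalForm h) X p =
      ((1 / 48 * ∑ σ : Equiv.Perm (Fin 6), ((Equiv.Perm.sign σ : ℤ) : ℝ) *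
        ddbarCritical h F p (X (σ 0)) (X (σ 1)) (X (σ 2)) (X (σ 3)) *
          h.omega (X (σ 4)) (X (σ 5)) : ℝ) : ℂ) +
      Complex.I * ((1 / 48 * ∑ σ : Equiv.Perm (Fin 6), ((Equiv.Perm.sign σ : ℤ) : ℝ) *
        R ![X (σ 0), X (σ 1), X (σ 2), X (σ 3)] * h.omega (X (σ 4)) (X (σ 5)) : ℝ) : ℂ) := by
  refine ⟨_, fun Y ↦ rfl, ?_⟩
  rw [wedge_four_two (del 𝒥 (delBar 𝒥 (funSmul F (fundamentalForm h))))]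
  push_cast
  simp only [Finset.mul_sum, ← Finset.sum_add_distrib]
  refine Finset.sum_congr rfl fun σ _ ↦ ?_
  rw [del_delBar_funSmul hF]
  simp only [realExtD₃_dFOmega hF _ _ _ _ _ p hp]
  -- the terms with `A = 1` carry `d (dΩ) = 0`; those with `A = ±J` combine to `ddbar`
  have z : ∀ X Y Z W : GroupLieAlgebra (𝓡 6) G,
      ceD₃ (fun X Y Z ↦ ceD₂ h.omega (LinearMap.id (R := ℝ) X) (LinearMap.id (R := ℝ) Y)
        (LinearMap.id (R := ℝ) Z)) X Y Z W = 0 := h.ceD₃_ceD₂_omega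
  have n : ∀ X Y Z W : GroupLieAlgebra (𝓡 6) G,
      ceD₃ (fun X Y Z ↦ ceD₂ h.omega ((-𝒥.J) X) ((-𝒥.J) Y) ((-𝒥.J) Z)) X Y Z W =
      -ceD₃ h.jdOmega X Y Z W := by
    intro X Y Z W
    have : (fun X Y Z ↦ ceD₂ h.omega ((-𝒥.J) X) ((-𝒥.J) Y) ((-𝒥.J) Z)) =
        fun X Y Z ↦ -h.jdOmega X Y Z := by
      ext X Y Z
      simp only [InvHermitianMetric.jdOmega, ceD₂, LinearMap.neg_apply, neg_lie, lie_neg, neg_neg,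
        h.omega_neg_right, h.omega_neg_left]
      ring
    rw [this]; simp only [ceD₃]; ring
  have m : ∀ X Y Z W : GroupLieAlgebra (𝓡 6) G,
      wedge₂₂ (skewHessian F (-𝒥.J) p) h.omega X Y Z W =
        -wedge₂₂ (skewHessian F 𝒥.J p) h.omega X Y Z W := by
    intro X Y Z W
    simp only [wedge₂₂, skewHessian_neg hF]; ring
  have j : (fun X Y Z ↦ ceD₂ h.omega (𝒥.J X) (𝒥.J Y) (𝒥.J Z)) = h.jdOmega := rfl
  simp only [z, n, m, j, ddbarCritical, InvHermitianMetric.ddbar, fundamentalForm,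
    Matrix.cons_val_zero, Matrix.cons_val_one, Matrix.cons_val]
  change _ = _
  have o : ∀ X Y, h.g (𝒥.J X) Y = h.omega X Y := fun _ _ ↦ rfl
  simp only [o]
  push_cast
  ring_nf
  simp only [Complex.I_sq]
  ring

/-- For an invariant metric the constant function solves the equation defining `γ₁`. -/
theorem isGamma₁_ddbarTrace (Γ : Subgroup G) {e : Fin 3 → GroupLieAlgebra (𝓡 6) G}
    (he : IsUnitaryFrame h e) : IsGamma₁ Γ h (h.ddbarTrace e / 6) := by
  refine ⟨fun _ ↦ 0, contMDiff_const, fun _ _ _ ↦ rfl, fun X p ↦ ?_⟩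
  have hF : ContMDiff (𝓡 6) 𝓘(ℝ, ℝ) ∞ (fun _ : G ↦ Real.exp 0) := contMDiff_const
  have hz : ∀ X : GroupLieAlgebra (𝓡 6) G, lieDerR X (fun _ : G ↦ Real.exp 0) = fun _ ↦ 0 := by
    intro X; ext q; exact lieDerR_const X _ q
  have hs : ∀ A X Y, skewHessian (fun _ : G ↦ Real.exp 0) A p X Y = 0 := by
    intro A X Y
    simp only [skewHessian, hz, lieDerR_const, sub_zero]
  obtain ⟨R, hR, heq⟩ := wedge_del_delBar_critical (h := h) hF (p := p)
    (fun X ↦ lieDerR_const X _ p) X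
  rw [heq, wedge_fundamentalForm_cube]
  have hd : Module.finrank ℝ (GroupLieAlgebra (𝓡 6) G) = 6 :=
    (finrank_euclideanSpace_fin (𝕜 := ℝ) (n := 6))
  have key := he.sum_ddbar_eq hd X
  have c : ∀ X Y Z W, ddbarCritical h (fun _ : G ↦ Real.exp 0) p X Y Z W = h.ddbar X Y Z W := by
    intro X Y Z W
    simp only [ddbarCritical, wedge₂₂, hs]
    rw [Real.exp_zero]
    ring
  have r : ∀ Y, R Y = 0 := by
    intro Y; rw [hR]; simp only [wedge₂₂, hs]; ring
  simp only [c, r, key]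
  simp
  ring

/-- The constant `γ₁` is bounded below by its value for the constant function: evaluate the equation
at a minimum of `v`, where the second order terms are nonnegative. -/
theorem IsGamma₁.ddbarTrace_le {Γ : Subgroup G}
    [CompactSpace (Quotient (QuotientGroup.rightRel Γ))] {γ : ℝ} (hγ : IsGamma₁ Γ h γ)
    {e : Fin 3 → GroupLieAlgebra (𝓡 6) G} (he : IsUnitaryFrame h e) :
    h.ddbarTrace e / 6 ≤ γ := by
  obtain ⟨v, hv, hΓ, heq⟩ := hγ
  -- `v` descends to the compact quotient, so it attains its minimum
  obtain ⟨p, hp⟩ : ∃ p, ∀ q, v p ≤ v q := by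
    let w : Quotient (QuotientGroup.rightRel Γ) → ℝ := Quotient.lift v (by
      intro a b hab
      have := hΓ _ (QuotientGroup.rightRel_apply.1 hab) a
      rwa [inv_mul_cancel_right, eq_comm] at this)
    have hw : Continuous w := hv.continuous.quotient_lift _
    obtain ⟨P, -, hP⟩ := isCompact_univ.exists_isMinOn ⟨Quotient.mk _ 1, trivial⟩ hw.continuousOn
    obtain ⟨p, rfl⟩ := Quotient.exists_rep P
    exact ⟨p, fun q ↦ hP (Set.mem_univ (Quotient.mk _ q))⟩
  set F : G → ℝ := fun q ↦ Real.exp (v q) with hFdef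
  have hF : ContMDiff (𝓡 6) 𝓘(ℝ, ℝ) ∞ F := Real.contDiff_exp.contMDiff.comp hv
  have hFp : ∀ q, F p ≤ F q := fun q ↦ Real.exp_le_exp.2 (hp q)
  have h1 := fun X ↦ (lieDerR_of_isMin hF hFp X).1
  have h2 := fun X ↦ (lieDerR_of_isMin hF hFp X).2
  have key := heq (realFrame 𝒥 e) p
  obtain ⟨R, -, heq'⟩ := wedge_del_delBar_critical (h := h) hF h1 (realFrame 𝒥 e)
  rw [heq', wedge_fundamentalForm_cube] at key
  have re := congrArg Complex.re key
  rw [← Complex.ofReal_mul, ← Complex.ofReal_mul, Complex.ofReal_re] at re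
  simp only [Complex.add_re, Complex.ofReal_re, Complex.I_mul_re, Complex.ofReal_im, neg_zero,
    add_zero] at re
  have w01 := wedge₂₂_swap01 h.omega_swap h.omega_swap
  have w12 := wedge₂₂_swap12 h.omega_swap h.omega_swap
  have w23 := wedge₂₂_swap23 h.omega_swap h.omega_swap
  have e₂ := he.sum_perm_six w01 w12 w23
  have sh := skewHessian_swap (F := F) 𝒥.J p
  have e₁ := he.sum_perm_six (A := ddbarCritical h F p)
    (by
      intro X Y Z W
      simp only [ddbarCritical]
      rw [h.ddbar_swap01, wedge₂₂_swap01 sh h.omega_swap X,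
        wedge₂₂_swap01 sh h.omega_swap (-𝒥.J X)]
      ring)
    (by
      intro X Y Z W
      simp only [ddbarCritical]
      rw [h.ddbar_swap12, wedge₂₂_swap12 sh h.omega_swap _ Y,
        wedge₂₂_swap12 sh h.omega_swap _ (-𝒥.J Y)]
      ring)
    (by
      intro X Y Z W
      simp only [ddbarCritical]
      rw [h.ddbar_swap23, wedge₂₂_swap23 sh h.omega_swap _ _ Z,
        wedge₂₂_swap23 sh h.omega_swap _ _ (-𝒥.J Z)]
      ring)
  rw [e₁, e₂] at re
  have e₃ : ∀ i j, i ≠ j →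
      wedge₂₂ h.omega h.omega (e i) (𝒥.J (e i)) (e j) (𝒥.J (e j)) = 2 := by
    intro i j hij
    simp [wedge₂₂, he.omega_apply, he.omega_J_J, he.omega_right_J, he.omega_left_J, hij, hij.symm]
    norm_num
  have hn : ∀ X Y : GroupLieAlgebra (𝓡 6) G,
      lieDerR X (lieDerR (-Y) F) p = -lieDerR X (lieDerR Y F) p := by
    intro X Y
    have : lieDerR (-Y) F = fun q ↦ lieDerR Y F q * (-1) := by
      ext q; rw [lieDerR_neg_left]; ring
    rw [this, lieDerR_mul_const (contMDiff_lieDerR hF Y p)]; ring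
  have e₄ : ∀ i j, i ≠ j → ddbarCritical h F p (e i) (𝒥.J (e i)) (e j) (𝒥.J (e j)) =
      F p * h.ddbar (e i) (𝒥.J (e i)) (e j) (𝒥.J (e j)) + 1 / 4 *
        (lieDerR (e i) (lieDerR (e i) F) p + lieDerR (𝒥.J (e i)) (lieDerR (𝒥.J (e i)) F) p +
        lieDerR (e j) (lieDerR (e j) F) p + lieDerR (𝒥.J (e j)) (lieDerR (𝒥.J (e j)) F) p) := by
    intro i j hij
    simp only [ddbarCritical, wedge₂₂, 𝒥.sq, neg_neg, h.omega_neg_left, h.omega_neg_right,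
      he.omega_apply, he.omega_J_J, he.omega_right_J, he.omega_left_J, hij, hij.symm, if_true,
      if_false, skewHessian, map_neg, hn, lieDerR_neg_left]
    ring
  rw [e₃ 0 1 (by decide), e₃ 0 2 (by decide), e₃ 1 2 (by decide), e₄ 0 1 (by decide),
    e₄ 0 2 (by decide), e₄ 1 2 (by decide)] at re
  have hpos : 0 < F p := Real.exp_pos _
  have a0 := h2 (e 0)
  have a1 := h2 (e 1)
  have a2 := h2 (e 2)
  have b0 := h2 (𝒥.J (e 0))
  have b1 := h2 (𝒥.J (e 1))
  have b2 := h2 (𝒥.J (e 2))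
  -- the second order terms add up to a positive multiple of the Laplacian of `F` at its minimum
  have re' : γ * F p * 6 = F p * h.ddbarTrace e + 1 / 2 *
      (lieDerR (e 0) (lieDerR (e 0) F) p + lieDerR (𝒥.J (e 0)) (lieDerR (𝒥.J (e 0)) F) p +
        lieDerR (e 1) (lieDerR (e 1) F) p + lieDerR (𝒥.J (e 1)) (lieDerR (𝒥.J (e 1)) F) p +
        lieDerR (e 2) (lieDerR (e 2) F) p + lieDerR (𝒥.J (e 2)) (lieDerR (𝒥.J (e 2)) F) p) := by
    simp only [InvHermitianMetric.ddbarTrace]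
    change _ = γ * F p * _ at re
    linear_combination -re
  have : F p * h.ddbarTrace e ≤ F p * (γ * 6) := by linarith
  have := le_of_mul_le_mul_left this hpos
  linarith

end GammaSign

/-! ### The contraction of `(i/2) ∂∂̄Ω` in a unitary coframe -/

section Coframes

variable {𝔤 : Type*} [LieRing 𝔤] [LieAlgebra ℝ 𝔤] {𝒥 : InvComplexStructure 𝔤}

/-- `θ` is the unitary coframe of `(1,0)`-forms dual to the unitary frame `e`. In it,
`Ω = (i/2) ∑ θᵏ ∧ θ̄ᵏ`, which is the real expression of `omega_eq`. -/
structure IsUnitaryCoframe (h : InvHermitianMetric 𝒥) (e : Fin 3 → 𝔤) (θ : Fin 3 → 𝔤 →ₗ[ℝ] ℂ) :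
    Prop where
  apply_J : ∀ k X, θ k (𝒥.J X) = Complex.I * θ k X
  apply_frame : ∀ j k, θ j (e k) = if j = k then 1 else 0
  omega_eq : ∀ X Y, h.omega X Y =
    ∑ k, ((θ k X).re * (θ k Y).im - (θ k X).im * (θ k Y).re)
  expand : ∀ X, X = ∑ k, ((θ k X).re • e k + (θ k X).im • 𝒥.J (e k))

theorem IsUnitaryFrame.expand {h : InvHermitianMetric 𝒥} {e : Fin 3 → 𝔤}
    (he : IsUnitaryFrame h e) (hd : Module.finrank ℝ 𝔤 = 6) (X : 𝔤) :
    X = ∑ k, (h.g X (e k) • e k + h.g X (𝒥.J (e k)) • 𝒥.J (e k)) := by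
  obtain ⟨b, hb⟩ := he.exists_basis hd
  have o1 := he.orthonormal
  have o2 := he.orthogonal_J
  have o3 : ∀ i j, h.g (e i) (𝒥.J (e j)) = 0 := fun i j ↦ by rw [h.symm, o2]
  have o4 : ∀ i j, h.g (𝒥.J (e i)) (𝒥.J (e j)) = if i = j then 1 else 0 := fun i j ↦ by
    rw [h.compat, o1]
  -- the difference of the two sides is orthogonal to a basis
  set Z := X - ∑ k, (h.g X (e k) • e k + h.g X (𝒥.J (e k)) • 𝒥.J (e k)) with hZ
  have key : h.g Z = 0 := by
    refine b.ext fun i ↦ ?_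
    rw [hb, hZ]
    fin_cases i <;> simp [realFrame, Fin.sum_univ_three, o1, o2, o3, o4]
  by_contra hne
  have : Z ≠ 0 := fun h0 ↦ hne (sub_eq_zero.1 h0)
  have := h.pos Z this
  rw [key] at this
  simp at this

theorem IsUnitaryFrame.exists_coframe {h : InvHermitianMetric 𝒥} {e : Fin 3 → 𝔤}
    (he : IsUnitaryFrame h e) (hd : Module.finrank ℝ 𝔤 = 6) :
    ∃ θ : Fin 3 → 𝔤 →ₗ[ℝ] ℂ, IsUnitaryCoframe h e θ := by
  have o1 := he.orthonormal
  have o2 := he.orthogonal_J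
  have gJ : ∀ X Y, h.g (𝒥.J X) Y = -h.g X (𝒥.J Y) := by
    intro X Y
    have := h.compat X (𝒥.J Y)
    rw [𝒥.sq, map_neg] at this
    linarith
  let θ : Fin 3 → 𝔤 →ₗ[ℝ] ℂ := fun k ↦
    Complex.ofRealCLM.toLinearMap ∘ₗ (h.g (e k)) +
      Complex.I • (Complex.ofRealCLM.toLinearMap ∘ₗ (h.g (𝒥.J (e k))))
  have hθ : ∀ k X, θ k X = (h.g X (e k) : ℂ) + Complex.I * (h.g X (𝒥.J (e k)) : ℂ) := by
    intro k X
    simp [θ, h.symm X]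
  have hre : ∀ k X, (θ k X).re = h.g X (e k) := by intro k X; simp [hθ]
  have him : ∀ k X, (θ k X).im = h.g X (𝒥.J (e k)) := by intro k X; simp [hθ]
  refine ⟨θ, ?_, ?_, ?_, ?_⟩
  · intro k X
    rw [hθ, hθ, gJ, h.compat]
    push_cast
    linear_combination -(h.g X (𝒥.J (e k)) : ℂ) * Complex.I_mul_I
  · intro j k
    rw [hθ, o1, h.symm, o2]
    rcases eq_or_ne j k with rfl | hjk
    · simp
    · simp [hjk, hjk.symm]
  · intro X Y
    simp only [hre, him]
    conv_lhs => rw [InvHermitianMetric.omega, he.expand hd X]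
    simp only [map_sum, map_add, map_smul, 𝒥.sq, smul_neg, LinearMap.sum_apply,
      LinearMap.add_apply, LinearMap.smul_apply, LinearMap.neg_apply, map_neg, smul_eq_mul]
    refine Finset.sum_congr rfl fun k _ ↦ ?_
    rw [h.symm (𝒥.J (e k)), h.symm (e k)]
    ring
  · intro X
    simp only [hre, him]
    exact he.expand hd X

/-- The contraction of `(i/2) ∂∂̄ Ω` in terms of the structure constants of a unitary coframe
adapted to a `J`-invariant flag. -/
theorem IsUnitaryCoframe.ddbarTrace_eq {h : InvHermitianMetric 𝒥} {e : Fin 3 → 𝔤}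
    {θ : Fin 3 → 𝔤 →ₗ[ℝ] ℂ} (hθ : IsUnitaryCoframe h e θ)
    {a b c d f A12 A13 B11 B12 B13 B21 B22 : ℂ}
    (h0 : ∀ X Y : 𝔤, θ 0 ⁅X, Y⁆ = 0)
    (h1 : ∀ X Y : 𝔤, θ 1 ⁅X, Y⁆ = -(a * (θ 0 X * θ 1 Y - θ 0 Y * θ 1 X)
      + b * (θ 0 X * θ 2 Y - θ 0 Y * θ 2 X)
      + c * (θ 0 X * star (θ 0 Y) - θ 0 Y * star (θ 0 X))
      + d * (θ 0 X * star (θ 1 Y) - θ 0 Y * star (θ 1 X))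
      + f * (θ 0 X * star (θ 2 Y) - θ 0 Y * star (θ 2 X))))
    (h2 : ∀ X Y : 𝔤, θ 2 ⁅X, Y⁆ = -(A12 * (θ 0 X * θ 1 Y - θ 0 Y * θ 1 X)
      + A13 * (θ 0 X * θ 2 Y - θ 0 Y * θ 2 X)
      + B11 * (θ 0 X * star (θ 0 Y) - θ 0 Y * star (θ 0 X))
      + B12 * (θ 0 X * star (θ 1 Y) - θ 0 Y * star (θ 1 X))
      + B13 * (θ 0 X * star (θ 2 Y) - θ 0 Y * star (θ 2 X))
      + B21 * (θ 1 X * star (θ 0 Y) - θ 1 Y * star (θ 0 X))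
      + B22 * (θ 1 X * star (θ 1 Y) - θ 1 Y * star (θ 1 X))))
    (htr : A13 = -a) :
    h.ddbarTrace e = ‖f - B12‖ ^ 2 + ‖b - star B21‖ ^ 2 + ‖A12‖ ^ 2 + 2 * ‖a‖ ^ 2
      - 2 * (B22 * star B11).re := by
  subst htr
  have f00 : θ 0 (e 0) = 1 := by simp [hθ.apply_frame]
  have f01 : θ 0 (e 1) = 0 := by simp [hθ.apply_frame]
  have f02 : θ 0 (e 2) = 0 := by simp [hθ.apply_frame]
  have f10 : θ 1 (e 0) = 0 := by simp [hθ.apply_frame]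
  have f11 : θ 1 (e 1) = 1 := by simp [hθ.apply_frame]
  have f12 : θ 1 (e 2) = 0 := by simp [hθ.apply_frame]
  have f20 : θ 2 (e 0) = 0 := by simp [hθ.apply_frame]
  have f21 : θ 2 (e 1) = 0 := by simp [hθ.apply_frame]
  have f22 : θ 2 (e 2) = 1 := by simp [hθ.apply_frame]
  simp only [InvHermitianMetric.ddbarTrace, InvHermitianMetric.ddbar, ceD₃,
    InvHermitianMetric.jdOmega, ceD₂, hθ.omega_eq, Fin.sum_univ_three, hθ.apply_J, map_neg, h0, h1,
    h2, f00, f01, f02, f10, f11, f12, f20, f21, f22, 𝒥.sq, neg_neg, neg_lie, lie_neg]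
  simp [← Complex.normSq_eq_norm_sq, Complex.normSq_apply]
  ring

end Coframes

/-! ### A flag of `J`-invariant subspaces and frames adapted to it -/

section Flags

variable {𝔤 : Type*} [LieRing 𝔤] [LieAlgebra ℝ 𝔤] (𝒥 : InvComplexStructure 𝔤)

/-- The smallest `J`-invariant subspace containing the `i`-th term of the lower central series. -/
def InvComplexStructure.series (i : ℕ) : Submodule ℝ 𝔤 :=
  (LieModule.lowerCentralSeries ℝ 𝔤 𝔤 i).toSubmodule ⊔
    (LieModule.lowerCentralSeries ℝ 𝔤 𝔤 i).toSubmodule.map 𝒥.J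

namespace InvComplexStructure

variable {𝒥}

theorem mem_series {i : ℕ} {X : 𝔤} : X ∈ 𝒥.series i ↔
    ∃ u ∈ LieModule.lowerCentralSeries ℝ 𝔤 𝔤 i, ∃ w ∈ LieModule.lowerCentralSeries ℝ 𝔤 𝔤 i,
      u + 𝒥.J w = X := by
  simp [series, Submodule.mem_sup]

theorem lcs_mem_series {i : ℕ} {X : 𝔤} (hX : X ∈ LieModule.lowerCentralSeries ℝ 𝔤 𝔤 i) :
    X ∈ 𝒥.series i := mem_series.2 ⟨X, hX, 0, zero_mem _, by simp⟩

theorem J_lcs_mem_series {i : ℕ} {X : 𝔤} (hX : X ∈ LieModule.lowerCentralSeries ℝ 𝔤 𝔤 i) :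
    𝒥.J X ∈ 𝒥.series i := mem_series.2 ⟨0, zero_mem _, X, hX, by simp⟩

theorem J_mem_series {i : ℕ} {X : 𝔤} (hX : X ∈ 𝒥.series i) : 𝒥.J X ∈ 𝒥.series i := by
  obtain ⟨u, hu, w, hw, rfl⟩ := mem_series.1 hX
  refine mem_series.2 ⟨-w, neg_mem hw, u, hu, ?_⟩
  rw [map_add, 𝒥.sq]; abel

theorem series_zero : 𝒥.series 0 = ⊤ := by
  rw [eq_top_iff]
  intro X _
  exact lcs_mem_series (by simp)

theorem series_antitone : Antitone 𝒥.series := by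
  intro i j hij X hX
  obtain ⟨u, hu, w, hw, rfl⟩ := mem_series.1 hX
  have := LieModule.antitone_lowerCentralSeries ℝ 𝔤 𝔤 hij
  exact mem_series.2 ⟨u, this hu, w, this hw, rfl⟩

theorem lie_lcs {i : ℕ} {X Y : 𝔤} (hY : Y ∈ LieModule.lowerCentralSeries ℝ 𝔤 𝔤 i) :
    ⁅X, Y⁆ ∈ LieModule.lowerCentralSeries ℝ 𝔤 𝔤 (i + 1) := by
  rw [LieModule.lowerCentralSeries_succ]
  exact LieSubmodule.lie_mem_lie (LieSubmodule.mem_top _) hY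

theorem lcs_lie {i : ℕ} {X Y : 𝔤} (hX : X ∈ LieModule.lowerCentralSeries ℝ 𝔤 𝔤 i) :
    ⁅X, Y⁆ ∈ LieModule.lowerCentralSeries ℝ 𝔤 𝔤 (i + 1) := by
  rw [← lie_skew]; exact neg_mem (lie_lcs hX)

/-- For `X` in the `i`-th term, `ad X` is `J`-linear modulo the next term; this is the
integrability of `J`. -/
theorem lie_J_sub_mem_series {i : ℕ} {X : 𝔤} (hX : X ∈ 𝒥.series i) (Y : 𝔤) :
    ⁅X, 𝒥.J Y⁆ - 𝒥.J ⁅X, Y⁆ ∈ 𝒥.series (i + 1) := by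
  obtain ⟨u, hu, w, hw, rfl⟩ := mem_series.1 hX
  have h1 := 𝒥.integrable w Y
  have : ⁅u + 𝒥.J w, 𝒥.J Y⁆ - 𝒥.J ⁅u + 𝒥.J w, Y⁆ =
      (⁅u, 𝒥.J Y⁆ + ⁅w, Y⁆) + 𝒥.J (⁅w, 𝒥.J Y⁆ - ⁅u, Y⁆) := by
    rw [add_lie, add_lie, map_add, map_sub]
    rw [sub_sub, sub_sub, sub_eq_zero] at h1
    rw [h1]; abel
  rw [this]
  exact mem_series.2 ⟨_, add_mem (lcs_lie hu) (lcs_lie hw), _,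
    sub_mem (lcs_lie hw) (lcs_lie hu), rfl⟩

theorem lie_mem_series {i : ℕ} {X Y : 𝔤} (hX : X ∈ 𝒥.series i) (hY : Y ∈ 𝒥.series i) :
    ⁅X, Y⁆ ∈ 𝒥.series (i + 1) := by
  obtain ⟨u, hu, w, hw, rfl⟩ := mem_series.1 hY
  rw [lie_add]
  refine add_mem (lcs_mem_series (lie_lcs hu)) ?_
  have := add_mem (lie_J_sub_mem_series hX w) (J_lcs_mem_series (𝒥 := 𝒥) (lie_lcs (X := X) hw))
  rwa [sub_add_cancel] at this

variable [LieRing.IsNilpotent 𝔤]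

variable (𝒥) in
theorem exists_series_eq_bot : ∃ k, 𝒥.series k = ⊥ := by
  obtain ⟨k, hk⟩ := LieModule.IsNilpotent.nilpotent ℝ 𝔤 𝔤
  exact ⟨k, by simp [series, hk]⟩

/-- There is a closed `(1,0)`-form: the commutator ideal and its image under `J` do not span. -/
theorem series_one_ne_top [Nontrivial 𝔤] : 𝒥.series 1 ≠ ⊤ := by
  intro h1
  have key : ∀ i, 𝒥.series i = ⊤ := by
    intro i
    induction i with
    | zero => exact series_zero
    | succ i ih =>
      have h3 : (LieModule.lowerCentralSeries ℝ 𝔤 𝔤 1).toSubmodule ≤ 𝒥.series (i + 1) := by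
        rw [LieModule.lowerCentralSeries_succ, LieSubmodule.lieIdeal_oper_eq_linear_span',
          Submodule.span_le]
        rintro _ ⟨X, -, Y, -, rfl⟩
        exact lie_mem_series (by rw [ih]; trivial) (by rw [ih]; trivial)
      rw [eq_top_iff, ← h1]
      intro X hX
      obtain ⟨u, hu, w, hw, rfl⟩ := mem_series.1 hX
      exact add_mem (h3 hu) (J_mem_series (h3 hw))
  obtain ⟨k, hk⟩ := exists_series_eq_bot 𝒥
  rw [key] at hk
  exact top_ne_bot hk

end InvComplexStructure

namespace InvHermitianMetric

variable {𝒥} (h : InvHermitianMetric 𝒥)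

theorem exists_unit_mem {W : Submodule ℝ 𝔤} (hW : W ≠ ⊥) : ∃ e ∈ W, h.g e e = 1 := by
  obtain ⟨x, hx, hx0⟩ := W.exists_mem_ne_zero_of_ne_bot hW
  have hp := h.pos x hx0
  refine ⟨(Real.sqrt (h.g x x))⁻¹ • x, W.smul_mem _ hx, ?_⟩
  simp only [map_smul, LinearMap.smul_apply, smul_eq_mul]
  rw [← mul_assoc, ← mul_inv, Real.mul_self_sqrt hp.le, inv_mul_cancel₀ hp.ne']

theorem exists_unit_orthogonal [Module.Finite ℝ 𝔤] {W : Submodule ℝ 𝔤} (hW : W ≠ ⊤) :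
    ∃ e, h.g e e = 1 ∧ ∀ w ∈ W, h.g e w = 0 := by
  obtain ⟨f, hf, hW'⟩ := W.exists_le_ker_of_lt_top hW.lt_top
  have inj : Function.Injective h.g := by
    rw [injective_iff_map_eq_zero]
    intro X hX
    by_contra h0
    have := h.pos X h0
    rw [hX] at this; simp at this
  have surj : Function.Surjective h.g :=
    (LinearMap.injective_iff_surjective_of_finrank_eq_finrank
      (Subspace.dual_finrank_eq (K := ℝ) (V := 𝔤)).symm).1 inj
  obtain ⟨x, rfl⟩ := surj f
  let V : Submodule ℝ 𝔤 := ⨅ w : W, LinearMap.ker (h.g.flip (w : 𝔤))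
  have hV : ∀ y, y ∈ V ↔ ∀ w ∈ W, h.g y w = 0 := by
    intro y; simp [V, Submodule.mem_iInf]
  have hx : x ∈ V := (hV x).2 fun w hw ↦ hW' hw
  have hx0 : V ≠ ⊥ := by
    rintro h0
    rw [h0, Submodule.mem_bot] at hx
    exact hf (by rw [hx, map_zero])
  obtain ⟨e, he, h1⟩ := h.exists_unit_mem hx0
  exact ⟨e, h1, (hV e).1 he⟩

theorem J_orthogonal {X Y : 𝔤} (hXY : h.g X (𝒥.J Y) = 0) : h.g (𝒥.J X) Y = 0 := by
  have := h.compat X (𝒥.J Y)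
  rw [𝒥.sq, map_neg, hXY] at this
  linarith

theorem g_J_self (X : 𝔤) : h.g (𝒥.J X) X = 0 := by
  have := h.omega_swap X X
  simp only [omega] at this
  linarith

/-- Three unit vectors that span mutually orthogonal complex lines form a unitary frame. -/
theorem isUnitaryFrame_of {e₀ e₁ e₂ : 𝔤} (u0 : h.g e₀ e₀ = 1) (u1 : h.g e₁ e₁ = 1)
    (u2 : h.g e₂ e₂ = 1) (o01 : h.g e₁ e₀ = 0) (o01' : h.g e₁ (𝒥.J e₀) = 0) (o12 : h.g e₁ e₂ = 0)
    (o12' : h.g e₁ (𝒥.J e₂) = 0) (o02 : h.g e₀ e₂ = 0) (o02' : h.g e₀ (𝒥.J e₂) = 0) :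
    IsUnitaryFrame h ![e₀, e₁, e₂] := by
  have s := h.symm
  constructor
  · intro i j
    fin_cases i <;> fin_cases j <;> simp [u0, u1, u2, o01, o12, o02, s e₀ e₁, s e₂]
  · intro i j
    fin_cases i <;> fin_cases j <;>
      simp [h.g_J_self, h.J_orthogonal o01', h.J_orthogonal o12', h.J_orthogonal o02',
        s _ e₁, s (𝒥.J e₂) e₀, o01', o12', o02']

end InvHermitianMetric

/-- A unitary frame adapted to the series of `J`-invariant subspaces: the flag
`⟨e₂⟩ ⊆ ⟨e₁, e₂⟩ ⊆ 𝔤` of complex subspaces is interlaced with the series. The vector `e₂` is taken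
in the last nonzero term, and `e₀` orthogonal to `𝒥.series 1` and to `e₂`. -/
theorem exists_adapted_frame [LieRing.IsNilpotent 𝔤] {𝒥 : InvComplexStructure 𝔤}
    (hd : Module.finrank ℝ 𝔤 = 6)
    (h : InvHermitianMetric 𝒥) :
    ∃ (e : Fin 3 → 𝔤) (θ : Fin 3 → 𝔤 →ₗ[ℝ] ℂ), IsUnitaryFrame h e ∧ IsUnitaryCoframe h e θ ∧
      (∀ X ∈ 𝒥.series 1, θ 0 X = 0) ∧
      (∃ i, (∀ X ∈ 𝒥.series (i + 1), θ 0 X = 0 ∧ θ 1 X = 0) ∧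
        ∀ X, θ 0 X = 0 → X ∈ 𝒥.series i) ∧
      ∃ j, 𝒥.series (j + 1) = ⊥ ∧ e 2 ∈ 𝒥.series j := by
  have : Module.Finite ℝ 𝔤 := Module.finite_of_finrank_pos (by omega)
  have : Nontrivial 𝔤 := Module.nontrivial_of_finrank_pos (R := ℝ) (by omega)
  classical
  have hb := InvComplexStructure.exists_series_eq_bot 𝒥
  obtain ⟨j, hj⟩ : ∃ j, Nat.find hb = j + 1 := Nat.exists_eq_succ_of_ne_zero (by
    intro h0
    have := Nat.find_spec hb
    rw [h0, InvComplexStructure.series_zero] at this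
    exact top_ne_bot this)
  have hj1 : 𝒥.series (j + 1) = ⊥ := hj ▸ Nat.find_spec hb
  have hj0 : ∀ m, m ≤ j → 𝒥.series m ≠ ⊥ := fun m hm ↦ Nat.find_min hb (by omega)
  have small : ∀ s : Finset 𝔤, s.card < 6 → Submodule.span ℝ (s : Set 𝔤) ≠ ⊤ := by
    intro s hs htop
    have := finrank_span_finset_le_card (R := ℝ) s
    rw [Set.finrank, htop, finrank_top] at this
    omega
  obtain ⟨e₂, he₂, u2⟩ := h.exists_unit_mem (hj0 j le_rfl)
  have hW : 𝒥.series 1 ⊔ Submodule.span ℝ (({e₂, 𝒥.J e₂} : Finset 𝔤) : Set 𝔤) ≠ ⊤ := by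
    rcases Nat.eq_zero_or_pos j with rfl | hpos
    · rw [hj1, bot_sup_eq]
      exact small _ (by have := Finset.card_le_two (a := e₂) (b := 𝒥.J e₂); omega)
    · have h1 : e₂ ∈ 𝒥.series 1 := InvComplexStructure.series_antitone hpos he₂
      rw [sup_eq_left.2]
      · exact InvComplexStructure.series_one_ne_top
      · rw [Submodule.span_le]
        intro x hx
        simp only [Finset.coe_insert, Finset.coe_singleton, Set.mem_insert_iff,
          Set.mem_singleton_iff] at hx
        rcases hx with rfl | rfl
        exacts [h1, InvComplexStructure.J_mem_series h1]
  obtain ⟨e₀, u0, o0⟩ := h.exists_unit_orthogonal hW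
  obtain ⟨e₁, u1, o1⟩ := h.exists_unit_orthogonal
    (small {e₀, 𝒥.J e₀, e₂, 𝒥.J e₂} (by
      have := Finset.card_le_four (a := e₀) (b := 𝒥.J e₀) (c := e₂) (d := 𝒥.J e₂); omega))
  have hs2 : ∀ x ∈ ({e₂, 𝒥.J e₂} : Finset 𝔤), h.g e₀ x = 0 := fun x hx ↦
    o0 x (Submodule.mem_sup_right (Submodule.subset_span hx))
  have hs4 : ∀ x ∈ ({e₀, 𝒥.J e₀, e₂, 𝒥.J e₂} : Finset 𝔤), h.g e₁ x = 0 := fun x hx ↦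
    o1 x (Submodule.subset_span hx)
  have he : IsUnitaryFrame h ![e₀, e₁, e₂] := h.isUnitaryFrame_of u0 u1 u2 (hs4 _ (by simp))
    (hs4 _ (by simp)) (hs4 _ (by simp)) (hs4 _ (by simp)) (hs2 _ (by simp)) (hs2 _ (by simp))
  obtain ⟨θ, hθ⟩ := he.exists_coframe hd
  have hθ1 : ∀ X ∈ 𝒥.series 1, θ 0 X = 0 := by
    intro X hX
    have c1 : h.g e₀ X = 0 := o0 X (Submodule.mem_sup_left hX)
    have c2 : h.g e₀ (𝒥.J X) = 0 :=
      o0 _ (Submodule.mem_sup_left (InvComplexStructure.J_mem_series hX))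
    have m1 := hθ.omega_eq e₀ X
    have m2 := hθ.omega_eq e₀ (𝒥.J X)
    rw [h.omega_swap, InvHermitianMetric.omega, h.symm] at m1
    rw [h.omega_swap, InvHermitianMetric.omega, h.symm, 𝒥.sq] at m2
    have f0 : θ 0 e₀ = 1 := by simpa using hθ.apply_frame 0 0
    have f1 : θ 1 e₀ = 0 := by simpa using hθ.apply_frame 1 0
    have f2 : θ 2 e₀ = 0 := by simpa using hθ.apply_frame 2 0
    simp [Fin.sum_univ_three, f0, f1, f2, c1, c2, hθ.apply_J] at m1 m2
    exact Complex.ext m2.symm m1.symm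
  refine ⟨_, θ, he, hθ, hθ1, ?_, j, hj1, he₂⟩
  -- a term of the series that contains `e₂` and has nonzero `θ¹` on the kernel of `θ⁰` contains
  -- this kernel, since it is `J`-invariant
  have star : ∀ m, e₂ ∈ 𝒥.series m → ∀ y ∈ 𝒥.series m, θ 0 y = 0 → θ 1 y ≠ 0 →
      ∀ X, θ 0 X = 0 → X ∈ 𝒥.series m := by
    intro m hm y hy hy0 hy1 X hX
    have hJ := fun {Z : 𝔤} (hZ : Z ∈ 𝒥.series m) ↦ InvComplexStructure.J_mem_series hZ
    have hex := hθ.expand y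
    simp only [Fin.sum_univ_three, hy0, Complex.zero_re, Complex.zero_im, zero_smul, zero_add,
      Matrix.cons_val_one, Matrix.cons_val_zero, Matrix.cons_val] at hex
    have hw : (θ 1 y).re • e₁ + (θ 1 y).im • 𝒥.J e₁ ∈ 𝒥.series m := by
      have := sub_mem hy (add_mem ((𝒥.series m).smul_mem (θ 2 y).re hm)
        ((𝒥.series m).smul_mem (θ 2 y).im (hJ hm)))
      rwa [sub_eq_of_eq_add hex] at this
    have hn : (θ 1 y).re * (θ 1 y).re + (θ 1 y).im * (θ 1 y).im ≠ 0 := by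
      rw [← Complex.normSq_apply]; exact (Complex.normSq_pos.2 hy1).ne'
    have h1 : e₁ ∈ 𝒥.series m := by
      have := sub_mem ((𝒥.series m).smul_mem (θ 1 y).re hw)
        ((𝒥.series m).smul_mem (θ 1 y).im (hJ hw))
      have e : (θ 1 y).re • ((θ 1 y).re • e₁ + (θ 1 y).im • 𝒥.J e₁) -
          (θ 1 y).im • 𝒥.J ((θ 1 y).re • e₁ + (θ 1 y).im • 𝒥.J e₁) =
          ((θ 1 y).re * (θ 1 y).re + (θ 1 y).im * (θ 1 y).im) • e₁ := by
        rw [map_add, map_smul, map_smul, 𝒥.sq]; module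
      rw [e] at this
      exact ((𝒥.series m).smul_mem_iff hn).1 this
    have hex' := hθ.expand X
    simp only [Fin.sum_univ_three, hX, Complex.zero_re, Complex.zero_im, zero_smul, zero_add,
      Matrix.cons_val_one, Matrix.cons_val_zero, Matrix.cons_val] at hex'
    rw [hex']
    exact add_mem (add_mem ((𝒥.series m).smul_mem _ h1) ((𝒥.series m).smul_mem _ (hJ h1)))
      (add_mem ((𝒥.series m).smul_mem _ hm) ((𝒥.series m).smul_mem _ (hJ hm)))
  have hex : ∃ m, ¬ ∀ X, θ 0 X = 0 → X ∈ 𝒥.series m := by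
    refine ⟨j + 1, fun hall ↦ ?_⟩
    have h0 : θ 0 e₂ = 0 := by simpa using hθ.apply_frame 0 2
    have h1 := hall e₂ h0
    rw [hj1, Submodule.mem_bot] at h1
    rw [h1] at u2; simp at u2
  obtain ⟨i, hi⟩ : ∃ i, Nat.find hex = i + 1 := Nat.exists_eq_succ_of_ne_zero (by
    intro h0
    have := Nat.find_spec hex
    rw [h0, InvComplexStructure.series_zero] at this
    exact this fun X _ ↦ trivial)
  refine ⟨i, fun X hX ↦ ?_, not_not.1 (Nat.find_min hex (by omega))⟩
  have hX0 := hθ1 X (InvComplexStructure.series_antitone (by omega : 1 ≤ i + 1) hX)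
  refine ⟨hX0, ?_⟩
  by_contra hne
  have hns := Nat.find_spec hex
  rw [hi] at hns
  refine hns (star (i + 1) ?_ X hX hX0 hne)
  have hle : i + 1 ≤ j := by
    by_contra hlt
    have h1 := InvComplexStructure.series_antitone (𝒥 := 𝒥) (by omega : j + 1 ≤ i + 1) hX
    rw [hj1, Submodule.mem_bot] at h1
    rw [h1] at hne; simp at hne
  exact InvComplexStructure.series_antitone hle he₂

end Flags

/-! ### Structure equations forced by nilpotency -/

section StructureEquations

variable {𝔤 : Type*} [LieRing 𝔤] [LieAlgebra ℝ 𝔤] {𝒥 : InvComplexStructure 𝔤}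

/-- The differential of a `(1,0)`-form has no component of type `(0,2)`; this is its expression in a
unitary coframe. -/
theorem IsUnitaryCoframe.exists_type_decomposition {h : InvHermitianMetric 𝒥} {e : Fin 3 → 𝔤}
    {θ : Fin 3 → 𝔤 →ₗ[ℝ] ℂ} (hθ : IsUnitaryCoframe h e θ) {α : 𝔤 →ₗ[ℝ] ℂ}
    (hα : ∀ X, α (𝒥.J X) = Complex.I * α X) :
    ∃ A B : Fin 3 → Fin 3 → ℂ, (∀ i j, A j i = -A i j) ∧ ∀ X Y, α ⁅X, Y⁆ =
      ∑ i, ∑ j, (A i j * (θ i X * θ j Y) + B i j * (θ i X * star (θ j Y))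
        - B j i * (star (θ i X) * θ j Y)) := by
  have int : ∀ X Y, α ⁅𝒥.J X, 𝒥.J Y⁆ =
      α ⁅X, Y⁆ + Complex.I * (α ⁅𝒥.J X, Y⁆ + α ⁅X, 𝒥.J Y⁆) := by
    intro X Y
    have := congrArg α (𝒥.integrable X Y)
    simp only [map_sub, map_zero, hα] at this
    linear_combination this
  have skew : ∀ X Y, α ⁅Y, X⁆ = -α ⁅X, Y⁆ := fun X Y ↦ by rw [← lie_skew, map_neg]
  refine ⟨fun i j ↦ -Complex.I / 2 * (α ⁅𝒥.J (e i), e j⁆ + α ⁅e i, 𝒥.J (e j)⁆),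
    fun i j ↦ (α ⁅e i, e j⁆ + Complex.I * α ⁅e i, 𝒥.J (e j)⁆) / 2, ?_, ?_⟩
  · intro i j
    simp only
    rw [skew (e i) (𝒥.J (e j)), skew (𝒥.J (e i))]; ring
  · intro X Y
    have ex : ∀ (β : 𝔤 →ₗ[ℝ] ℂ) Z, β Z = ∑ k, (((θ k Z).re : ℂ) * β (e k)
        + ((θ k Z).im : ℂ) * β (𝒥.J (e k))) := by
      intro β Z
      conv_lhs => rw [hθ.expand Z]
      simp
    have e1 : α ⁅X, Y⁆ = (α ∘ₗ (LieAlgebra.ad ℝ 𝔤 X : 𝔤 →ₗ[ℝ] 𝔤)) Y := rfl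
    have e2 : ∀ Z, (α ∘ₗ (LieAlgebra.ad ℝ 𝔤 X : 𝔤 →ₗ[ℝ] 𝔤)) Z =
        -(α ∘ₗ (LieAlgebra.ad ℝ 𝔤 Z : 𝔤 →ₗ[ℝ] 𝔤)) X := fun Z ↦ skew _ _
    have e3 : ∀ Z W, (α ∘ₗ (LieAlgebra.ad ℝ 𝔤 Z : 𝔤 →ₗ[ℝ] 𝔤)) W = -α ⁅W, Z⁆ := fun Z W ↦ skew _ _
    rw [e1, ex]
    simp only [e2]
    rw [Finset.sum_comm]
    refine Finset.sum_congr rfl fun j _ ↦ ?_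
    rw [ex _ X, ex _ X]
    simp only [e3, ← Finset.sum_neg_distrib, Finset.mul_sum, ← Finset.sum_add_distrib]
    refine Finset.sum_congr rfl fun i _ ↦ ?_
    have k := int (e i) (e j)
    have z1 : θ i X = (θ i X).re + (θ i X).im * Complex.I := (Complex.re_add_im _).symm
    have z2 : θ j Y = (θ j Y).re + (θ j Y).im * Complex.I := (Complex.re_add_im _).symm
    have w1 : star (θ i X) = (θ i X).re - (θ i X).im * Complex.I := by
      apply Complex.ext <;> simp
    have w2 : star (θ j Y) = (θ j Y).re - (θ j Y).im * Complex.I := by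
      apply Complex.ext <;> simp
    rw [skew (𝒥.J (e i)) (e j), skew (e i) (e j), w1, w2]
    generalize (θ i X).re = x at *
    generalize (θ i X).im = y at *
    generalize (θ j Y).re = u at *
    generalize (θ j Y).im = v at *
    rw [z1, z2, k]
    ring_nf
    simp only [Complex.I_sq, show Complex.I ^ 3 = -Complex.I by rw [pow_succ, Complex.I_sq]; ring]
    ring

/-- A nilpotent real-linear map `t ↦ u t + w t̄` of `ℂ` has square zero. -/
theorem sq_add_normSq_eq_zero_of_isNilpotent {u w : ℂ} {T : Module.End ℝ ℂ}
    (hT : ∀ t, T t = u * t + w * star t) (hn : IsNilpotent T) : u ^ 2 + w * star w = 0 := by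
  have h1 := LinearMap.aeval_self_charpoly T
  rw [IsNilpotent.charpoly_eq_X_pow_finrank hn, Complex.finrank_real_complex, map_pow,
    Polynomial.aeval_X] at h1
  have h2 := LinearMap.congr_fun h1 1
  have h3 := LinearMap.congr_fun h1 Complex.I
  simp [pow_two, hT] at h2 h3
  simp only [Complex.star_def]
  linear_combination h2 / 2 - Complex.I * h3 / 2 +
    ((u ^ 2 + w * (starRingEnd ℂ) w) / 2 - (u * w + w * (starRingEnd ℂ) u) / 2) * Complex.I_mul_I

/-- If `ad X` preserves the complex line spanned by the last vector of the frame, it acts on it as a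
nilpotent real-linear map. -/
theorem IsUnitaryCoframe.sq_add_normSq_eq_zero [LieRing.IsNilpotent 𝔤] {h : InvHermitianMetric 𝒥}
    {e : Fin 3 → 𝔤} {θ : Fin 3 → 𝔤 →ₗ[ℝ] ℂ} (hθ : IsUnitaryCoframe h e θ) {X : 𝔤} {u w : ℂ}
    (h0 : ∀ Y, θ 0 Y = 0 → θ 1 Y = 0 → θ 0 ⁅X, Y⁆ = 0)
    (h1 : ∀ Y, θ 0 Y = 0 → θ 1 Y = 0 → θ 1 ⁅X, Y⁆ = 0)
    (h2 : ∀ Y, θ 0 Y = 0 → θ 1 Y = 0 → θ 2 ⁅X, Y⁆ = u * θ 2 Y + w * star (θ 2 Y)) :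
    u ^ 2 + w * star w = 0 := by
  let T : Module.End ℝ ℂ := LinearMap.mulLeft ℝ u +
    LinearMap.mulLeft ℝ w ∘ₗ Complex.conjAe.toLinearMap
  have hT : ∀ t, T t = u * t + w * star t := fun t ↦ rfl
  refine sq_add_normSq_eq_zero_of_isNilpotent hT ?_
  obtain ⟨k, hk⟩ := LieAlgebra.nilpotent_ad_of_nilpotent_algebra ℝ 𝔤
  have it : ∀ n Y, θ 0 Y = 0 → θ 1 Y = 0 → θ 0 ((LieAlgebra.ad ℝ 𝔤 X ^ n) Y) = 0 ∧
      θ 1 ((LieAlgebra.ad ℝ 𝔤 X ^ n) Y) = 0 ∧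
      θ 2 ((LieAlgebra.ad ℝ 𝔤 X ^ n) Y) = (T ^ n) (θ 2 Y) := by
    intro n Y hY0 hY1
    induction n with
    | zero => simp [hY0, hY1]
    | succ n ih =>
      obtain ⟨i0, i1, i2⟩ := ih
      rw [pow_succ', pow_succ', Module.End.mul_apply, Module.End.mul_apply, LieAlgebra.ad_apply]
      exact ⟨h0 _ i0 i1, h1 _ i0 i1, by rw [h2 _ i0 i1, i2, hT]⟩
  refine ⟨k, LinearMap.ext fun z ↦ ?_⟩
  have f0 : θ 0 (e 2) = 0 := by simp [hθ.apply_frame]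
  have f1 : θ 1 (e 2) = 0 := by simp [hθ.apply_frame]
  have f2 : θ 2 (e 2) = 1 := by simp [hθ.apply_frame]
  obtain ⟨-, -, i2⟩ := it k (z.re • e 2 + z.im • 𝒥.J (e 2)) (by simp [f0, hθ.apply_J])
    (by simp [f1, hθ.apply_J])
  have hz : θ 2 (z.re • e 2 + z.im • 𝒥.J (e 2)) = z := by
    rw [map_add, map_smul, map_smul, hθ.apply_J, f2]
    simp [Complex.re_add_im]
  rw [hz, hk X, LinearMap.zero_apply, map_zero] at i2
  simpa using i2.symm

/-- The trace of `ad X`, computed in a unitary frame, vanishes since `ad X` is nilpotent. -/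
theorem IsUnitaryCoframe.trace_ad {h : InvHermitianMetric 𝒥} {e : Fin 3 → 𝔤}
    {θ : Fin 3 → 𝔤 →ₗ[ℝ] ℂ} (hθ : IsUnitaryCoframe h e θ) (he : IsUnitaryFrame h e)
    (hd : Module.finrank ℝ 𝔤 = 6) [LieRing.IsNilpotent 𝔤] (X : 𝔤) :
    ∑ k, ((θ k ⁅X, e k⁆).re + (θ k ⁅X, 𝒥.J (e k)⁆).im) = 0 := by
  have : Module.Finite ℝ 𝔤 := Module.finite_of_finrank_pos (by omega)
  obtain ⟨b, hb⟩ := he.exists_basis hd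
  obtain ⟨k, hk⟩ := LieAlgebra.nilpotent_ad_of_nilpotent_algebra ℝ 𝔤
  have h0 : LinearMap.trace ℝ 𝔤 (LieAlgebra.ad ℝ 𝔤 X) = 0 :=
    (LinearMap.isNilpotent_trace_of_isNilpotent ⟨k, hk X⟩).eq_zero
  have hr : ∀ Z, (b.repr Z : Fin 6 → ℝ) = ![(θ 0 Z).re, (θ 0 Z).im, (θ 1 Z).re, (θ 1 Z).im,
      (θ 2 Z).re, (θ 2 Z).im] := by
    intro Z
    have : Z = ∑ i, ![(θ 0 Z).re, (θ 0 Z).im, (θ 1 Z).re, (θ 1 Z).im,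
      (θ 2 Z).re, (θ 2 Z).im] i • b i := by
      conv_lhs => rw [hθ.expand Z]
      simp only [hb, Fin.sum_univ_three, Fin.sum_univ_six, realFrame]
      simp
      abel
    conv_lhs => rw [this]
    exact b.repr_sum_self _
  rw [LinearMap.trace_eq_matrix_trace ℝ b, Matrix.trace] at h0
  simp only [Matrix.diag_apply, LinearMap.toMatrix_apply, hr, hb, Fin.sum_univ_six, realFrame,
    LieAlgebra.ad_apply] at h0
  simp at h0
  simp only [Fin.sum_univ_three]
  linarith

/-- The structure equations of a nilpotent Lie algebra with complex structure in an adapted unitary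
coframe, with the relations that nilpotency forces on their coefficients. -/
theorem exists_structure_equations [LieRing.IsNilpotent 𝔤] (hd : Module.finrank ℝ 𝔤 = 6)
    (h : InvHermitianMetric 𝒥) :
    ∃ (e : Fin 3 → 𝔤) (θ : Fin 3 → 𝔤 →ₗ[ℝ] ℂ) (a b c d f A12 A13 B11 B12 B13 B21 B22 : ℂ),
      IsUnitaryFrame h e ∧ IsUnitaryCoframe h e θ ∧ (∀ X Y : 𝔤, θ 0 ⁅X, Y⁆ = 0) ∧
      (∀ X Y : 𝔤, θ 1 ⁅X, Y⁆ = -(a * (θ 0 X * θ 1 Y - θ 0 Y * θ 1 X)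
        + b * (θ 0 X * θ 2 Y - θ 0 Y * θ 2 X)
        + c * (θ 0 X * star (θ 0 Y) - θ 0 Y * star (θ 0 X))
        + d * (θ 0 X * star (θ 1 Y) - θ 0 Y * star (θ 1 X))
        + f * (θ 0 X * star (θ 2 Y) - θ 0 Y * star (θ 2 X)))) ∧
      (∀ X Y : 𝔤, θ 2 ⁅X, Y⁆ = -(A12 * (θ 0 X * θ 1 Y - θ 0 Y * θ 1 X)
        + A13 * (θ 0 X * θ 2 Y - θ 0 Y * θ 2 X)
        + B11 * (θ 0 X * star (θ 0 Y) - θ 0 Y * star (θ 0 X))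
        + B12 * (θ 0 X * star (θ 1 Y) - θ 0 Y * star (θ 1 X))
        + B13 * (θ 0 X * star (θ 2 Y) - θ 0 Y * star (θ 2 X))
        + B21 * (θ 1 X * star (θ 0 Y) - θ 1 Y * star (θ 0 X))
        + B22 * (θ 1 X * star (θ 1 Y) - θ 1 Y * star (θ 1 X)))) ∧
      A13 = -a ∧ (b = 0 → f = 0 → A13 = 0 ∧ B13 = 0) := by
  obtain ⟨e, θ, he, hθ, F1, ⟨i, F2, F2'⟩, j, hj, F3⟩ := exists_adapted_frame hd h
  obtain ⟨A, B, hA, h1⟩ := hθ.exists_type_decomposition (hθ.apply_J 1)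
  obtain ⟨C, D, hC, h2⟩ := hθ.exists_type_decomposition (hθ.apply_J 2)
  have f00 : θ 0 (e 0) = 1 := by simp [hθ.apply_frame]
  have f01 : θ 0 (e 1) = 0 := by simp [hθ.apply_frame]
  have f02 : θ 0 (e 2) = 0 := by simp [hθ.apply_frame]
  have f10 : θ 1 (e 0) = 0 := by simp [hθ.apply_frame]
  have f11 : θ 1 (e 1) = 1 := by simp [hθ.apply_frame]
  have f12 : θ 1 (e 2) = 0 := by simp [hθ.apply_frame]
  have f20 : θ 2 (e 0) = 0 := by simp [hθ.apply_frame]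
  have f21 : θ 2 (e 1) = 0 := by simp [hθ.apply_frame]
  have f22 : θ 2 (e 2) = 1 := by simp [hθ.apply_frame]
  have hA0 : ∀ i, A i i = 0 := fun i ↦ by linear_combination (hA i i) / 2
  have hC0 : ∀ i, C i i = 0 := fun i ↦ by linear_combination (hC i i) / 2
  have fr : ∀ (α : 𝔤 →ₗ[ℝ] ℂ) (A B : Fin 3 → Fin 3 → ℂ), (∀ X Y : 𝔤, α ⁅X, Y⁆ =
      ∑ i, ∑ j, (A i j * (θ i X * θ j Y) + B i j * (θ i X * star (θ j Y))
        - B j i * (star (θ i X) * θ j Y))) → ∀ m n, α ⁅e m, e n⁆ = A m n + B m n - B n m ∧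
        α ⁅e m, 𝒥.J (e n)⁆ = Complex.I * (A m n - B m n - B n m) := by
    intro α A B hα m n
    rw [hα, hα]
    fin_cases m <;> fin_cases n <;> simp [Fin.sum_univ_three, hθ.apply_frame, hθ.apply_J] <;> ring
  -- `ad X` is complex linear modulo the next step of the flag, which kills `(1,1)`-coefficients
  have k1 : ∀ m, θ 0 (e m) = 0 → ∀ n, B m n = 0 := by
    intro m hm n
    have := (F2 _ (InvComplexStructure.lie_J_sub_mem_series (F2' _ hm) (e n))).2
    rw [map_sub, hθ.apply_J, (fr _ _ _ h1 m n).1, (fr _ _ _ h1 m n).2] at this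
    linear_combination (Complex.I / 2) * this + B m n * Complex.I_mul_I
  have k2 : A 1 2 = 0 := by
    have := (F2 _ (InvComplexStructure.lie_mem_series (F2' _ f01) (F2' _ f02))).2
    rw [(fr _ _ _ h1 1 2).1, k1 1 f01, k1 2 f02] at this
    simpa using this
  have k3 : ∀ n, D 2 n = 0 := by
    intro n
    have := InvComplexStructure.lie_J_sub_mem_series F3 (e n)
    rw [hj, Submodule.mem_bot] at this
    have := congrArg (θ 2) this
    rw [map_sub, hθ.apply_J, (fr _ _ _ h2 2 n).1, (fr _ _ _ h2 2 n).2, map_zero] at this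
    linear_combination (Complex.I / 2) * this + D 2 n * Complex.I_mul_I
  have H0 : ∀ X Y : 𝔤, θ 0 ⁅X, Y⁆ = 0 := fun X Y ↦ F1 _ (InvComplexStructure.lie_mem_series
    (i := 0) (by rw [InvComplexStructure.series_zero]; trivial)
    (by rw [InvComplexStructure.series_zero]; trivial))
  have H1 : ∀ X Y : 𝔤, θ 1 ⁅X, Y⁆ = -(-A 0 1 * (θ 0 X * θ 1 Y - θ 0 Y * θ 1 X)
        + -A 0 2 * (θ 0 X * θ 2 Y - θ 0 Y * θ 2 X)
        + -B 0 0 * (θ 0 X * star (θ 0 Y) - θ 0 Y * star (θ 0 X))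
        + -B 0 1 * (θ 0 X * star (θ 1 Y) - θ 0 Y * star (θ 1 X))
        + -B 0 2 * (θ 0 X * star (θ 2 Y) - θ 0 Y * star (θ 2 X))) := by
    intro X Y
    rw [h1]
    simp only [Fin.sum_univ_three, hA0, hA 0 1, hA 0 2, hA 1 2, k1 1 f01, k1 2 f02, k2]
    ring
  have H2 : ∀ X Y : 𝔤, θ 2 ⁅X, Y⁆ = -(-C 0 1 * (θ 0 X * θ 1 Y - θ 0 Y * θ 1 X)
        + -C 0 2 * (θ 0 X * θ 2 Y - θ 0 Y * θ 2 X)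
        + -C 1 2 * (θ 1 X * θ 2 Y - θ 1 Y * θ 2 X)
        + -D 0 0 * (θ 0 X * star (θ 0 Y) - θ 0 Y * star (θ 0 X))
        + -D 0 1 * (θ 0 X * star (θ 1 Y) - θ 0 Y * star (θ 1 X))
        + -D 0 2 * (θ 0 X * star (θ 2 Y) - θ 0 Y * star (θ 2 X))
        + -D 1 0 * (θ 1 X * star (θ 0 Y) - θ 1 Y * star (θ 0 X))
        + -D 1 1 * (θ 1 X * star (θ 1 Y) - θ 1 Y * star (θ 1 X))
        + -D 1 2 * (θ 1 X * star (θ 2 Y) - θ 1 Y * star (θ 2 X))) := by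
    intro X Y
    rw [h2]
    simp only [Fin.sum_univ_three, hC0, hC 0 1, hC 0 2, hC 1 2, k3]
    ring
  -- a nilpotent action of a complex line on a complex line is trivial
  have line : ∀ u w : ℂ, u ^ 2 + w * star w = 0 →
      (u * Complex.I) ^ 2 + (w * Complex.I) * star (w * Complex.I) = 0 → u = 0 ∧ w = 0 := by
    intro u w h1 h2
    simp only [star_mul', Complex.star_def, Complex.conj_I] at h1 h2
    have hw : w * (starRingEnd ℂ) w = 0 := by
      linear_combination h1 / 2 + h2 / 2 + (-u ^ 2 + w * (starRingEnd ℂ) w) / 2 * Complex.I_mul_I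
    have hw0 : w = 0 := by simpa using hw
    subst hw0
    exact ⟨by simpa using h1, rfl⟩
  have n1 : C 1 2 = 0 ∧ D 1 2 = 0 := by
    refine line _ _ (hθ.sq_add_normSq_eq_zero (X := e 1) (fun Y _ _ ↦ H0 _ _) ?_ ?_)
      (hθ.sq_add_normSq_eq_zero (X := 𝒥.J (e 1)) (fun Y _ _ ↦ H0 _ _) ?_ ?_)
    all_goals
      intro Y hY0 hY1
      simp only [H1, H2, hY0, hY1, hθ.apply_J, f01, f11, f21, star_zero]
      ring
  have n2 : A 0 2 = 0 → B 0 2 = 0 → C 0 2 = 0 ∧ D 0 2 = 0 := by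
    intro z1 z2
    refine line _ _ (hθ.sq_add_normSq_eq_zero (X := e 0) (fun Y _ _ ↦ H0 _ _) ?_ ?_)
      (hθ.sq_add_normSq_eq_zero (X := 𝒥.J (e 0)) (fun Y _ _ ↦ H0 _ _) ?_ ?_)
    all_goals
      intro Y hY0 hY1
      simp only [H1, H2, hY0, hY1, hθ.apply_J, f00, f10, f20, star_zero, z1, z2]
      ring
  have tr : C 0 2 = -A 0 1 := by
    have t1 := hθ.trace_ad he hd (e 0)
    have t2 := hθ.trace_ad he hd (𝒥.J (e 0))
    simp [Fin.sum_univ_three, H0, H1, H2, hθ.apply_J, f00, f01, f02, f10, f11, f12, f20, f21, f22]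
      at t1 t2
    apply Complex.ext
    · simp; linarith
    · simp; linarith
  refine ⟨e, θ, -A 0 1, -A 0 2, -B 0 0, -B 0 1, -B 0 2, -C 0 1, -C 0 2, -D 0 0, -D 0 1, -D 0 2,
    -D 1 0, -D 1 1, he, hθ, H0, H1, ?_, by rw [tr], ?_⟩
  · intro X Y
    rw [H2, n1.1, n1.2]; ring
  · intro hb hf
    have := n2 (neg_eq_zero.1 hb) (neg_eq_zero.1 hf)
    simp [this]

end StructureEquations

/-! ### Reduction of the structure equations -/

section ReducedBases

variable {𝔤 : Type*} [LieRing 𝔤] [LieAlgebra ℝ 𝔤] {𝒥 : InvComplexStructure 𝔤}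

/-- A `2`-step structure equation with nonzero `ω¹ ∧ ω̄¹`-coefficient can be brought to reduced
form: the shear `ω¹ + (B₂₁ / B₁₁) ω²` removes the `ω² ∧ ω̄¹`-coefficient, and a rescaling of `ω²`
normalises the `ω¹ ∧ ω²`-coefficient. -/
theorem IsUnitaryCoframe.exists_isReducedBasis {h : InvHermitianMetric 𝒥}
    {e : Fin 3 → 𝔤} {θ : Fin 3 → 𝔤 →ₗ[ℝ] ℂ} (hθ : IsUnitaryCoframe h e θ)
    {A12 B11 B12 B21 B22 : ℂ} (h0 : ∀ X Y : 𝔤, θ 0 ⁅X, Y⁆ = 0) (h1 : ∀ X Y : 𝔤, θ 1 ⁅X, Y⁆ = 0)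
    (h2 : ∀ X Y : 𝔤, θ 2 ⁅X, Y⁆ = -(A12 * (θ 0 X * θ 1 Y - θ 0 Y * θ 1 X)
      + B11 * (θ 0 X * star (θ 0 Y) - θ 0 Y * star (θ 0 X))
      + B12 * (θ 0 X * star (θ 1 Y) - θ 0 Y * star (θ 1 X))
      + B21 * (θ 1 X * star (θ 0 Y) - θ 1 Y * star (θ 0 X))
      + B22 * (θ 1 X * star (θ 1 Y) - θ 1 Y * star (θ 1 X))))
    (hB : B11 ≠ 0) : ∃ (η : Fin 3 → 𝔤 →ₗ[ℝ] ℂ) (ρ : ℝ) (B : ℂ) (x y : ℝ),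
      IsReducedBasis 𝒥 η ρ B x y := by
  obtain ⟨s, ρ, hs, hρ, hsρ⟩ : ∃ (s : ℂ) (ρ : ℝ), s ≠ 0 ∧ (ρ = 0 ∨ ρ = 1) ∧ A12 = B11 * s * ρ := by
    by_cases hA : A12 = 0
    · exact ⟨1, 0, one_ne_zero, Or.inl rfl, by simp [hA]⟩
    · exact ⟨A12 / B11, 1, div_ne_zero hA hB, Or.inr rfl, by field_simp; simp⟩
  have hs' : star s ≠ 0 := star_ne_zero.2 hs
  set l := B21 / B11 with hl
  have hl' : B21 = B11 * l := by rw [hl]; field_simp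
  set D := (B22 - B12 * l) / (B11 * s * star s) with hD
  have hD' : (D.re : ℂ) + Complex.I * D.im = D := by rw [mul_comm]; exact Complex.re_add_im D
  refine ⟨![θ 0 + l • θ 1, s • θ 1, B11⁻¹ • θ 2], ρ, (B12 - B11 * star l) / (B11 * star s),
    D.re, D.im, ?_, ?_, hρ, ?_, ?_, ?_⟩
  · intro j X
    fin_cases j <;> simp [hθ.apply_J] <;> ring
  · rw [Fintype.linearIndependent_iff]
    intro g hg
    have hg0 := LinearMap.congr_fun hg (e 0)
    have hg1 := LinearMap.congr_fun hg (e 1)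
    have hg2 := LinearMap.congr_fun hg (e 2)
    simp [Fin.sum_univ_three, hθ.apply_frame] at hg0 hg1 hg2
    simp [hg0, hs] at hg1
    intro i
    fin_cases i
    exacts [hg0, hg1, hg2.resolve_right hB]
  · intro X Y
    simp [invD, h0, h1]
  · intro X Y
    simp [invD, h1]
  · intro X Y
    rw [hD', hD]
    simp only [invD, wedge₁, LinearMap.smul_apply, LinearMap.add_apply, Matrix.cons_val, h2,
      Matrix.cons_val_zero, Matrix.cons_val_one, smul_eq_mul, star_add, star_mul']
    rw [hsρ, hl']
    field_simp
    ring

/-- If `(i/2) ∂∂̄Ω` has negative contraction, then there is a basis of `(1,0)`-forms satisfying the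
reduced equations: negativity makes `B₁₁` and `B₂₂` nonzero, and with `B₂₂ ≠ 0` the Jacobi identity
kills the remaining coefficients of `dω²` and the terms of `dω³` that involve `ω³`. -/
theorem exists_isReducedBasis_of_ddbarTrace_neg [LieRing.IsNilpotent 𝔤]
    (hd : Module.finrank ℝ 𝔤 = 6) {h : InvHermitianMetric 𝒥}
    (hneg : ∀ e, IsUnitaryFrame h e → h.ddbarTrace e < 0) :
    ∃ (η : Fin 3 → 𝔤 →ₗ[ℝ] ℂ) (ρ : ℝ) (B : ℂ) (x y : ℝ), IsReducedBasis 𝒥 η ρ B x y := by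
  obtain ⟨e, θ, a, b, c, d, f, A12, A13, B11, B12, B13, B21, B22, he, hθ, h0, h1, h2, htr, hbf⟩ :=
    exists_structure_equations hd h
  have hS := hneg e he
  rw [hθ.ddbarTrace_eq h0 h1 h2 htr] at hS
  have hre : (B22 * star B11).re ≠ 0 := by
    intro h0
    rw [h0] at hS
    have : 0 ≤ ‖f - B12‖ ^ 2 + ‖b - star B21‖ ^ 2 + ‖A12‖ ^ 2 + 2 * ‖a‖ ^ 2 := by positivity
    linarith
  have hB22 : B22 ≠ 0 := by rintro rfl; simp at hre
  have hB11 : B11 ≠ 0 := by rintro rfl; simp at hre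
  have f00 : θ 0 (e 0) = 1 := by simp [hθ.apply_frame]
  have f01 : θ 0 (e 1) = 0 := by simp [hθ.apply_frame]
  have f02 : θ 0 (e 2) = 0 := by simp [hθ.apply_frame]
  have f10 : θ 1 (e 0) = 0 := by simp [hθ.apply_frame]
  have f11 : θ 1 (e 1) = 1 := by simp [hθ.apply_frame]
  have f12 : θ 1 (e 2) = 0 := by simp [hθ.apply_frame]
  have f20 : θ 2 (e 0) = 0 := by simp [hθ.apply_frame]
  have f21 : θ 2 (e 1) = 0 := by simp [hθ.apply_frame]
  have f22 : θ 2 (e 2) = 1 := by simp [hθ.apply_frame]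
  have jac : ∀ (k : Fin 3) (X Y Z : 𝔤), θ k ⁅⁅X, Y⁆, Z⁆ = θ k ⁅X, ⁅Y, Z⁆⁆ - θ k ⁅Y, ⁅X, Z⁆⁆ :=
    fun k X Y Z ↦ by rw [leibniz_lie X Y Z, map_add, add_sub_cancel_right]
  -- a vector in the kernel of `θ⁰` whose brackets with `e₁`, `J e₁` vanish is killed by `θ¹`
  have van : ∀ W : 𝔤, θ 0 W = 0 → θ 2 ⁅W, e 1⁆ = 0 → θ 2 ⁅W, 𝒥.J (e 1)⁆ = 0 → θ 1 W = 0 := by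
    intro W hW z1 z2
    rw [h2] at z1 z2
    simp [hW, hθ.apply_J, f01, f11, f21, hB22] at z1 z2
    linear_combination z1 / 2 + Complex.I / 2 * z2 +
      (θ 1 W + (starRingEnd ℂ) (θ 1 W)) / 2 * Complex.I_mul_I
  have v1 : b + f = 0 := by
    have := van ⁅e 0, e 2⁆ (h0 _ _)
      (by simp [h0, h1, h2, f00, f01, f02, f10, f11, f12, f20, f21, f22])
      (by simp [h0, h1, h2, f00, f01, f02, f10, f11, f12, f20, f21, f22, hθ.apply_J])
    simp [h1, f00, f02, f10, f12, f20, f22] at this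
    linear_combination -this
  have v2 : b - f = 0 := by
    have := van ⁅e 0, 𝒥.J (e 2)⁆ (h0 _ _)
      (by simp [h0, h1, h2, f00, f01, f02, f10, f11, f12, f20, f21, f22, hθ.apply_J])
      (by simp [h0, h1, h2, f00, f01, f02, f10, f11, f12, f20, f21, f22, hθ.apply_J])
    simp [h1, f00, f02, f10, f12, f20, f22, hθ.apply_J] at this
    linear_combination Complex.I * this + (b - f) * Complex.I_mul_I
  have hb : b = 0 := by linear_combination (v1 + v2) / 2
  have hf : f = 0 := by linear_combination (v1 - v2) / 2
  obtain ⟨hA13, hB13⟩ := hbf hb hf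
  have ha : a = 0 := by linear_combination htr - hA13
  subst ha hb hf hA13 hB13
  simp only [zero_mul, zero_add, add_zero] at h1 h2
  have hd0 : d = 0 := by
    have j1 := jac 1 (e 0) (e 1) (𝒥.J (e 0))
    simp only [h0, h1, hθ.apply_J, f00, f01, f10, f11] at j1
    simp at j1
    have : d * star d = 0 := by
      simp only [Complex.star_def]
      linear_combination Complex.I / 2 * j1 + d * (starRingEnd ℂ) d * Complex.I_mul_I
    simpa using this
  subst hd0
  simp only [zero_mul, add_zero] at h1
  have hc : c = 0 := by
    have := van ⁅e 0, 𝒥.J (e 0)⁆ (h0 _ _)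
      (by simp [h0, h1, h2, f00, f01, f10, hθ.apply_J])
      (by simp [h0, h1, h2, f00, f01, f10, hθ.apply_J])
    simp [h1, f00, hθ.apply_J] at this
    refine this.resolve_right fun h3 ↦ ?_
    have := congrArg Complex.im h3
    norm_num at this
  subst hc
  exact hθ.exists_isReducedBasis h0 (by simpa using h1) h2 hB11

end ReducedBases

/-! ### Hermitian metrics and a reduced basis -/

section MetricsAndReducedBases

variable {𝔤 : Type*} [LieRing 𝔤] [LieAlgebra ℝ 𝔤] {𝒥 : InvComplexStructure 𝔤}

theorem InvComplexStructure.exists_invHermitianMetric [Module.Finite ℝ 𝔤]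
    (𝒥 : InvComplexStructure 𝔤) : Nonempty (InvHermitianMetric 𝒥) := by
  let b := Module.finBasis ℝ 𝔤
  let g : LinearMap.BilinForm ℝ 𝔤 := LinearMap.mk₂ ℝ
    (fun X Y ↦ ∑ i, (b.repr X i * b.repr Y i + b.repr (𝒥.J X) i * b.repr (𝒥.J Y) i))
    (by intros; rw [← Finset.sum_add_distrib]; simp; congr! 1; ring)
    (by intros; simp [Finset.mul_sum]; congr! 1; ring)
    (by intros; rw [← Finset.sum_add_distrib]; simp; congr! 1; ring)
    (by intros; simp [Finset.mul_sum]; congr! 1; ring)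
  have hg : ∀ X Y, g X Y =
    ∑ i, (b.repr X i * b.repr Y i + b.repr (𝒥.J X) i * b.repr (𝒥.J Y) i) := fun X Y ↦ rfl
  refine ⟨⟨g, ?_, ?_, ?_⟩⟩
  · intro X Y
    rw [hg, hg]; congr! 1; ring
  · intro X hX
    rw [hg]
    obtain ⟨i, hi⟩ : ∃ i, b.repr X i ≠ 0 := by
      by_contra! hc
      exact hX (b.repr.map_eq_zero_iff.1 (Finsupp.ext hc))
    exact Finset.sum_pos' (fun i _ ↦ add_nonneg (mul_self_nonneg _) (mul_self_nonneg _))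
      ⟨i, Finset.mem_univ _, add_pos_of_pos_of_nonneg (mul_self_pos.2 hi) (mul_self_nonneg _)⟩
  · intro X Y
    rw [hg, hg]
    congr! 1
    simp [𝒥.sq]; ring

/-- Gram–Schmidt: a reduced basis is triangular with respect to some unitary coframe. -/
theorem IsReducedBasis.exists_triangular_coframe (hd : Module.finrank ℝ 𝔤 = 6)
    {η : Fin 3 → 𝔤 →ₗ[ℝ] ℂ} {ρ : ℝ} {B : ℂ} {x y : ℝ} (hη : IsReducedBasis 𝒥 η ρ B x y)
    (h : InvHermitianMetric 𝒥) :
    ∃ (e : Fin 3 → 𝔤) (θ : Fin 3 → 𝔤 →ₗ[ℝ] ℂ) (p q r u v t : ℂ), IsUnitaryFrame h e ∧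
      IsUnitaryCoframe h e θ ∧ (∀ X, η 0 X = p * θ 0 X) ∧ (∀ X, η 1 X = q * θ 0 X + r * θ 1 X) ∧
      (∀ X, η 2 X = u * θ 0 X + v * θ 1 X + t * θ 2 X) ∧ p ≠ 0 ∧ r ≠ 0 ∧ t ≠ 0 := by
  have : Module.Finite ℝ 𝔤 := Module.finite_of_finrank_pos (by omega)
  classical
  obtain ⟨e₂, he₂, u2⟩ := h.exists_unit_mem (W := LinearMap.ker ((η 0).prod (η 1)))
    (LinearMap.ker_ne_bot_of_finrank_lt (by simp [hd, Complex.finrank_real_complex]))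
  obtain ⟨e₁, he₁, u1⟩ := h.exists_unit_mem
    (W := LinearMap.ker ((η 0).prod ((h.g e₂).prod (h.g (𝒥.J e₂)))))
    (LinearMap.ker_ne_bot_of_finrank_lt (by simp [hd, Complex.finrank_real_complex]))
  simp only [LinearMap.mem_ker, LinearMap.prod_apply, Function.prod_apply,
    Prod.mk_eq_zero] at he₁ he₂
  obtain ⟨e₀, u0, o0⟩ := h.exists_unit_orthogonal
    (W := Submodule.span ℝ (({e₁, 𝒥.J e₁, e₂, 𝒥.J e₂} : Finset 𝔤) : Set 𝔤)) (by
      intro htop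
      have := finrank_span_finset_le_card (R := ℝ) ({e₁, 𝒥.J e₁, e₂, 𝒥.J e₂} : Finset 𝔤)
      rw [Set.finrank, htop, finrank_top] at this
      have := Finset.card_le_four (a := e₁) (b := 𝒥.J e₁) (c := e₂) (d := 𝒥.J e₂)
      omega)
  have hs : ∀ x ∈ ({e₁, 𝒥.J e₁, e₂, 𝒥.J e₂} : Finset 𝔤), h.g e₀ x = 0 := fun x hx ↦
    o0 x (Submodule.subset_span hx)
  have s := h.symm
  have he : IsUnitaryFrame h ![e₀, e₁, e₂] := h.isUnitaryFrame_of u0 u1 u2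
    (by rw [s]; exact hs _ (by simp)) (by rw [s]; exact h.J_orthogonal (hs _ (by simp)))
    (by rw [s]; exact he₁.2.1) (by rw [s]; exact he₁.2.2) (hs _ (by simp)) (hs _ (by simp))
  obtain ⟨θ, hθ⟩ := he.exists_coframe hd
  have ex : ∀ k X, η k X = η k e₀ * θ 0 X + η k e₁ * θ 1 X + η k e₂ * θ 2 X := by
    intro k X
    have : ∀ m, (θ m X : ℂ) = (θ m X).re + (θ m X).im * Complex.I :=
      fun m ↦ (Complex.re_add_im _).symm
    conv_lhs => rw [hθ.expand X]
    simp only [Fin.sum_univ_three, map_add, map_smul, hη.type_one_zero, Complex.real_smul]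
    simp
    linear_combination -(η k e₀) * this 0 - (η k e₁) * this 1 - (η k e₂) * this 2
  have e0 : ∀ X, η 0 X = η 0 e₀ * θ 0 X := fun X ↦ by rw [ex 0 X]; simp [he₁.1, he₂.1]
  have e1 : ∀ X, η 1 X = η 1 e₀ * θ 0 X + η 1 e₁ * θ 1 X := fun X ↦ by rw [ex 1 X]; simp [he₂.2]
  have li := Fintype.linearIndependent_iff.1 hη.linearIndependent
  have hp : η 0 e₀ ≠ 0 := by
    intro h0
    have := li ![1, 0, 0] (LinearMap.ext fun X ↦ by
      simp [Fin.sum_univ_three, (e0 X).trans (by rw [h0, zero_mul])]) 0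
    simp at this
  have hr : η 1 e₁ ≠ 0 := by
    intro h0
    have := li ![η 1 e₀, -η 0 e₀, 0] (LinearMap.ext fun X ↦ by
      simp only [Fin.sum_univ_three, LinearMap.add_apply, LinearMap.smul_apply,
        Matrix.cons_val, Matrix.cons_val_zero, Matrix.cons_val_one, smul_eq_mul,
        LinearMap.zero_apply]
      rw [e0 X, e1 X, h0]
      ring) 1
    simp [hp] at this
  have ht : η 2 e₂ ≠ 0 := by
    intro h0
    have := li ![η 1 e₀ * η 2 e₁ - η 2 e₀ * η 1 e₁, -η 0 e₀ * η 2 e₁, η 0 e₀ * η 1 e₁]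
      (LinearMap.ext fun X ↦ by
        simp only [Fin.sum_univ_three, LinearMap.add_apply, LinearMap.smul_apply,
          Matrix.cons_val, Matrix.cons_val_zero, Matrix.cons_val_one, smul_eq_mul,
          LinearMap.zero_apply]
        rw [e0 X, e1 X, ex 2 X, h0]
        ring) 2
    simp [hp, hr] at this
  exact ⟨_, θ, _, _, _, _, _, _, he, hθ, e0, e1, ex 2, hp, hr, ht⟩

/-- When there is a reduced basis, the contraction of `(i/2) ∂∂̄Ω` has the sign of `ρ + |B|² - 2x`,
whatever the metric. -/
theorem IsReducedBasis.exists_ddbarTrace_eq (hd : Module.finrank ℝ 𝔤 = 6)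
    {η : Fin 3 → 𝔤 →ₗ[ℝ] ℂ} {ρ : ℝ} {B : ℂ} {x y : ℝ} (hη : IsReducedBasis 𝒥 η ρ B x y)
    (h : InvHermitianMetric 𝒥) :
    ∃ e, IsUnitaryFrame h e ∧ ∃ K : ℝ, 0 < K ∧ h.ddbarTrace e = K * (ρ + ‖B‖ ^ 2 - 2 * x) := by
  obtain ⟨e, θ, p, q, r, u, v, t, he, hθ, e0, e1, e2, hp, hr, ht⟩ :=
    hη.exists_triangular_coframe hd h
  refine ⟨e, he, ‖p‖ ^ 2 * ‖r‖ ^ 2 / ‖t‖ ^ 2, by positivity, ?_⟩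
  have d0 := hη.d_one
  have d1 := hη.d_two
  have d2 := hη.d_three
  simp only [invD, neg_eq_zero, wedge₁] at d0 d1 d2
  have h0 : ∀ X Y : 𝔤, θ 0 ⁅X, Y⁆ = 0 := by
    intro X Y
    have := d0 X Y
    rw [e0] at this
    exact (mul_eq_zero.1 this).resolve_left hp
  have h1 : ∀ X Y : 𝔤, θ 1 ⁅X, Y⁆ = 0 := by
    intro X Y
    have := d1 X Y
    rw [e1, h0, mul_zero, zero_add] at this
    exact (mul_eq_zero.1 this).resolve_left hr
  obtain ⟨D, hD⟩ : ∃ D : ℂ, D = x + Complex.I * y := ⟨_, rfl⟩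
  rw [← hD] at d2
  have key := hθ.ddbarTrace_eq (a := 0) (b := 0) (c := 0) (d := 0) (f := 0) (A12 := ρ * p * r / t)
    (A13 := 0) (B11 := (p * star p + B * p * star q + D * q * star q) / t)
    (B12 := (B * p * star r + D * q * star r) / t) (B13 := 0) (B21 := D * r * star q / t)
    (B22 := D * r * star r / t) h0 (fun X Y ↦ by rw [h1]; ring) (fun X Y ↦ by
      have := d2 X Y
      rw [e2, h0, h1] at this
      simp only [e0, e1, star_add, star_mul'] at this
      field_simp
      linear_combination -this) (by simp)
  rw [key, zero_sub, zero_sub, norm_neg, norm_neg, norm_zero]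
  have hρ : ρ ^ 2 = ρ := by rcases hη.rho with h | h <;> simp [h]
  have hn : ∀ z : ℂ, ((‖z‖ ^ 2 : ℝ) : ℂ) = z * star z := fun z ↦ by
    rw [← Complex.normSq_eq_norm_sq, Complex.star_def, Complex.mul_conj]
  have hDs : D + star D = 2 * x := by
    simp [hD]; ring
  have hre : ∀ z : ℂ, ((z.re : ℝ) : ℂ) = (z + star z) / 2 := fun z ↦ by
    rw [Complex.star_def, Complex.add_conj]; push_cast; ring
  have hts : star t ≠ 0 := star_ne_zero.2 ht
  apply Complex.ofReal_injective
  push_cast [hn, hre]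
  have hρ' : (ρ : ℂ) ^ 2 = ρ := by exact_mod_cast hρ
  have hρs : star (ρ : ℂ) = ρ := by simp
  simp only [star_add, star_mul', star_star, star_div₀, hρs]
  field_simp
  linear_combination (p * star p * r * star r) * hρ' - p * star p * r * star r * hDs

/-- A reduced basis separates points. -/
theorem IsReducedBasis.eq_zero_of_apply_eq_zero (hd : Module.finrank ℝ 𝔤 = 6)
    {η : Fin 3 → 𝔤 →ₗ[ℝ] ℂ} {ρ : ℝ} {B : ℂ} {x y : ℝ} (hη : IsReducedBasis 𝒥 η ρ B x y) {X : 𝔤}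
    (hX : ∀ k, η k X = 0) : X = 0 := by
  have : Module.Finite ℝ 𝔤 := Module.finite_of_finrank_pos (by omega)
  obtain ⟨h⟩ := InvComplexStructure.exists_invHermitianMetric 𝒥
  obtain ⟨e, θ, p, q, r, u, v, t, he, hθ, e0, e1, e2, hp, hr, ht⟩ :=
    hη.exists_triangular_coframe hd h
  have t0 : θ 0 X = 0 := by simpa [hp, hX] using e0 X
  have t1 : θ 1 X = 0 := by simpa [hr, hX, t0] using e1 X
  have t2 : θ 2 X = 0 := by simpa [ht, hX, t0, t1] using e2 X
  rw [hθ.expand X]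
  simp [Fin.sum_univ_three, t0, t1, t2]

end MetricsAndReducedBases

/-! ### The Lie algebras with `2x > ρ + |B|²` -/

section Classification

variable {𝔤 : Type*} [LieRing 𝔤] [LieAlgebra ℝ 𝔤] {𝒥 : InvComplexStructure 𝔤}

/-- Linear forms that separate the points of a space form a basis of its dual if there are as many
as the dimension. -/
theorem exists_dual_basis_of_separating {n : ℕ} (hd : Module.finrank ℝ 𝔤 = n)
    (hn : n ≠ 0) (E : Fin n → Module.Dual ℝ 𝔤) (hE : ∀ X, (∀ i, E i X = 0) → X = 0) :
    ∃ b : Module.Basis (Fin n) ℝ (Module.Dual ℝ 𝔤), ∀ i, b i = E i := by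
  have : Module.Finite ℝ 𝔤 := Module.finite_of_finrank_pos (by omega)
  have hinj : Function.Injective (LinearMap.pi E) := by
    rw [← LinearMap.ker_eq_bot, LinearMap.ker_eq_bot']
    exact fun X hX ↦ hE X fun i ↦ congrFun hX i
  let Φ := LinearEquiv.ofInjectiveOfFinrankEq (LinearMap.pi E) hinj (by simp [hd])
  refine ⟨(Module.Basis.ofEquivFun Φ).dualBasis, fun i ↦ LinearMap.ext fun X ↦ ?_⟩
  rw [Module.Basis.coe_dualBasis, Module.Basis.coord_apply, Module.Basis.ofEquivFun_repr_apply]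
  rfl

/-- Real and imaginary parts of a reduced basis whose parameter `B` is real. -/
theorem IsReducedBasis.exists_real_coframe (hd : Module.finrank ℝ 𝔤 = 6)
    {η : Fin 3 → 𝔤 →ₗ[ℝ] ℂ} {ρ b x y : ℝ} (hη : IsReducedBasis 𝒥 η ρ b x y) :
    ∃ f : Fin 6 → Module.Dual ℝ 𝔤, (∀ X, (∀ i, f i X = 0) → X = 0) ∧
      (∀ X Y : 𝔤, f 0 ⁅X, Y⁆ = 0 ∧ f 1 ⁅X, Y⁆ = 0 ∧ f 2 ⁅X, Y⁆ = 0 ∧ f 3 ⁅X, Y⁆ = 0 ∧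
      -f 4 ⁅X, Y⁆ = (ρ + b) * wedge₁ (f 0) (f 2) X Y - (ρ - b) * wedge₁ (f 1) (f 3) X Y
        + 2 * y * wedge₁ (f 2) (f 3) X Y ∧
      -f 5 ⁅X, Y⁆ = -2 * wedge₁ (f 0) (f 1) X Y + (ρ - b) * wedge₁ (f 0) (f 3) X Y
        + (ρ + b) * wedge₁ (f 1) (f 2) X Y - 2 * x * wedge₁ (f 2) (f 3) X Y) := by
  refine ⟨![Complex.reLm ∘ₗ η 0, Complex.imLm ∘ₗ η 0, Complex.reLm ∘ₗ η 1, Complex.imLm ∘ₗ η 1,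
    Complex.reLm ∘ₗ η 2, Complex.imLm ∘ₗ η 2], ?_, ?_⟩
  · intro X hX
    refine hη.eq_zero_of_apply_eq_zero hd fun k ↦ ?_
    fin_cases k
    · exact Complex.ext (hX 0) (hX 1)
    · exact Complex.ext (hX 2) (hX 3)
    · exact Complex.ext (hX 4) (hX 5)
  · intro X Y
    have d0 := hη.d_one X Y
    have d1 := hη.d_two X Y
    have d2 := hη.d_three X Y
    simp only [invD, neg_eq_zero, wedge₁] at d0 d1 d2
    have r := congrArg Complex.re d2
    have i := congrArg Complex.im d2
    simp at r i
    simp [d0, d1, wedge₁]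
    exact ⟨by linarith, by linarith⟩

/-- A change of phase makes the parameter `B` real and nonnegative. -/
theorem IsReducedBasis.exists_norm {η : Fin 3 → 𝔤 →ₗ[ℝ] ℂ} {ρ : ℝ} {B : ℂ} {x y : ℝ}
    (hη : IsReducedBasis 𝒥 η ρ B x y) :
    ∃ η', IsReducedBasis 𝒥 η' ρ (‖B‖ : ℝ) x y := by
  -- `v` is a square root of the phase of `B`; replacing `ω¹, ω²` by `v ω¹, v̄ ω²` preserves
  -- `ω¹ ∧ ω²`
  obtain ⟨v, hv, hvB⟩ : ∃ v : ℂ, v * star v = 1 ∧ (‖B‖ : ℂ) * v ^ 2 = B := by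
    refine ⟨Complex.exp ((B.arg / 2 : ℝ) * Complex.I), ?_, ?_⟩
    · rw [Complex.star_def, Complex.mul_conj, Complex.normSq_eq_norm_sq,
        Complex.norm_exp_ofReal_mul_I]
      simp
    · rw [← Complex.exp_nat_mul]
      conv_rhs => rw [← Complex.norm_mul_exp_arg_mul_I B]
      congr 2
      push_cast; ring
  have hv0 : v ≠ 0 := by rintro rfl; simp at hv
  have hv0' : star v ≠ 0 := star_ne_zero.2 hv0
  refine ⟨![v • η 0, star v • η 1, η 2], ?_, ?_, hη.rho, ?_, ?_, ?_⟩
  · intro j X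
    fin_cases j <;> simp [hη.type_one_zero] <;> ring
  · have := hη.linearIndependent.units_smul ![Units.mk0 v hv0, Units.mk0 _ hv0', 1]
    convert this using 1
    ext j : 1
    fin_cases j
    exacts [rfl, rfl, (one_smul ℂ (η 2)).symm]
  · intro X Y
    have := hη.d_one X Y
    simp only [invD, neg_eq_zero] at this
    simp [invD, this]
  · intro X Y
    have := hη.d_two X Y
    simp only [invD, neg_eq_zero] at this
    simp [invD, this]
  · intro X Y
    have := hη.d_three X Y
    simp only [invD, wedge₁] at this
    simp only [invD, wedge₁, Matrix.cons_val, Matrix.cons_val_zero, Matrix.cons_val_one,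
      LinearMap.smul_apply, smul_eq_mul, star_mul', star_star]
    rw [this]
    linear_combination (-ρ * (η 0 X * η 1 Y - η 0 Y * η 1 X)
      - (η 0 X * star (η 0 Y) - η 0 Y * star (η 0 X))
      - (x + Complex.I * y) * (η 1 X * star (η 1 Y) - η 1 Y * star (η 1 X))) * hv
      - (η 0 X * star (η 1 Y) - η 0 Y * star (η 1 X)) * hvB

/-- The Lie algebra underlying a reduced basis with `2x > ρ + |B|²`. One may take `B = b ≥ 0`. If
`ρ + b = 0`, then `𝔤` is `𝔥₂` or `𝔥₃`. Otherwise put `s = ρ + b`, `m = ρ - b` and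
`Δ = 4x + s m > 0`. The pencil of 2-forms spanned by the real part `α` and the imaginary part `β`
of `dω³` then contains two, one or no real decomposable members, namely `α + (k + τ) β` with
`τ² = κ`, where `k = 2y / Δ` and `κ = k² - s m / Δ`. Accordingly `𝔤` is `𝔥₂`, `𝔥₄` or `𝔥₅`. -/
theorem IsReducedBasis.isH2_or_isH3_or_isH4_or_isH5 (hd : Module.finrank ℝ 𝔤 = 6)
    {η : Fin 3 → 𝔤 →ₗ[ℝ] ℂ} {ρ : ℝ} {B : ℂ} {x y : ℝ} (hη : IsReducedBasis 𝒥 η ρ B x y)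
    (hx : ρ + ‖B‖ ^ 2 < 2 * x) : IsH2 𝔤 ∨ IsH3 𝔤 ∨ IsH4 𝔤 ∨ IsH5 𝔤 := by
  obtain ⟨η', hη'⟩ := hη.exists_norm
  obtain ⟨f, hf, hfd⟩ := hη'.exists_real_coframe hd
  have hb : 0 ≤ ‖B‖ := norm_nonneg B
  have hρ := hη.rho
  generalize ‖B‖ = b at *
  clear hη hη'
  have hρ0 : 0 ≤ ρ := by rcases hρ with h | h <;> simp [h]
  have hρ2 : ρ ^ 2 = ρ := by rcases hρ with h | h <;> simp [h]
  have hx0 : 0 < x := by nlinarith [sq_nonneg b]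
  have mk : ∀ E : Fin 6 → Module.Dual ℝ 𝔤, (∀ X, (∀ i, E i X = 0) → ∀ i, f i X = 0) →
      ∃ b : Module.Basis (Fin 6) ℝ (Module.Dual ℝ 𝔤), ∀ i, b i = E i := fun E hE ↦
    exists_dual_basis_of_separating hd (by norm_num) E fun X hX ↦ hf X (hE X hX)
  rcases (add_nonneg hρ0 hb).eq_or_lt' with hs | hs
  · obtain rfl : ρ = 0 := by linarith
    obtain rfl : b = 0 := by linarith
    by_cases hy : y = 0
    · subst hy
      right; left
      obtain ⟨E, hE⟩ := mk ![f 0, -(2 : ℝ) • f 1, f 2, -(2 * x) • f 3, f 4, f 5] (by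
        intro X hX
        simp [Fin.forall_fin_succ, hx0.ne'] at hX ⊢
        tauto)
      refine ⟨E, fun X Y ↦ ?_⟩
      obtain ⟨h0, h1, h2, h3, h4, h5⟩ := hfd X Y
      simp only [invD, hE]
      simp [h0, h1, h2, h3, wedge₁]
      simp [wedge₁] at h4 h5
      exact ⟨h4, by linear_combination h5⟩
    · left
      obtain ⟨E, hE⟩ := mk ![f 0, -(2 : ℝ) • f 1, f 2, (2 * y) • f 3, f 5 + (x / y) • f 4, f 4] (by
        intro X hX
        simp [Fin.forall_fin_succ, hy] at hX ⊢
        obtain ⟨h0, h1, h2, h3, h4, h5⟩ := hX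
        simp [h5] at h4
        tauto)
      refine ⟨E, fun X Y ↦ ?_⟩
      obtain ⟨h0, h1, h2, h3, h4, h5⟩ := hfd X Y
      simp only [invD, hE]
      simp [h0, h1, h2, h3, wedge₁]
      simp [wedge₁] at h4 h5
      constructor
      · field_simp
        linear_combination x * h4 + y * h5
      · linear_combination h4
  · obtain ⟨s, hs'⟩ : ∃ s, s = ρ + b := ⟨_, rfl⟩
    obtain ⟨m, hm⟩ : ∃ m, m = ρ - b := ⟨_, rfl⟩
    rw [← hs'] at hs
    rw [← hs', ← hm] at hfd
    have hΔ : 0 < 4 * x + s * m := by rw [hs', hm]; nlinarith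
    have hΔ0 := hΔ.ne'
    have hs0 := hs.ne'
    clear hs' hm
    obtain ⟨k, hk⟩ : ∃ k, k = 2 * y / (4 * x + s * m) := ⟨_, rfl⟩
    obtain ⟨κ, hκ⟩ : ∃ κ, κ = k ^ 2 - s * m / (4 * x + s * m) := ⟨_, rfl⟩
    have hk' : 2 * y = k * (4 * x + s * m) := by rw [hk]; field_simp
    have hκ' : s * m = (k ^ 2 - κ) * (4 * x + s * m) := by rw [hκ]; field_simp; ring
    -- with these two forms, `β = f₁ ∧ g₂ + f₃ ∧ g₄`
    set g₂ := -(2 : ℝ) • f 1 + m • f 3 with hg₂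
    set g₄ := -s • f 1 - (2 * x) • f 3 with hg₄
    have sep : ∀ X, g₂ X = 0 → g₄ X = 0 → f 1 X = 0 ∧ f 3 X = 0 := by
      intro X h2 h4
      simp [hg₂, hg₄] at h2 h4
      have h3 : f 3 X = 0 := by
        have : (4 * x + s * m) * f 3 X = 0 := by linear_combination s * h2 - 2 * h4
        exact (mul_eq_zero.1 this).resolve_left hΔ0
      rw [h3] at h2
      exact ⟨by linarith, h3⟩
    -- the member `α + (k + τ) β` of the pencil; the last term vanishes if `τ² = κ`
    have pencil : ∀ (τ : ℝ) (X Y : 𝔤), -(f 4 ⁅X, Y⁆ + (k + τ) * f 5 ⁅X, Y⁆) =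
        wedge₁ ⇑(s • f 2 + (k + τ) • g₂) ⇑(-f 0 + k • g₂ + ((τ - k) / s) • g₄) X Y
          + (κ - τ ^ 2) / s * wedge₁ g₂ g₄ X Y := by
      intro τ X Y
      obtain ⟨-, -, -, -, h4, h5⟩ := hfd X Y
      simp only [wedge₁, hg₂, hg₄, LinearMap.add_apply, LinearMap.sub_apply, LinearMap.smul_apply,
        LinearMap.neg_apply, smul_eq_mul] at h4 h5 ⊢
      field_simp
      linear_combination s * h4 + s * (k + τ) * h5 + s * (f 2 X * f 3 Y - f 2 Y * f 3 X) * hk'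
        - (f 1 X * f 3 Y - f 1 Y * f 3 X) * hκ'
    have im : ∀ X Y : 𝔤, -f 5 ⁅X, Y⁆ = wedge₁ (f 0) g₂ X Y + wedge₁ (f 2) g₄ X Y := by
      intro X Y
      obtain ⟨-, -, -, -, -, h5⟩ := hfd X Y
      simp only [wedge₁, hg₂, hg₄, LinearMap.add_apply, LinearMap.sub_apply, LinearMap.smul_apply,
        smul_eq_mul] at h5 ⊢
      linear_combination h5
    have d2 : ∀ X Y : 𝔤, g₂ ⁅X, Y⁆ = 0 := fun X Y ↦ by
      obtain ⟨h0, h1, h2, h3, -, -⟩ := hfd X Y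
      simp [hg₂, h1, h3]
    have d4 : ∀ X Y : 𝔤, g₄ ⁅X, Y⁆ = 0 := fun X Y ↦ by
      obtain ⟨h0, h1, h2, h3, -, -⟩ := hfd X Y
      simp [hg₄, h1, h3]
    have fin : ∀ X, f 0 X = 0 → f 2 X = 0 → g₂ X = 0 → g₄ X = 0 → f 4 X = 0 → f 5 X = 0 →
        ∀ i, f i X = 0 := by
      intro X z0 z2 w2 w4 z4 z5 i
      obtain ⟨z1, z3⟩ := sep X w2 w4
      fin_cases i <;> assumption
    clear_value g₂ g₄
    rcases lt_trichotomy κ 0 with hκ0 | hκ0 | hκ0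
    · right; right; right
      obtain ⟨t, ht, ht2⟩ : ∃ t : ℝ, t ≠ 0 ∧ t ^ 2 = -κ :=
        ⟨√(-κ), (Real.sqrt_pos.2 (by linarith)).ne', Real.sq_sqrt (by linarith)⟩
      obtain ⟨E, hE⟩ := mk ![s • f 2 + k • g₂, t • g₂, -f 0 + k • g₂ - (k / s) • g₄, (t / s) • g₄,
          f 4 + k • f 5, t • f 5] (by
        intro X hX
        simp [Fin.forall_fin_succ, hs0, ht] at hX
        obtain ⟨h0, h1, h2, h3, h4, h5⟩ := hX
        simp [h1, h3, h5, hs0] at h0 h2 h4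
        exact fin X h2 h0 h1 h3 h4 h5)
      refine ⟨E, fun X Y ↦ ?_⟩
      obtain ⟨h0, h1, h2, h3, -, -⟩ := hfd X Y
      have p := pencil 0 X Y
      have q := im X Y
      simp [wedge₁] at p q
      simp only [invD, hE]
      simp [h0, h2, d2, d4, wedge₁]
      constructor
      · have e : t * (t / s) = -κ / s := by rw [← ht2]; ring
        linear_combination p - (g₂ Y * g₄ X - g₂ X * g₄ Y) * e
      · field_simp
        linear_combination s * q
    · right; right; left
      obtain ⟨E, hE⟩ := mk ![s • f 2 + k • g₂, -f 0 + k • g₂ - (k / s) • g₄, -g₂, s⁻¹ • g₄,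
          f 4 + k • f 5, f 5] (by
        intro X hX
        simp [Fin.forall_fin_succ, hs0] at hX
        obtain ⟨h0, h1, h2, h3, h4, h5⟩ := hX
        simp [h2, h3, h5, hs0] at h0 h1 h4
        exact fin X h1 h0 h2 h3 h4 h5)
      refine ⟨E, fun X Y ↦ ?_⟩
      obtain ⟨h0, h1, h2, h3, -, -⟩ := hfd X Y
      have p := pencil 0 X Y
      have q := im X Y
      simp [wedge₁, hκ0] at p q
      simp only [invD, hE]
      simp [h0, h2, d2, d4, wedge₁]
      constructor
      · linear_combination p
      · field_simp
        linear_combination s * q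
    · left
      obtain ⟨t, ht, ht2⟩ : ∃ t : ℝ, t ≠ 0 ∧ t ^ 2 = κ :=
        ⟨√κ, (Real.sqrt_pos.2 hκ0).ne', Real.sq_sqrt hκ0.le⟩
      obtain ⟨E, hE⟩ := mk ![s • f 2 + (k + t) • g₂, -f 0 + k • g₂ + ((t - k) / s) • g₄,
          s • f 2 + (k + -t) • g₂, -f 0 + k • g₂ + ((-t - k) / s) • g₄,
          f 4 + (k + t) • f 5, f 4 + (k + -t) • f 5] (by
        intro X hX
        simp [Fin.forall_fin_succ] at hX
        obtain ⟨h0, h1, h2, h3, h4, h5⟩ := hX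
        have w2 : g₂ X = 0 := by
          have : t * g₂ X = 0 := by linear_combination (h0 - h2) / 2
          exact (mul_eq_zero.1 this).resolve_left ht
        have w4 : g₄ X = 0 := by
          have : t / s * g₄ X = 0 := by linear_combination (h1 - h3) / 2
          exact (mul_eq_zero.1 this).resolve_left (div_ne_zero ht hs0)
        have w5 : f 5 X = 0 := by
          have : t * f 5 X = 0 := by linear_combination (h4 - h5) / 2
          exact (mul_eq_zero.1 this).resolve_left ht
        simp [w2, w4, w5, hs0] at h0 h1 h4
        exact fin X h1 h0 w2 w4 h4 w5)
      refine ⟨E, fun X Y ↦ ?_⟩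
      obtain ⟨h0, h1, h2, h3, -, -⟩ := hfd X Y
      have p := pencil t X Y
      have q := pencil (-t) X Y
      simp only [neg_sq, ht2, sub_self, zero_div, zero_mul, add_zero] at p q
      simp only [invD, hE]
      refine ⟨?_, ?_, ?_, ?_, p, q⟩ <;> simp [h0, h2, d2, d4]

end Classification

/-! ### Realization of the reduced equations -/

section Realizations

variable {𝔤 : Type*} [LieRing 𝔤] [LieAlgebra ℝ 𝔤]

/-- Three complex-valued forms that are jointly injective and satisfy the reduced equations are
the `(1,0)`-forms of a unique almost complex structure; it is integrable since the equations have no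
`(0,2)`-components. -/
theorem exists_isReducedBasis_of_separating (hd : Module.finrank ℝ 𝔤 = 6)
    {η : Fin 3 → 𝔤 →ₗ[ℝ] ℂ} {ρ : ℝ} {B : ℂ} {x y : ℝ}
    (hη : ∀ X, (∀ k, η k X = 0) → X = 0) (hρ : ρ = 0 ∨ ρ = 1)
    (h0 : ∀ X Y, invD (η 0) X Y = 0) (h1 : ∀ X Y, invD (η 1) X Y = 0)
    (h2 : ∀ X Y, invD (η 2) X Y = ρ * wedge₁ (η 0) (η 1) X Y
      + wedge₁ (η 0) (fun Z ↦ star (η 0 Z)) X Y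
      + B * wedge₁ (η 0) (fun Z ↦ star (η 1 Z)) X Y
      + (x + Complex.I * y) * wedge₁ (η 1) (fun Z ↦ star (η 1 Z)) X Y) :
    ∃ 𝒥 : InvComplexStructure 𝔤, IsReducedBasis 𝒥 η ρ B x y := by
  have : Module.Finite ℝ 𝔤 := Module.finite_of_finrank_pos (by omega)
  have hinj : Function.Injective (LinearMap.pi η) := by
    rw [← LinearMap.ker_eq_bot, LinearMap.ker_eq_bot']
    exact fun X hX ↦ hη X fun i ↦ congrFun hX i
  let Φ := LinearEquiv.ofInjectiveOfFinrankEq (LinearMap.pi η) hinj (by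
    simp [hd, Module.finrank_pi_fintype, Complex.finrank_real_complex])
  have hΦ : ∀ X k, Φ X k = η k X := fun X k ↦ rfl
  let J : 𝔤 →ₗ[ℝ] 𝔤 := Φ.symm.toLinearMap ∘ₗ
    ((Complex.I • LinearMap.id : (Fin 3 → ℂ) →ₗ[ℂ] (Fin 3 → ℂ)).restrictScalars ℝ) ∘ₗ Φ.toLinearMap
  have hJ : ∀ k X, η k (J X) = Complex.I * η k X := by
    intro k X
    rw [← hΦ, ← hΦ]
    simp [J]
  simp only [invD, neg_eq_zero, wedge₁] at h0 h1 h2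
  have h2' : ∀ X Y : 𝔤, η 2 ⁅X, Y⁆ = -(ρ * (η 0 X * η 1 Y - η 0 Y * η 1 X)
      + (η 0 X * star (η 0 Y) - η 0 Y * star (η 0 X))
      + B * (η 0 X * star (η 1 Y) - η 0 Y * star (η 1 X))
      + (x + Complex.I * y) * (η 1 X * star (η 1 Y) - η 1 Y * star (η 1 X))) := by
    intro X Y; rw [← h2, neg_neg]
  refine ⟨⟨J, ?_, ?_⟩, hJ, ?_, hρ, ?_, ?_, ?_⟩
  · intro X
    rw [← sub_eq_zero]
    refine hη _ fun k ↦ ?_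
    rw [map_sub, map_neg, hJ, hJ]
    linear_combination η k X * Complex.I_mul_I
  · intro X Y
    refine hη _ fun k ↦ ?_
    simp only [map_sub, hJ]
    fin_cases k
    · simp [h0]
    · simp [h1]
    · simp only [Fin.reduceFinMk, h2', hJ, star_mul', Complex.star_def, Complex.conj_I]
      ring_nf
      simp only [Complex.I_sq, show Complex.I ^ 3 = -Complex.I by rw [pow_succ, Complex.I_sq]; ring]
      ring
  · rw [Fintype.linearIndependent_iff]
    intro g hg k
    have := LinearMap.congr_fun hg (Φ.symm (Pi.single k 1))
    have e : ∀ m, η m (Φ.symm (Pi.single k 1)) = (Pi.single k 1 : Fin 3 → ℂ) m := fun m ↦ by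
      rw [← hΦ, LinearEquiv.apply_symm_apply]
    simpa [e, Pi.single_apply] using this
  · intro X Y; simp [invD, h0]
  · intro X Y; simp [invD, h1]
  · exact h2

/-- The real form of the reduced equations, for `ω¹ = f₀ + i f₁`, `ω² = f₂ + i f₃`,
`ω³ = f₄ + i f₅` and real `B = b`. -/
theorem exists_isReducedBasis_of_real_coframe (hd : Module.finrank ℝ 𝔤 = 6)
    {f : Fin 6 → Module.Dual ℝ 𝔤} {ρ b x y : ℝ} (hf : ∀ X, (∀ i, f i X = 0) → X = 0)
    (hρ : ρ = 0 ∨ ρ = 1)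
    (hfd : ∀ X Y : 𝔤, f 0 ⁅X, Y⁆ = 0 ∧ f 1 ⁅X, Y⁆ = 0 ∧ f 2 ⁅X, Y⁆ = 0 ∧ f 3 ⁅X, Y⁆ = 0 ∧
      -f 4 ⁅X, Y⁆ = (ρ + b) * wedge₁ (f 0) (f 2) X Y - (ρ - b) * wedge₁ (f 1) (f 3) X Y
        + 2 * y * wedge₁ (f 2) (f 3) X Y ∧
      -f 5 ⁅X, Y⁆ = -2 * wedge₁ (f 0) (f 1) X Y + (ρ - b) * wedge₁ (f 0) (f 3) X Y
        + (ρ + b) * wedge₁ (f 1) (f 2) X Y - 2 * x * wedge₁ (f 2) (f 3) X Y) :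
    ∃ (𝒥 : InvComplexStructure 𝔤) (η : Fin 3 → 𝔤 →ₗ[ℝ] ℂ), IsReducedBasis 𝒥 η ρ b x y := by
  let c : Module.Dual ℝ 𝔤 → Module.Dual ℝ 𝔤 → 𝔤 →ₗ[ℝ] ℂ := fun u v ↦
    Complex.ofRealCLM.toLinearMap ∘ₗ u + Complex.I • (Complex.ofRealCLM.toLinearMap ∘ₗ v)
  have hc : ∀ u v X, c u v X = (u X : ℂ) + Complex.I * (v X : ℂ) := fun u v X ↦ by simp [c]
  have hc0 : ∀ u v X, c u v X = 0 → u X = 0 ∧ v X = 0 := by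
    intro u v X h
    rw [hc] at h
    exact ⟨by simpa using congrArg Complex.re h, by simpa using congrArg Complex.im h⟩
  suffices ∃ 𝒥 : InvComplexStructure 𝔤,
      IsReducedBasis 𝒥 ![c (f 0) (f 1), c (f 2) (f 3), c (f 4) (f 5)] ρ b x y from
    let ⟨𝒥, h⟩ := this; ⟨𝒥, _, h⟩
  refine exists_isReducedBasis_of_separating hd ?_ hρ ?_ ?_ ?_
  · intro X hX
    obtain ⟨z0, z1⟩ := hc0 _ _ _ (hX 0)
    obtain ⟨z2, z3⟩ := hc0 _ _ _ (hX 1)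
    obtain ⟨z4, z5⟩ := hc0 _ _ _ (hX 2)
    refine hf X fun i ↦ ?_
    fin_cases i <;> assumption
  · intro X Y
    obtain ⟨z0, z1, z2, z3, -, -⟩ := hfd X Y
    simp [invD, hc, z0, z1]
  · intro X Y
    obtain ⟨z0, z1, z2, z3, -, -⟩ := hfd X Y
    simp [invD, hc, z2, z3]
  · intro X Y
    obtain ⟨-, -, -, -, z4, z5⟩ := hfd X Y
    simp only [wedge₁] at z4 z5
    simp only [invD, wedge₁, Matrix.cons_val, Matrix.cons_val_zero, Matrix.cons_val_one, hc]
    apply Complex.ext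
    · simp
      linarith
    · simp
      linarith

theorem apply_eq_zero_of_dual_basis [Module.Finite ℝ 𝔤] {ι : Type*}
    (e : Module.Basis ι ℝ (Module.Dual ℝ 𝔤)) {X : 𝔤} (hX : ∀ i, e i X = 0) : X = 0 := by
  rw [← Module.forall_dual_apply_eq_zero_iff ℝ X]
  intro φ
  have : Module.Dual.eval ℝ 𝔤 X = 0 := e.ext fun i ↦ by simp [hX]
  exact LinearMap.congr_fun this φ

theorem IsH2.exists_isReducedBasis (hd : Module.finrank ℝ 𝔤 = 6) (h : IsH2 𝔤) :
    ∃ (𝒥 : InvComplexStructure 𝔤) (η : Fin 3 → 𝔤 →ₗ[ℝ] ℂ),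
      IsReducedBasis 𝒥 η 0 (0 : ℝ) 1 1 := by
  have : Module.Finite ℝ 𝔤 := Module.finite_of_finrank_pos (by omega)
  obtain ⟨e, he⟩ := h
  refine exists_isReducedBasis_of_real_coframe hd (f := ![e 0, e 1, e 2, e 3, (2 : ℝ) • e 5,
    -(2 : ℝ) • e 4 - (2 : ℝ) • e 5]) ?_ (Or.inl rfl) ?_
  · intro X hX
    refine apply_eq_zero_of_dual_basis e ?_
    simp [Fin.forall_fin_succ] at hX ⊢
    obtain ⟨h0, h1, h2, h3, h4, h5⟩ := hX
    exact ⟨h0, h1, h2, h3, by linarith, h4⟩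
  · intro X Y
    obtain ⟨h0, h1, h2, h3, h4, h5⟩ := he X Y
    simp only [invD, neg_eq_zero] at h0 h1 h2 h3 h4 h5
    refine ⟨h0, h1, h2, h3, ?_, ?_⟩
    · simp [wedge₁] at h4 h5 ⊢; linarith
    · simp [wedge₁] at h4 h5 ⊢; linarith

theorem IsH3.exists_isReducedBasis (hd : Module.finrank ℝ 𝔤 = 6) (h : IsH3 𝔤) :
    ∃ (𝒥 : InvComplexStructure 𝔤) (η : Fin 3 → 𝔤 →ₗ[ℝ] ℂ),
      IsReducedBasis 𝒥 η 0 (0 : ℝ) 1 0 := by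
  have : Module.Finite ℝ 𝔤 := Module.finite_of_finrank_pos (by omega)
  obtain ⟨e, he⟩ := h
  refine exists_isReducedBasis_of_real_coframe hd (f := ![e 0, e 1, e 2, e 3, e 4,
    -(2 : ℝ) • e 5]) ?_ (Or.inl rfl) ?_
  · intro X hX
    refine apply_eq_zero_of_dual_basis e ?_
    simpa [Fin.forall_fin_succ] using hX
  · intro X Y
    obtain ⟨h0, h1, h2, h3, h4, h5⟩ := he X Y
    simp only [invD, neg_eq_zero] at h0 h1 h2 h3 h4 h5
    refine ⟨h0, h1, h2, h3, ?_, ?_⟩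
    · simp [h4]
    · simp [wedge₁] at h5 ⊢; linarith

theorem IsH4.exists_isReducedBasis (hd : Module.finrank ℝ 𝔤 = 6) (h : IsH4 𝔤) :
    ∃ (𝒥 : InvComplexStructure 𝔤) (η : Fin 3 → 𝔤 →ₗ[ℝ] ℂ),
      IsReducedBasis 𝒥 η 1 (1 : ℝ) 2 0 := by
  have : Module.Finite ℝ 𝔤 := Module.finite_of_finrank_pos (by omega)
  obtain ⟨e, he⟩ := h
  refine exists_isReducedBasis_of_real_coframe hd (f := ![e 0, -e 3, e 1,
    (1 / 2 : ℝ) • (e 3 - e 2), (2 : ℝ) • e 4, (2 : ℝ) • e 5]) ?_ (Or.inr rfl) ?_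
  · intro X hX
    refine apply_eq_zero_of_dual_basis e ?_
    simp [Fin.forall_fin_succ] at hX ⊢
    obtain ⟨h0, h1, h2, h3, h4, h5⟩ := hX
    exact ⟨h0, h2, by linarith, h1, h4, h5⟩
  · intro X Y
    obtain ⟨h0, h1, h2, h3, h4, h5⟩ := he X Y
    simp only [invD, neg_eq_zero] at h0 h1 h2 h3 h4 h5
    refine ⟨h0, by simp [h3], h1, by simp [h2, h3], ?_, ?_⟩
    · simp [wedge₁] at h4 h5 ⊢; linarith
    · simp [wedge₁] at h4 h5 ⊢; linarith

theorem IsH5.exists_isReducedBasis (hd : Module.finrank ℝ 𝔤 = 6) (h : IsH5 𝔤) :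
    ∃ (𝒥 : InvComplexStructure 𝔤) (η : Fin 3 → 𝔤 →ₗ[ℝ] ℂ),
      IsReducedBasis 𝒥 η 1 (0 : ℝ) 2 0 := by
  have : Module.Finite ℝ 𝔤 := Module.finite_of_finrank_pos (by omega)
  obtain ⟨e, he⟩ := h
  refine exists_isReducedBasis_of_real_coframe hd (f := ![-e 2 - (1 / 2 : ℝ) • e 0,
    -(1 / 3 : ℝ) • e 3 - (3 / 2 : ℝ) • e 1, e 0, -(2 / 3 : ℝ) • e 3, e 4, (3 : ℝ) • e 5])
    ?_ (Or.inr rfl) ?_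
  · intro X hX
    refine apply_eq_zero_of_dual_basis e ?_
    simp [Fin.forall_fin_succ] at hX ⊢
    obtain ⟨h0, h1, h2, h3, h4, h5⟩ := hX
    exact ⟨h2, by linarith, by linarith, h3, h4, h5⟩
  · intro X Y
    obtain ⟨h0, h1, h2, h3, h4, h5⟩ := he X Y
    simp only [invD, neg_eq_zero] at h0 h1 h2 h3 h4 h5
    refine ⟨by simp [h0, h2], by simp [h1, h3], h0, by simp [h3], ?_, ?_⟩
    · simp [wedge₁] at h4 h5 ⊢; linarith
    · simp [wedge₁] at h4 h5 ⊢; linarith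

end Realizations

/-! ### Nilmanifolds with invariant metrics of negative `γ₁` -/

section Conclusion

variable {G : Type*} [TopologicalSpace G] [ChartedSpace (EuclideanSpace ℝ (Fin 6)) G] [Group G]
  [LieGroup (𝓡 6) ∞ G] {Γ : Subgroup G} {𝒥 : InvComplexStructure (GroupLieAlgebra (𝓡 6) G)}

omit [LieGroup (𝓡 6) ∞ G] in
theorem finrank_groupLieAlgebra : Module.finrank ℝ (GroupLieAlgebra (𝓡 6) G) = 6 :=
  finrank_euclideanSpace_fin

theorem IsReducedBasis.admitsNegativeGamma₁_iff
    [CompactSpace (Quotient (QuotientGroup.rightRel Γ))]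
    {η : Fin 3 → GroupLieAlgebra (𝓡 6) G →ₗ[ℝ] ℂ} {ρ : ℝ} {B : ℂ} {x y : ℝ}
    (hη : IsReducedBasis 𝒥 η ρ B x y) :
    AdmitsNegativeGamma₁ Γ 𝒥 ↔ ρ + ‖B‖ ^ 2 < 2 * x := by
  have hd := finrank_groupLieAlgebra (G := G)
  have : Module.Finite ℝ (GroupLieAlgebra (𝓡 6) G) := Module.finite_of_finrank_pos (by omega)
  constructor
  · rintro ⟨h, γ, hγ, hneg⟩
    obtain ⟨e, he, K, hK, htr⟩ := hη.exists_ddbarTrace_eq hd h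
    have := hγ.ddbarTrace_le he
    rw [htr] at this
    by_contra! hle
    have := mul_nonneg hK.le (sub_nonneg.2 hle)
    linarith
  · intro hx
    obtain ⟨h⟩ := InvComplexStructure.exists_invHermitianMetric 𝒥
    obtain ⟨e, he, K, hK, htr⟩ := hη.exists_ddbarTrace_eq hd h
    refine ⟨h, _, isGamma₁_ddbarTrace Γ he, ?_⟩
    rw [htr]
    have := mul_neg_of_pos_of_neg hK (sub_neg.2 hx)
    linarith

theorem AdmitsNegativeGamma₁.exists_isReducedBasis
    [LieRing.IsNilpotent (GroupLieAlgebra (𝓡 6) G)]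
    [CompactSpace (Quotient (QuotientGroup.rightRel Γ))] (hn : AdmitsNegativeGamma₁ Γ 𝒥) :
    ∃ (η : Fin 3 → GroupLieAlgebra (𝓡 6) G →ₗ[ℝ] ℂ) (ρ : ℝ) (B : ℂ) (x y : ℝ),
      IsReducedBasis 𝒥 η ρ B x y := by
  obtain ⟨h, γ, hγ, hneg⟩ := hn
  refine exists_isReducedBasis_of_ddbarTrace_neg finrank_groupLieAlgebra (h := h) fun e he ↦ ?_
  have := hγ.ddbarTrace_le he
  linarith

end Conclusion

theorem mainTheorem4 {G : Type*} [TopologicalSpace G]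
    [ChartedSpace (EuclideanSpace ℝ (Fin 6)) G] [Group G] [LieGroup (𝓡 6) ∞ G]
    [SimplyConnectedSpace G] [LieRing.IsNilpotent (GroupLieAlgebra (𝓡 6) G)]
    (Γ : Subgroup G) [DiscreteTopology Γ]
    [CompactSpace (Quotient (QuotientGroup.rightRel Γ))] :
    ((∃ 𝒥 : InvComplexStructure (GroupLieAlgebra (𝓡 6) G), AdmitsNegativeGamma₁ Γ 𝒥) ↔
      (IsH2 (GroupLieAlgebra (𝓡 6) G) ∨ IsH3 (GroupLieAlgebra (𝓡 6) G) ∨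
        IsH4 (GroupLieAlgebra (𝓡 6) G) ∨ IsH5 (GroupLieAlgebra (𝓡 6) G))) ∧
    (∀ 𝒥 : InvComplexStructure (GroupLieAlgebra (𝓡 6) G),
      (AdmitsNegativeGamma₁ Γ 𝒥 ↔
        ∃ (η : Fin 3 → GroupLieAlgebra (𝓡 6) G →ₗ[ℝ] ℂ) (ρ : ℝ) (B : ℂ) (x y : ℝ),
          IsReducedBasis 𝒥 η ρ B x y ∧ ρ + ‖B‖ ^ 2 < 2 * x) ∧
      ∀ (η : Fin 3 → GroupLieAlgebra (𝓡 6) G →ₗ[ℝ] ℂ) (ρ : ℝ) (B : ℂ) (x y : ℝ),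
        IsReducedBasis 𝒥 η ρ B x y →
          (AdmitsNegativeGamma₁ Γ 𝒥 ↔ ρ + ‖B‖ ^ 2 < 2 * x)) := by
  have hd := finrank_groupLieAlgebra (G := G)
  have key : ∀ 𝒥 : InvComplexStructure (GroupLieAlgebra (𝓡 6) G), AdmitsNegativeGamma₁ Γ 𝒥 ↔
      ∃ (η : Fin 3 → GroupLieAlgebra (𝓡 6) G →ₗ[ℝ] ℂ) (ρ : ℝ) (B : ℂ) (x y : ℝ),
        IsReducedBasis 𝒥 η ρ B x y ∧ ρ + ‖B‖ ^ 2 < 2 * x := by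
    refine fun 𝒥 ↦ ⟨fun hn ↦ ?_, ?_⟩
    · obtain ⟨η, ρ, B, x, y, hη⟩ := hn.exists_isReducedBasis
      exact ⟨η, ρ, B, x, y, hη, hη.admitsNegativeGamma₁_iff.1 hn⟩
    · rintro ⟨η, ρ, B, x, y, hη, hx⟩
      exact hη.admitsNegativeGamma₁_iff.2 hx
  refine ⟨⟨?_, ?_⟩, fun 𝒥 ↦ ⟨key 𝒥, fun η ρ B x y hη ↦ hη.admitsNegativeGamma₁_iff⟩⟩
  · rintro ⟨𝒥, hn⟩
    obtain ⟨η, ρ, B, x, y, hη, hx⟩ := (key 𝒥).1 hn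
    exact hη.isH2_or_isH3_or_isH4_or_isH5 hd hx
  · rintro (h | h | h | h)
    all_goals
      obtain ⟨𝒥, η, hη⟩ := h.exists_isReducedBasis hd
      exact ⟨𝒥, hη.admitsNegativeGamma₁_iff.2 (by norm_num)⟩
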